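/- **Theorem 4.1.** Let $n,m\in\mathbb N=\{1,2,\dots\}$, $1\le p<\infty$ and $\sigma>0$. Let $B=\{x\in\mathbb R^n:|x|<1\}$ be the open Euclidean unit ball, let $L_p(B)$ be the complex Lebesgue space, let $C_0^m(B)$ be the space of complex-valued $C^m$ functions with compact support in $B$, and let $E^m_{p,\sigma}(B)$ be the completion of $C_0^m(B)$ with respect to the norm $$\|f\,|\,E^m_{p,\sigma}(B)\|=\Big(\int_B |x|^{mp}\,(1+|\log|x||)^{\sigma p}\sum_{|\alpha|=m}|D^\alpha f(x)|^p\,dx\Big)^{1/p}.$$ Then the inclusion $C_0^m(B)\subset L_p(B)$ extends (uniquely) to an injective bounded linear operator $\mathrm{id}:E^m_{p,\sigma}(B)\hookrightarrow L_p(B)$. This embedding is compact, and its entropy numbers $$e_k(\mathrm{id})=\inf\Big\{\varepsilon>0:\ \exists\,y_1,\dots,y_{2^{k-1}}\in L_p(B)\ \text{ with }\ \mathrm{id}\big(\{f:\|f\,|\,E^m_{p,\sigma}(B)\|\le1\}\big)\subseteq\bigcup_{i=1}^{2^{k-1}}\{y\in L_p(B):\|y-y_i\,|\,L_p(B)\|<\varepsilon\}\Big\},\qquad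 k\in\mathbb N,$$ satisfy $$e_k(\mathrm{id})\sim\begin{cases}k^{-m/n} & \text{if }\sigma>\frac mn \quad(k\ge1),\\[2pt] k^{-m/n}(\log k)^{m/n} & \text{if }\sigma=\frac mn\quad(k\ge2),\\[2pt] k^{-\sigma} & \text{if }0<\sigma<\frac mn\quad(k\ge1).\end{cases}$$ Here $a_k\sim b_k$ means that there are constants $c_1,c_2>0$, independent of $k$ (they may depend on $n,m,p,\sigma$), such that $c_1b_k\le a_k\le c_2b_k$ for all indicated $k$. -/

import Mathlib

open MeasureTheory Set
open scoped Distributions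

noncomputable section

/-- The open unit ball `B` of `ℝⁿ`, with the Euclidean norm. -/
def unitBall (n : ℕ) : TopologicalSpace.Opens (EuclideanSpace ℝ (Fin n)) :=
  ⟨Metric.ball 0 1, Metric.isOpen_ball⟩

/-- The classical partial derivative `D^α f (x)` for a multi-index `α`: the derivative of
order `|α| = ∑ i, α i` of `f` at `x`, evaluated on the list of coordinate directions in which
`e_i` occurs exactly `α i` times. -/
def multiDeriv {n : ℕ} (α : Fin n → ℕ) (f : EuclideanSpace ℝ (Fin n) → ℂ)
    (x : EuclideanSpace ℝ (Fin n)) : ℂ :=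
  iteratedFDeriv ℝ (∑ i, α i) f x
    fun j => EuclideanSpace.single (finSigmaFinEquiv.symm j).1 (1 : ℝ)

/-- The norm
`(∫_B |x|^(mp) (1 + |log |x||)^(σp) ∑_{|α| = m} |D^α f(x)|^p dx)^(1/p)`. -/
def eNorm (n m : ℕ) (p σ : ℝ) (f : EuclideanSpace ℝ (Fin n) → ℂ) : ℝ :=
  (∫ x in (unitBall n : Set (EuclideanSpace ℝ (Fin n))),
    ‖x‖ ^ ((m : ℝ) * p) * (1 + |Real.log ‖x‖|) ^ (σ * p) *
      ∑ α ∈ Finset.Nat.antidiagonalTuple n m, ‖multiDeriv α f x‖ ^ p) ^ (1 / p)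

/-- The space `C₀^m(B)` of complex-valued `C^m` functions with compact support in `B`, as a
synonym of Mathlib's test functions, which will carry the norm `eNorm n m p σ`. -/
def CZero (n m : ℕ) (_p _σ : ℝ) : Type := 𝓓^{(m : ℕ∞)}(unitBall n, ℂ)

namespace CZero

variable {n m : ℕ} {p σ : ℝ}

instance : AddCommGroup (CZero n m p σ) :=
  inferInstanceAs (AddCommGroup 𝓓^{(m : ℕ∞)}(unitBall n, ℂ))

instance : Module ℂ (CZero n m p σ) :=
  inferInstanceAs (Module ℂ 𝓓^{(m : ℕ∞)}(unitBall n, ℂ))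

instance : CoeFun (CZero n m p σ) fun _ => EuclideanSpace ℝ (Fin n) → ℂ :=
  ⟨fun φ => TestFunction.toFun φ⟩

lemma contDiff (φ : CZero n m p σ) : ContDiff ℝ m φ := TestFunction.contDiff' φ

lemma multiDeriv_add (φ ψ : CZero n m p σ) {α : Fin n → ℕ} (hα : ∑ i, α i = m)
    (x : EuclideanSpace ℝ (Fin n)) :
    multiDeriv α (φ + ψ : CZero n m p σ) x = multiDeriv α φ x + multiDeriv α ψ x := by
  subst hα
  change iteratedFDeriv ℝ _
    ((φ : EuclideanSpace ℝ (Fin n) → ℂ) + (ψ : EuclideanSpace ℝ (Fin n) → ℂ)) x _ = _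
  rw [iteratedFDeriv_add_apply φ.contDiff.contDiffAt ψ.contDiff.contDiffAt]
  rfl

lemma multiDeriv_smul (c : ℂ) (φ : CZero n m p σ) {α : Fin n → ℕ} (hα : ∑ i, α i = m)
    (x : EuclideanSpace ℝ (Fin n)) :
    multiDeriv α (c • φ : CZero n m p σ) x = c * multiDeriv α φ x := by
  subst hα
  change iteratedFDeriv ℝ _ (c • (φ : EuclideanSpace ℝ (Fin n) → ℂ)) x _ = _
  rw [iteratedFDeriv_const_smul_apply φ.contDiff.contDiffAt]
  rfl

lemma continuous_multiDeriv (φ : CZero n m p σ) {α : Fin n → ℕ} (hα : ∑ i, α i = m) :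
    Continuous (multiDeriv α φ) := by
  subst hα
  have h := φ.contDiff.continuous_iteratedFDeriv'
  unfold multiDeriv
  fun_prop

lemma exists_bound_multiDeriv (φ : CZero n m p σ) {α : Fin n → ℕ} (hα : ∑ i, α i = m) :
    ∃ C, ∀ x, ‖multiDeriv α φ x‖ ≤ C := by
  have hc : HasCompactSupport (multiDeriv α φ) := by
    have h := HasCompactSupport.iteratedFDeriv (𝕜 := ℝ)
      (TestFunction.hasCompactSupport' φ) (∑ i, α i)
    refine h.mono fun x hx hx' => hx ?_
    simp [multiDeriv, hx']
  exact hc.exists_bound_of_continuous (φ.continuous_multiDeriv hα)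

/-- The weight `|x|^m (1 + |log |x||)^σ`. -/
def weight (m : ℕ) (σ : ℝ) (x : EuclideanSpace ℝ (Fin n)) : ℝ :=
  ‖x‖ ^ m * (1 + |Real.log ‖x‖|) ^ σ

lemma weight_nonneg (x : EuclideanSpace ℝ (Fin n)) : 0 ≤ weight m σ x := by
  unfold weight; positivity

lemma exists_bound_weight [NeZero m] : ∃ C : ℝ, 0 ≤ C ∧
    ∀ x ∈ (unitBall n : Set (EuclideanSpace ℝ (Fin n))), weight m σ x ≤ C := by
  obtain ⟨N, hN⟩ := exists_nat_ge σ
  refine ⟨Real.exp 1 * N.factorial, by positivity, fun x hx => ?_⟩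
  have hx1 : ‖x‖ < 1 := by simpa [unitBall] using hx
  rcases (norm_nonneg x).eq_or_lt with h0 | h0
  · rw [weight, ← h0, zero_pow (NeZero.ne m), zero_mul]; positivity
  set t := ‖x‖
  set y := 1 + |Real.log t| with hy
  have hy1 : 1 ≤ y := by have := abs_nonneg (Real.log t); linarith
  have hlog : |Real.log t| = -Real.log t := abs_of_nonpos (Real.log_nonpos h0.le hx1.le)
  have ht : t = Real.exp 1 / Real.exp y := by
    rw [← Real.exp_sub, hy, hlog, show (1 : ℝ) - (1 + -Real.log t) = Real.log t by ring,
      Real.exp_log h0]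
  have h1 : y ^ σ ≤ y ^ N := by
    rw [← Real.rpow_natCast]; exact Real.rpow_le_rpow_of_exponent_le hy1 hN
  have h2 : y ^ N ≤ Real.exp y * N.factorial := by
    have := Real.pow_div_factorial_le_exp y (by linarith) N
    rwa [div_le_iff₀ (by positivity)] at this
  have h3 : t ^ m ≤ t := pow_le_of_le_one h0.le hx1.le (NeZero.ne m)
  calc weight m σ x = t ^ m * y ^ σ := rfl
    _ ≤ t * (Real.exp y * N.factorial) := by gcongr; exact h1.trans h2
    _ = Real.exp 1 * N.factorial := by
      rw [ht]; field_simp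

/-- The weighted derivative `|x|^m (1 + |log |x||)^σ D^α φ(x)`. -/
def weighted (φ : CZero n m p σ) (α : Fin n → ℕ) (x : EuclideanSpace ℝ (Fin n)) : ℂ :=
  (weight m σ x : ℂ) * multiDeriv α φ x

lemma memLp_weighted [NeZero m] (φ : CZero n m p σ) {α : Fin n → ℕ} (hα : ∑ i, α i = m)
    (q : ENNReal) : MemLp (φ.weighted α) q (volume.restrict (unitBall n)) := by
  obtain ⟨C, hC0, hC⟩ := exists_bound_weight (n := n) (m := m) (σ := σ)
  obtain ⟨D, hD⟩ := φ.exists_bound_multiDeriv hα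
  have : IsFiniteMeasure (volume.restrict (unitBall n : Set (EuclideanSpace ℝ (Fin n)))) :=
    ⟨by simpa [unitBall] using measure_ball_lt_top⟩
  refine MemLp.of_bound (C := C * D) ?_ ?_
  · have h1 : Measurable (multiDeriv α φ) := (φ.continuous_multiDeriv hα).measurable
    have h2 : Measurable (weight m σ : EuclideanSpace ℝ (Fin n) → ℝ) := by
      have h3 : Measurable fun x : EuclideanSpace ℝ (Fin n) => |Real.log ‖x‖| :=
        (Real.measurable_log.comp measurable_norm).abs
      unfold weight
      exact (measurable_norm.pow_const m).mul ((h3.const_add 1).pow_const σ)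
    exact ((Complex.measurable_ofReal.comp h2).mul h1).aestronglyMeasurable
  · refine (ae_restrict_mem (unitBall n).isOpen.measurableSet).mono fun x hx => ?_
    rw [weighted, norm_mul, Complex.norm_real, Real.norm_of_nonneg (weight_nonneg x)]
    exact mul_le_mul (hC x hx) (hD x) (norm_nonneg _) hC0

/-- The `L_p(B)`-norm of the weighted derivative. -/
def part (φ : CZero n m p σ) (α : Fin n → ℕ) : ℝ :=
  (eLpNorm (φ.weighted α) (ENNReal.ofReal p) (volume.restrict (unitBall n))).toReal

lemma part_add_le [NeZero m] (hp : 1 ≤ p) (φ ψ : CZero n m p σ) {α : Fin n → ℕ}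
    (hα : ∑ i, α i = m) : (φ + ψ).part α ≤ φ.part α + ψ.part α := by
  have h1 := φ.memLp_weighted hα (ENNReal.ofReal p)
  have h2 := ψ.memLp_weighted hα (ENNReal.ofReal p)
  have h : (φ + ψ).weighted α = φ.weighted α + ψ.weighted α := by
    ext x; simp only [weighted, Pi.add_apply, multiDeriv_add φ ψ hα, mul_add]
  rw [part, part, part, h, ← ENNReal.toReal_add h1.2.ne h2.2.ne]
  exact ENNReal.toReal_mono (ENNReal.add_ne_top.2 ⟨h1.2.ne, h2.2.ne⟩)
    (eLpNorm_add_le h1.1 h2.1 (by simpa using hp))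

lemma part_smul (c : ℂ) (φ : CZero n m p σ) {α : Fin n → ℕ}
    (hα : ∑ i, α i = m) : (c • φ).part α = ‖c‖ * φ.part α := by
  have h : (c • φ).weighted α = c • φ.weighted α := by
    ext x; simp only [weighted, Pi.smul_apply, multiDeriv_smul c φ hα, smul_eq_mul]; ring
  rw [part, part, h, eLpNorm_const_smul, ENNReal.toReal_mul, toReal_enorm]

lemma part_nonneg (φ : CZero n m p σ) (α : Fin n → ℕ) : 0 ≤ φ.part α := ENNReal.toReal_nonneg

lemma eNorm_eq [NeZero m] (hp : 1 ≤ p) (φ : CZero n m p σ) :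
    eNorm n m p σ φ = (∑ α ∈ Finset.Nat.antidiagonalTuple n m, φ.part α ^ p) ^ (1 / p) := by
  have hp0 : 0 < p := by linarith
  have hq0 : ENNReal.ofReal p ≠ 0 := by simpa using hp0
  have hr : (ENNReal.ofReal p).toReal = p := ENNReal.toReal_ofReal hp0.le
  have key : ∀ α ∈ Finset.Nat.antidiagonalTuple n m,
      φ.part α ^ p = ∫ x in (unitBall n : Set _), ‖φ.weighted α x‖ ^ p := by
    intro α hα
    have hα' := Finset.Nat.mem_antidiagonalTuple.1 hα
    have hint : 0 ≤ ∫ x in (unitBall n : Set _), ‖φ.weighted α x‖ ^ p :=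
      integral_nonneg fun x => by positivity
    rw [part, (φ.memLp_weighted hα' _).eLpNorm_eq_integral_rpow_norm hq0 ENNReal.ofReal_ne_top,
      hr, ENNReal.toReal_ofReal (Real.rpow_nonneg hint _), ← Real.rpow_mul hint,
      inv_mul_cancel₀ hp0.ne', Real.rpow_one]
  rw [Finset.sum_congr rfl key, ← integral_finsetSum, eNorm]
  · congr 2
    ext x
    rw [Finset.mul_sum]
    refine Finset.sum_congr rfl fun α _ => ?_
    rw [weighted, norm_mul, Complex.norm_real, Real.norm_of_nonneg (weight_nonneg x),
      Real.mul_rpow (weight_nonneg x) (norm_nonneg _), weight,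
      Real.mul_rpow (by positivity) (by positivity), ← Real.rpow_natCast, ← Real.rpow_mul
      (norm_nonneg x), ← Real.rpow_mul (by positivity)]
  · intro α hα
    have := (φ.memLp_weighted (Finset.Nat.mem_antidiagonalTuple.1 hα)
      (ENNReal.ofReal p)).integrable_norm_rpow hq0 ENNReal.ofReal_ne_top
    rwa [hr] at this

lemma eNorm_add_le [NeZero m] (hp : 1 ≤ p) (φ ψ : CZero n m p σ) :
    eNorm n m p σ (φ + ψ : CZero n m p σ) ≤ eNorm n m p σ φ + eNorm n m p σ ψ := by
  rw [eNorm_eq hp, eNorm_eq hp, eNorm_eq hp]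
  refine le_trans ?_ (Real.Lp_add_le_of_nonneg _ hp (fun α _ => φ.part_nonneg α)
    fun α _ => ψ.part_nonneg α)
  refine Real.rpow_le_rpow (Finset.sum_nonneg fun α _ => Real.rpow_nonneg (part_nonneg _ α) _)
    (Finset.sum_le_sum fun α hα => ?_) (by positivity)
  exact Real.rpow_le_rpow (part_nonneg _ α)
    (part_add_le hp φ ψ (Finset.Nat.mem_antidiagonalTuple.1 hα)) (by linarith)

lemma eNorm_smul [NeZero m] (hp : 1 ≤ p) (c : ℂ) (φ : CZero n m p σ) :
    eNorm n m p σ (c • φ : CZero n m p σ) = ‖c‖ * eNorm n m p σ φ := by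
  have hp0 : 0 < p := by linarith
  rw [eNorm_eq hp, eNorm_eq hp]
  have : ∀ α ∈ Finset.Nat.antidiagonalTuple n m,
      (c • φ).part α ^ p = ‖c‖ ^ p * φ.part α ^ p := fun α hα => by
    rw [part_smul c φ (Finset.Nat.mem_antidiagonalTuple.1 hα),
      Real.mul_rpow (norm_nonneg _) (part_nonneg _ _)]
  rw [Finset.sum_congr rfl this, ← Finset.mul_sum, Real.mul_rpow (by positivity)
    (Finset.sum_nonneg fun α _ => Real.rpow_nonneg (part_nonneg _ α) _),
    ← Real.rpow_mul (norm_nonneg c), mul_one_div_cancel hp0.ne', Real.rpow_one]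

/-- `C₀^m(B)` with the norm `eNorm n m p σ`. -/
instance [NeZero m] [hp : Fact (1 ≤ p)] : SeminormedAddCommGroup (CZero n m p σ) :=
  AddGroupSeminorm.toSeminormedAddCommGroup
    { toFun := fun φ => eNorm n m p σ φ
      map_zero' := by
        have := eNorm_smul hp.out 0 (0 : CZero n m p σ)
        rwa [zero_smul, norm_zero, zero_mul] at this
      add_le' := eNorm_add_le hp.out
      neg' := fun φ => by
        have := eNorm_smul hp.out (-1) φ
        rwa [neg_one_smul, norm_neg, norm_one, one_mul] at this }

lemma norm_def [NeZero m] [Fact (1 ≤ p)] (φ : CZero n m p σ) : ‖φ‖ = eNorm n m p σ φ := rfl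

instance [NeZero m] [hp : Fact (1 ≤ p)] : NormedSpace ℂ (CZero n m p σ) where
  norm_smul_le c φ := (eNorm_smul hp.out c φ).le

end CZero

/-- The Banach space `E^m_{p,σ}(B)`: the completion of `C₀^m(B)` with respect to the norm
`eNorm n m p σ`. -/
abbrev ESpace (n m : ℕ) [NeZero m] (p σ : ℝ) [Fact (1 ≤ p)] : Type :=
  UniformSpace.Completion (CZero n m p σ)

instance fact_one_le_ofReal {p : ℝ} [hp : Fact (1 ≤ p)] : Fact (1 ≤ ENNReal.ofReal p) :=
  ⟨by simpa using hp.out⟩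

/-- The complex Lebesgue space `L_p(B)`. -/
abbrev LpBall (n : ℕ) (p : ℝ) : Type :=
  Lp ℂ (ENNReal.ofReal p)
    (volume.restrict (unitBall n : Set (EuclideanSpace ℝ (Fin n))))

/-- `J` is the embedding `id : E^m_{p,σ}(B) ↪ L_p(B)`: the injective bounded linear operator that
sends every `φ ∈ C₀^m(B)` to (the class of) `φ`. As `C₀^m(B)` is dense in `E^m_{p,σ}(B)`, there
is at most one such operator. -/
def IsIdEmbedding {n m : ℕ} [NeZero m] {p σ : ℝ} [Fact (1 ≤ p)]
    (J : ESpace n m p σ →L[ℂ] LpBall n p) : Prop :=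
  (∀ φ : CZero n m p σ, ∀ᵐ x ∂volume.restrict (unitBall n : Set (EuclideanSpace ℝ (Fin n))),
    J (φ : ESpace n m p σ) x = φ x) ∧ Function.Injective J

/-- The `k`-th entropy number of a bounded operator, for `k ≥ 1`: the infimum of all `ε > 0` such
that the image of the closed unit ball is covered by `2^(k-1)` open balls of radius `ε`. -/
def entropyNumber {X Y : Type*} [NormedAddCommGroup X] [NormedSpace ℂ X]
    [NormedAddCommGroup Y] [NormedSpace ℂ Y] (T : X →L[ℂ] Y) (k : ℕ) : ℝ :=
  sInf {ε : ℝ | 0 < ε ∧ ∃ y : Fin (2 ^ (k - 1)) → Y,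
    T '' Metric.closedBall 0 1 ⊆ ⋃ i, Metric.ball (y i) ε}

/-- `a k ∼ b k` for all `k ≥ k₀`: two-sided estimates with positive constants that do not depend
on `k`. -/
def EquivFrom (k₀ : ℕ) (a b : ℕ → ℝ) : Prop :=
  ∃ c₁ c₂ : ℝ, 0 < c₁ ∧ 0 < c₂ ∧ ∀ k : ℕ, k₀ ≤ k → c₁ * b k ≤ a k ∧ a k ≤ c₂ * b k

end

/-! Split B into shells where |x| is comparable with 2^(-j). On each of them the factor |x|^m makes
the norm of order m scale like the L_p norm, and the logarithmic factor is of size (1+j)^σ.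

Upper bound. Cut the j-th shell into about N_j^n cubes and replace f on each cube by a Taylor
polynomial of degree less than m. The L_p error there is at most a constant times N_j^(-m)
(1+j)^(-σ) times the norm. On the innermost cube of size 2^(-J), f is replaced by 0; a Hardy
inequality with the same weight (`exists_hardy`) bounds the error by a multiple of (1+J)^(-σ). This
is `exists_subspace_approx`. Asking for the error K^(-τ) with τ = min(m/n, σ) costs a dimension of
order K Λ(K), where Λ(K) = 1 + log K if σ = m/n and Λ = 1 otherwise (`exists_grid`): the series of
(1+j)^(-σn/m) converges, diverges logarithmically or diverges like a power. Widths turn into entropy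
numbers by `exists_entropyNumber_le`: a cover is refined by the factor 3/4 over and over, each time
at the price of a factor 5^dim, and the dimensions form an essentially geometric sum. The same
covers give compactness.

Lower bound. Bump functions in distinct cells have disjoint supports, so that the energy and the
p-th power of the L_p norm are additive on their span. There id is bounded below by a multiple of δ
if δ N_j^m (1+j)^σ ≤ 1 for all shells in use, and a volume argument (`le_entropyNumber_of_subspace`)
yields e_k ≥ cδ as soon as the dimension reaches k. One shell with many cells, many shells with one
cell each, and N_j of size (K/(1+j))^(1/n) give the three rates.

Injectivity. The norm extends to the completion as the ℓ_p-sum of the L_p norms of the weighted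
derivatives. Away from the origin these remain weak derivatives of the image in L_p, so they vanish
if the image does (`weightedExtension_eq_zero`). -/

/-! ### Entropy numbers: covers from widths, and Bernstein's lower bound -/

section Entropy

open Metric Module

/-- A set that is covered by balls of radius `ε` and is close to a finite-dimensional subspace is
covered by comparatively few balls of radius `3 ε / 4`. -/
theorem exists_cover_three_quarters {Y : Type*} [NormedAddCommGroup Y] [NormedSpace ℝ Y]
    {A : Set Y} (V : Submodule ℝ Y) [FiniteDimensional ℝ V] {ε : ℝ} (hε : 0 < ε)
    (hV : ∀ a ∈ A, ∃ v ∈ V, ‖a - v‖ ≤ ε / 12) {S : Finset Y} (hS : (S : Set Y) ⊆ A)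
    (hcov : ∀ a ∈ A, ∃ s ∈ S, ‖a - s‖ ≤ ε) :
    ∃ S' : Finset Y, (S' : Set Y) ⊆ A ∧ (∀ a ∈ A, ∃ s ∈ S', ‖a - s‖ ≤ 3 / 4 * ε) ∧
      S'.card ≤ S.card * 5 ^ finrank ℝ V := by
  classical
  choose! φ hφV hφ using hV
  have key : ∀ s ∈ S, ∃ t : Finset Y, (t : Set Y) ⊆ A ∧ t.card ≤ 5 ^ finrank ℝ V ∧
      ∀ a ∈ A, ‖a - s‖ ≤ ε → ∃ x ∈ t, ‖a - x‖ ≤ 3 / 4 * ε := by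
    intro s hs
    let P : Finset Y → Prop := fun t => (∀ x ∈ t, x ∈ A ∧ ‖x - s‖ ≤ ε) ∧
      ∀ x ∈ t, ∀ y ∈ t, x ≠ y → 3 / 4 * ε < ‖x - y‖
    have hsA : s ∈ A := hS hs
    have hcard : ∀ t, P t → t.card ≤ 5 ^ finrank ℝ V := by
      intro t ht
      -- Moving points into V by at most ε/12 leaves them separated by 3/4 ε - 2 ε/12 = 7/12 ε and
      -- within ε + 2 ε/12 = 2 (7/12 ε) of `φ s`. After scaling they are 1-separated in a ball of
      -- radius 2 of V, which holds at most 5 ^ dim such points.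
      let g : t → V := fun x => ((7 / 12 * ε)⁻¹ : ℝ) •
        (⟨φ x, hφV x (ht.1 x x.2).1⟩ - ⟨φ s, hφV s hsA⟩)
      have hg : ∀ x y : t, x ≠ y → 1 ≤ ‖g x - g y‖ := by
        intro x y hxy
        have h1 := ht.2 x x.2 y y.2 (fun h => hxy (Subtype.ext h))
        have h2 := hφ x (ht.1 x x.2).1
        have h3 := hφ y (ht.1 y y.2).1
        have h4 : ‖(x : Y) - y‖ ≤ ‖(x : Y) - φ x‖ + ‖φ x - φ y‖ + ‖(y : Y) - φ y‖ := by
          rw [norm_sub_rev (y : Y)]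
          exact (norm_sub_le_norm_sub_add_norm_sub _ (φ y) _).trans (by
            gcongr; exact norm_sub_le_norm_sub_add_norm_sub _ _ _)
        have h5 : g x - g y = ((7 / 12 * ε)⁻¹ : ℝ) •
            (⟨φ x - φ y, V.sub_mem (hφV x (ht.1 x x.2).1) (hφV y (ht.1 y y.2).1)⟩ : V) := by
          simp only [g, ← smul_sub]
          congr 1
          ext
          simp
        rw [h5, norm_smul, norm_inv, Real.norm_of_nonneg (by positivity), inv_mul_eq_div,
          le_div_iff₀ (by positivity)]
        change 1 * (7 / 12 * ε) ≤ ‖φ x - φ y‖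
        linarith
      have hinj : Function.Injective g := by
        intro x y hxy
        by_contra h
        have := hg x y h
        rw [hxy, sub_self, norm_zero] at this
        linarith
      have h6 := Besicovitch.card_le_of_separated (Finset.univ.image g) (E := V) ?_ ?_
      · rwa [Finset.card_image_of_injective _ hinj, Finset.card_univ, Fintype.card_coe] at h6
      · simp only [Finset.mem_image, Finset.mem_univ, true_and, forall_exists_index,
          forall_apply_eq_imp_iff]
        intro x
        have h1 := (ht.1 x x.2).2
        have h2 := hφ x (ht.1 x x.2).1
        have h3 := hφ s hsA
        have h4 : ‖φ x - φ s‖ ≤ ‖(x : Y) - φ x‖ + ‖(x : Y) - s‖ + ‖s - φ s‖ := by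
          rw [norm_sub_rev (x : Y) (φ x)]
          exact (norm_sub_le_norm_sub_add_norm_sub _ s _).trans (by
            gcongr; exact norm_sub_le_norm_sub_add_norm_sub _ _ _)
        simp only [g]
        rw [norm_smul, norm_inv, Real.norm_of_nonneg (by positivity), inv_mul_eq_div,
          div_le_iff₀ (by positivity)]
        change ‖φ x - φ s‖ ≤ _
        linarith
      · simp only [Finset.mem_image, Finset.mem_univ, true_and, forall_exists_index,
          forall_apply_eq_imp_iff]
        intro x y hxy
        exact hg x y (fun h => hxy (by rw [h]))
    -- A separated set of maximal cardinality is a net, since a point far from all of it could be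
    -- inserted.
    let C : Set ℕ := {c | ∃ t, P t ∧ t.card = c}
    have hC0 : C.Nonempty := ⟨0, ∅, ⟨by simp, by simp⟩, rfl⟩
    have hCb : BddAbove C := ⟨5 ^ finrank ℝ V, by rintro _ ⟨t, ht, rfl⟩; exact hcard t ht⟩
    obtain ⟨t, ht, htc⟩ := Nat.sSup_mem hC0 hCb
    refine ⟨t, fun x hx => (ht.1 x hx).1, hcard t ht, fun a ha has => ?_⟩
    by_contra! hcon
    have hat : a ∉ t := fun h => by
      have := hcon a h
      rw [sub_self, norm_zero] at this
      nlinarith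
    have hP : P (insert a t) := by
      refine ⟨fun x hx => ?_, fun x hx y hy hxy => ?_⟩
      · rcases Finset.mem_insert.1 hx with rfl | h
        · exact ⟨ha, has⟩
        · exact ht.1 x h
      · rcases Finset.mem_insert.1 hx with rfl | h <;> rcases Finset.mem_insert.1 hy with rfl | h'
        · exact absurd rfl hxy
        · exact hcon y h'
        · rw [norm_sub_rev]; exact hcon x h
        · exact ht.2 x h y h' hxy
    have := le_csSup hCb ⟨insert a t, hP, rfl⟩
    rw [Finset.card_insert_of_notMem hat, htc] at this
    omega
  choose! t htA htc ht using key
  refine ⟨S.biUnion t, ?_, ?_, Finset.card_biUnion_le_card_mul _ _ _ htc⟩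
  · intro x hx
    obtain ⟨s, hs, hx⟩ := Finset.mem_biUnion.1 (Finset.mem_coe.1 hx)
    exact htA s hs hx
  · intro a ha
    obtain ⟨s, hs, has⟩ := hcov a ha
    obtain ⟨x, hx, hax⟩ := ht s hs a ha has
    exact ⟨x, Finset.mem_biUnion.2 ⟨s, hs, hx⟩, hax⟩

/-- The start is the single centre 0 with radius R. Each refinement multiplies the radius by 3/4 and
the number of balls by at most 5 ^ D i, so the dimensions add up in the exponent. -/
theorem exists_cover_iterate {Y : Type*} [NormedAddCommGroup Y] [NormedSpace ℝ Y]
    {A : Set Y} {R : ℝ} (hR : 0 < R) (h0 : (0 : Y) ∈ A) (hA : ∀ a ∈ A, ‖a‖ ≤ R)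
    (D : ℕ → ℕ) (hV : ∀ i : ℕ, ∃ V : Submodule ℝ Y, FiniteDimensional ℝ V ∧ finrank ℝ V ≤ D i ∧
      ∀ a ∈ A, ∃ v ∈ V, ‖a - v‖ ≤ (R * (3 / 4) ^ i) / 12) (i : ℕ) :
    ∃ S : Finset Y, (S : Set Y) ⊆ A ∧ (∀ a ∈ A, ∃ s ∈ S, ‖a - s‖ ≤ R * (3 / 4) ^ i) ∧
      S.card ≤ 5 ^ ∑ l ∈ Finset.range i, D l := by
  induction i with
  | zero => exact ⟨{0}, by simpa using h0, by simpa using hA, by simp⟩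
  | succ i ih =>
    obtain ⟨S, hS, hcov, hc⟩ := ih
    obtain ⟨V, hfin, hd, hV⟩ := hV i
    obtain ⟨S', hS', hcov', hc'⟩ := exists_cover_three_quarters V (by positivity) hV hS hcov
    refine ⟨S', hS', fun a ha => ?_, ?_⟩
    · obtain ⟨s, hs, h⟩ := hcov' a ha
      exact ⟨s, hs, h.trans_eq (by ring)⟩
    · rw [Finset.sum_range_succ, pow_add]
      exact hc'.trans (Nat.mul_le_mul hc (Nat.pow_le_pow_right (by norm_num) hd))

variable {X Y : Type*} [NormedAddCommGroup X] [NormedSpace ℂ X]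
    [NormedAddCommGroup Y] [NormedSpace ℂ Y]

theorem entropyNumber_le_of_cover (T : X →L[ℂ] Y) (k : ℕ) {ε ε' : ℝ} (hε : ε < ε') (h0 : 0 ≤ ε)
    (S : Finset Y) (hS : S.card ≤ 2 ^ (k - 1))
    (hcov : ∀ a ∈ T '' closedBall 0 1, ∃ s ∈ S, ‖a - s‖ ≤ ε) : entropyNumber T k ≤ ε' := by
  refine csInf_le ⟨0, fun x hx => hx.1.le⟩ ⟨h0.trans_lt hε, ?_⟩
  -- Surplus indices get the centre 0, as exactly 2 ^ (k - 1) balls have to be listed.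
  refine ⟨fun i => if h : (i : ℕ) < S.card then S.equivFin.symm ⟨i, h⟩ else 0, fun a ha => ?_⟩
  obtain ⟨s, hs, has⟩ := hcov a ha
  let j := S.equivFin ⟨s, hs⟩
  refine mem_iUnion.2 ⟨⟨j, j.2.trans_le hS⟩, ?_⟩
  have : (j : ℕ) < S.card := j.2
  simp only [this, dif_pos, mem_ball, dist_eq_norm]
  simpa [j] using has.trans_lt hε

/-- Bernstein's lower bound: an operator that is bounded below by `δ` on a subspace of real
dimension at least `k` has `k`-th entropy number at least `δ / 4`. -/
theorem le_entropyNumber_of_subspace (T : X →L[ℂ] Y) {k : ℕ} (hk : 1 ≤ k) {δ : ℝ} (hδ : 0 < δ)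
    (V : Submodule ℂ X) [FiniteDimensional ℂ V] (hkV : k ≤ finrank ℂ V)
    (hV : ∀ x ∈ V, δ * ‖x‖ ≤ ‖T x‖) : δ / 4 ≤ entropyNumber T k := by
  have : FiniteDimensional ℝ V := FiniteDimensional.complexToReal V
  have hdim : k ≤ finrank ℝ V := by rw [finrank_real_of_complex]; omega
  refine le_csInf ?_ ?_
  -- Since `sInf ∅ = 0`, the set of admissible radii has to be nonempty.
  · refine ⟨‖T‖ + 1, by positivity, fun _ => 0, ?_⟩
    rintro _ ⟨x, hx, rfl⟩
    refine mem_iUnion.2 ⟨⟨0, by positivity⟩, ?_⟩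
    rw [mem_closedBall_zero_iff] at hx
    rw [mem_ball_zero_iff]
    have h1 := T.le_opNorm x
    have h2 := norm_nonneg T
    nlinarith
  · rintro ε ⟨hε, y, hy⟩
    by_contra! hlt
    let _ : MeasurableSpace V := borel V
    have : BorelSpace V := ⟨rfl⟩
    let μ : Measure V := Measure.addHaar
    -- Each of these sets has diameter at most 2 ε / δ < 1 / 2, so it fits into a ball of radius 1 /
    -- 2. As the real dimension is at least k, all 2 ^ (k - 1) of them together have at most half of
    -- the volume of the unit ball.
    let B : Fin (2 ^ (k - 1)) → Set V := fun i => {x | ‖x‖ ≤ 1 ∧ T x ∈ ball (y i) ε}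
    have hcov : closedBall (0 : V) 1 ⊆ ⋃ i, B i := by
      intro x hx
      rw [mem_closedBall_zero_iff] at hx
      have : T x ∈ ⋃ i, ball (y i) ε := hy ⟨x, by simpa using hx, rfl⟩
      obtain ⟨i, hi⟩ := mem_iUnion.1 this
      exact mem_iUnion.2 ⟨i, hx, hi⟩
    have hB : ∀ i, μ (B i) ≤ ENNReal.ofReal ((1 / 2) ^ finrank ℝ V) * μ (closedBall 0 1) := by
      intro i
      rcases (B i).eq_empty_or_nonempty with h | ⟨x₀, hx₀⟩
      · simp [h]
      · have hsub : B i ⊆ closedBall x₀ (1 / 2) := by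
          intro x hx
          rw [mem_closedBall, dist_eq_norm]
          have h1 := hV (x - x₀ : V) (x - x₀ : V).2
          have h2 : ‖T ((x - x₀ : V) : X)‖ ≤ 2 * ε := by
            rw [Submodule.coe_sub, map_sub]
            have h3 := mem_ball_iff_norm.1 hx.2
            have h4 := mem_ball_iff_norm'.1 hx₀.2
            calc _ ≤ ‖T x - y i‖ + ‖y i - T x₀‖ := norm_sub_le_norm_sub_add_norm_sub _ _ _
              _ ≤ _ := by linarith
          have h5 : δ * ‖x - x₀‖ ≤ 2 * ε := h1.trans h2
          by_contra! h6
          nlinarith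
        refine (measure_mono hsub).trans_eq ?_
        rw [Measure.addHaar_closedBall' μ x₀ (by norm_num)]
    have h1 : μ (closedBall 0 1) ≤ (2 ^ (k - 1) : ℕ) *
        (ENNReal.ofReal ((1 / 2) ^ finrank ℝ V) * μ (closedBall 0 1)) := by
      refine (measure_mono hcov).trans ((measure_iUnion_fintype_le _ _).trans ?_)
      refine (Finset.sum_le_sum fun i _ => hB i).trans ?_
      simp
    have hpos : 0 < μ (closedBall 0 1) := measure_closedBall_pos _ _ one_pos
    have hfin : μ (closedBall 0 1) < ⊤ := measure_closedBall_lt_top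
    have h2 : ((2 ^ (k - 1) : ℕ) : ENNReal) * ENNReal.ofReal ((1 / 2) ^ finrank ℝ V) < 1 := by
      rw [← ENNReal.ofReal_natCast, ← ENNReal.ofReal_mul (by positivity), ← ENNReal.ofReal_one,
        ENNReal.ofReal_lt_ofReal_iff one_pos]
      calc ((2 ^ (k - 1) : ℕ) : ℝ) * (1 / 2) ^ finrank ℝ V
          ≤ ((2 ^ (k - 1) : ℕ) : ℝ) * (1 / 2) ^ k := by
            gcongr _ * ?_
            exact pow_le_pow_of_le_one (by norm_num) (by norm_num) hdim
        _ = 1 / 2 := by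
            obtain ⟨l, rfl⟩ : ∃ l, k = l + 1 := ⟨k - 1, by omega⟩
            rw [Nat.add_sub_cancel]; push_cast
            rw [pow_succ, ← mul_assoc, ← mul_pow]; norm_num
        _ < 1 := by norm_num
    rw [← mul_assoc] at h1
    have h3 := ENNReal.mul_lt_mul_left hpos.ne' hfin.ne h2
    simp only [one_mul] at h3
    exact absurd h1 (not_le.2 h3)

/-- Entropy estimate from Kolmogorov widths: if for every `K ≥ 1` the image of the unit ball is
`K ^ (-τ)`-close to a subspace of dimension `K * Λ K` then the `k`-th entropy number is of order
`(Λ k / k) ^ τ`. -/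
theorem exists_entropyNumber_le (T : X →L[ℂ] Y) {τ C₀ C₁ : ℝ} (hτ : 0 < τ)
    (hC₁ : 0 < C₁) (Λ : ℝ → ℝ) (hΛ1 : ∀ x, 1 ≤ x → 1 ≤ Λ x)
    (hΛ : ∀ x y, 1 ≤ x → x ≤ y → Λ x ≤ Λ y)
    (hV : ∀ K : ℝ, 1 ≤ K → ∃ V : Submodule ℂ Y, FiniteDimensional ℂ V ∧
      (finrank ℂ V : ℝ) ≤ C₁ * (K * Λ K) ∧
      ∀ x, ‖x‖ ≤ 1 → ∃ v ∈ V, ‖T x - v‖ ≤ C₀ * K ^ (-τ)) :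
    (∃ C, 0 < C ∧ ∀ k : ℕ, 1 ≤ k → entropyNumber T k ≤ C * (Λ k / k) ^ τ) ∧
      TotallyBounded (T '' closedBall 0 1) := by
  set A := T '' closedBall 0 1 with hAdef
  -- R bounds the image of the unit ball, and C₀ ≤ R / 12 is the accuracy that each refinement
  -- needs.
  set R : ℝ := ‖T‖ + 12 * |C₀| + 1 with hRdef
  have hR : 0 < R := by positivity
  have hRC : C₀ ≤ R / 12 := by
    have := le_abs_self C₀; have := norm_nonneg T
    rw [hRdef]; linarith
  have h0 : (0 : Y) ∈ A := ⟨0, by simp, by simp⟩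
  have hAR : ∀ a ∈ A, ‖a‖ ≤ R := by
    rintro _ ⟨x, hx, rfl⟩
    rw [mem_closedBall_zero_iff] at hx
    have h1 := T.le_opNorm x
    have h2 := norm_nonneg T
    have h3 := abs_nonneg C₀
    rw [hRdef]
    nlinarith
  -- The scales K = lam ^ i have the errors K ^ (-τ) = (3 / 4) ^ i, in step with the radii of the
  -- covers.
  set lam : ℝ := (4 / 3 : ℝ) ^ (1 / τ) with hlam
  have hlam1 : 1 < lam := Real.one_lt_rpow (by norm_num) (by positivity)
  have hlamτ : ∀ i : ℕ, (lam ^ i) ^ (-τ) = (3 / 4 : ℝ) ^ i := by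
    intro i
    rw [hlam, ← Real.rpow_natCast, ← Real.rpow_mul (by positivity), ← Real.rpow_mul (by positivity),
      show 1 / τ * (i * -τ) = -(i : ℝ) by field_simp, Real.rpow_neg (by norm_num),
      Real.rpow_natCast, ← inv_pow]
    norm_num
  -- The factor 2 converts complex into real dimension.
  let D : ℕ → ℕ := fun i => ⌊2 * (C₁ * (lam ^ i * Λ (lam ^ i)))⌋₊
  have hone : ∀ i : ℕ, 1 ≤ lam ^ i := fun i => one_le_pow₀ hlam1.le
  have hcover : ∀ i, ∃ S : Finset Y, (S : Set Y) ⊆ A ∧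
      (∀ a ∈ A, ∃ s ∈ S, ‖a - s‖ ≤ R * (3 / 4) ^ i) ∧
      S.card ≤ 5 ^ ∑ l ∈ Finset.range i, D l := by
    refine exists_cover_iterate hR h0 hAR D fun i => ?_
    obtain ⟨V, hfin, hdim, hVT⟩ := hV (lam ^ i) (hone i)
    refine ⟨V.restrictScalars ℝ, FiniteDimensional.complexToReal V, ?_, ?_⟩
    · refine Nat.le_floor ?_
      have : finrank ℝ (V.restrictScalars ℝ) = 2 * finrank ℂ V := finrank_real_of_complex V
      rw [this]; push_cast; linarith
    · rintro _ ⟨x, hx, rfl⟩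
      obtain ⟨v, hv, h⟩ := hVT x (by simpa using hx)
      refine ⟨v, hv, h.trans ?_⟩
      rw [hlamτ]
      have : (0 : ℝ) ≤ (3 / 4) ^ i := by positivity
      nlinarith
  set C₂ : ℝ := 2 * C₁ / (lam - 1) with hC₂
  have hC₂pos : 0 < C₂ := div_pos (by linarith) (by linarith)
  have hsum : ∀ i, ((∑ l ∈ Finset.range i, D l : ℕ) : ℝ) ≤ C₂ * (lam ^ i * Λ (lam ^ i)) := by
    intro i
    have hΛpos := hΛ1 _ (hone i)
    push_cast
    calc ∑ l ∈ Finset.range i, (D l : ℝ)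
        ≤ ∑ l ∈ Finset.range i, 2 * C₁ * Λ (lam ^ i) * lam ^ l := by
          refine Finset.sum_le_sum fun l hl => ?_
          have hle : lam ^ l ≤ lam ^ i :=
            pow_le_pow_right₀ hlam1.le (Finset.mem_range.1 hl).le
          have h1 := hΛ _ _ (hone l) hle
          have h2 := hΛ1 _ (hone l)
          have h3 := hone l
          refine (Nat.floor_le (by positivity)).trans ?_
          rw [show 2 * C₁ * Λ (lam ^ i) * lam ^ l = 2 * (C₁ * (lam ^ l * Λ (lam ^ i))) by ring]
          gcongr
      _ = 2 * C₁ * Λ (lam ^ i) * ((lam ^ i - 1) / (lam - 1)) := by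
          rw [← Finset.mul_sum, geom_sum_eq hlam1.ne']
      _ ≤ 2 * C₁ * Λ (lam ^ i) * (lam ^ i / (lam - 1)) := by
          have : 0 < lam - 1 := by linarith
          gcongr
          linarith
      _ = _ := by rw [hC₂]; ring
  refine ⟨?_, ?_⟩
  -- Two properties matter: 3 C₂ c ≤ 1/2 and c ≤ 1/2. If K = c k / Λ k ≥ 1, the second forces k ≥ 2,
  -- hence k / 2 ≤ k - 1, and by the first the exponent of the cover fits into the k - 1 available
  -- bits.
  · set c : ℝ := 1 / (6 * C₂ + 2) with hc
    have hcpos : 0 < c := by positivity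
    have hc1 : c < 1 := by rw [hc, div_lt_one (by positivity)]; linarith
    have hcC : 3 * C₂ * c ≤ 1 / 2 := by
      rw [hc, mul_one_div, div_le_iff₀ (by positivity)]; linarith
    refine ⟨2 * R * lam ^ τ * c ^ (-τ), by positivity, fun k hk => ?_⟩
    have hk1 : (1 : ℝ) ≤ k := by exact_mod_cast hk
    have hkpos : (0 : ℝ) < k := by linarith
    have hΛk := hΛ1 _ hk1
    set K : ℝ := c * k / Λ k with hK
    have hKpos : 0 < K := by positivity
    have hrate : 2 * R * lam ^ τ * c ^ (-τ) * (Λ k / k) ^ τ = 2 * R * lam ^ τ * K ^ (-τ) := by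
      rw [hK, mul_div_assoc, Real.mul_rpow hcpos.le (by positivity),
        Real.rpow_neg (x := (k : ℝ) / Λ k) (by positivity), ← Real.inv_rpow (by positivity),
        inv_div]
      ring
    rw [hrate]
    -- For K < 1 the claimed bound is at least 2 R, and one ball suffices.
    rcases lt_or_ge K 1 with hK1 | hK1
    · obtain ⟨S, -, hcov, hcard⟩ := hcover 0
      have h1 : 1 ≤ lam ^ τ := Real.one_le_rpow hlam1.le hτ.le
      have h2 : 1 ≤ K ^ (-τ) := Real.one_le_rpow_of_pos_of_le_one_of_nonpos hKpos hK1.le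
        (by linarith)
      have h3 : 1 ≤ lam ^ τ * K ^ (-τ) := one_le_mul_of_one_le_of_one_le h1 h2
      refine entropyNumber_le_of_cover T k (ε := R) ?_ hR.le S ?_ (by simpa only [pow_zero, mul_one] using hcov)
      · nlinarith
      · exact hcard.trans (by simpa using Nat.one_le_two_pow)
    · obtain ⟨i, hi, hi'⟩ := exists_nat_pow_near hK1 hlam1
      obtain ⟨S, -, hcov, hcard⟩ := hcover i
      refine entropyNumber_le_of_cover T k (ε := R * (3 / 4) ^ i) ?_ (by positivity) S ?_ hcov
      · have h1 : (3 / 4 : ℝ) ^ i ≤ lam ^ τ * K ^ (-τ) := by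
          have h2 : K ^ τ ≤ (lam ^ (i + 1)) ^ τ := Real.rpow_le_rpow hKpos.le hi'.le hτ.le
          rw [pow_succ, Real.mul_rpow (by positivity) (by positivity)] at h2
          rw [← hlamτ, Real.rpow_neg (by positivity), Real.rpow_neg hKpos.le, ← div_eq_mul_inv,
            le_div_iff₀ (by positivity), inv_mul_le_iff₀ (by positivity)]
          exact h2
        have h3 : (0 : ℝ) < (3 / 4 : ℝ) ^ i := by positivity
        nlinarith
      · have hKk : K ≤ k := by
          rw [hK, div_le_iff₀ (by positivity)]
          nlinarith
        have hik : lam ^ i ≤ k := hi.trans hKk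
        have h1 : ((∑ l ∈ Finset.range i, D l : ℕ) : ℝ) ≤ C₂ * (K * Λ k) := by
          refine (hsum i).trans ?_
          have := hΛ _ _ (hone i) hik
          have := hΛ1 _ (hone i)
          gcongr
        have h2 : K * Λ k = c * k := by rw [hK]; field_simp
        have h3 : 3 * ∑ l ∈ Finset.range i, D l ≤ k - 1 := by
          have h4 : (1 : ℝ) ≤ c * k := by
            rw [← h2]; nlinarith
          have h5 : (2 : ℝ) ≤ k := by
            have : c ≤ 1 / 2 := by
              rw [hc]; apply one_div_le_one_div_of_le <;> linarith
            nlinarith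
          rw [h2] at h1
          have h6 : ((3 * ∑ l ∈ Finset.range i, D l : ℕ) : ℝ) ≤ ((k - 1 : ℕ) : ℝ) := by
            rw [Nat.cast_mul, Nat.cast_sub hk]
            push_cast at h1 ⊢
            have : 3 * C₂ * c * k ≤ 1 / 2 * k := by gcongr
            linarith
          exact_mod_cast h6
        calc S.card ≤ 5 ^ ∑ l ∈ Finset.range i, D l := hcard
          -- Rounding 5 up to 2 ^ 3 is the origin of the factor 3 in `h3`.
          _ ≤ 8 ^ ∑ l ∈ Finset.range i, D l := Nat.pow_le_pow_left (by norm_num) _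
          _ = 2 ^ (3 * ∑ l ∈ Finset.range i, D l) := by rw [pow_mul]; norm_num
          _ ≤ 2 ^ (k - 1) := Nat.pow_le_pow_right (by norm_num) h3
  · rw [Metric.totallyBounded_iff]
    intro ε hε
    obtain ⟨i, hi⟩ := exists_pow_lt_of_lt_one (div_pos hε hR) (by norm_num : (3 / 4 : ℝ) < 1)
    obtain ⟨S, -, hcov, -⟩ := hcover i
    refine ⟨S, S.finite_toSet, fun a ha => ?_⟩
    obtain ⟨s, hs, h⟩ := hcov a ha
    rw [lt_div_iff₀ hR] at hi
    refine mem_iUnion₂.2 ⟨s, hs, ?_⟩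
    rw [mem_ball, dist_eq_norm]
    linarith

end Entropy

/-! ### Taylor's formula along segments and rays -/

section Taylor

open scoped ENNReal NNReal

/-- Hölder's inequality against the constant function 1. -/
theorem lintegral_rpow_le_measure_univ_mul {α : Type*} [MeasurableSpace α] {μ : Measure α}
    {g : α → ℝ≥0∞} (hg : AEMeasurable g μ) {p : ℝ} (hp : 1 ≤ p) :
    (∫⁻ x, g x ∂μ) ^ p ≤ μ univ ^ (p - 1) * ∫⁻ x, g x ^ p ∂μ := by
  have hp0 : 0 < p := by linarith
  have h := eLpNorm'_le_eLpNorm'_mul_rpow_measure_univ (f := g) one_pos hp hg.aestronglyMeasurable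
  simp only [eLpNorm', enorm_eq_self, ENNReal.rpow_one, div_one] at h
  have h2 := ENNReal.rpow_le_rpow h hp0.le
  rw [ENNReal.mul_rpow_of_nonneg _ _ hp0.le, ← ENNReal.rpow_mul, ← ENNReal.rpow_mul,
    one_div_mul_cancel hp0.ne', ENNReal.rpow_one, mul_comm] at h2
  refine h2.trans_eq ?_
  congr 2
  field_simp

variable {E F : Type*} [NormedAddCommGroup E] [NormedSpace ℝ E]
  [NormedAddCommGroup F] [NormedSpace ℝ F]

theorem enorm_apply_const_le {k : ℕ} (g : ContinuousMultilinearMap ℝ (fun _ : Fin k => E) F)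
    (v : E) : ‖g fun _ => v‖ₑ ≤ ‖g‖ₑ * ‖v‖ₑ ^ k := by
  have h := g.le_opNNNorm fun _ => v
  rw [Finset.prod_const, Finset.card_univ, Fintype.card_fin] at h
  simp only [enorm_eq_nnnorm]
  exact_mod_cast h

theorem iteratedDeriv_comp_line {f : E → F} {k : ℕ} (hf : ContDiff ℝ k f) (y v : E) (t : ℝ) :
    iteratedDeriv k (fun s : ℝ => f (y + s • v)) t =
      iteratedFDeriv ℝ k f (y + t • v) fun _ => v := by
  let L : ℝ →L[ℝ] E := ContinuousLinearMap.toSpanSingleton ℝ v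
  have h1 : ContDiff ℝ k fun z => f (y + z) := hf.comp (contDiff_const.add contDiff_id)
  have h2 := L.iteratedFDeriv_comp_right h1 t (le_refl (k : WithTop ℕ∞))
  rw [iteratedDeriv]
  change iteratedFDeriv ℝ k ((fun z => f (y + z)) ∘ L) t _ = _
  rw [h2, iteratedFDeriv_comp_add_left]
  simp [L]

/-- Taylor's formula along a line, in terms of the full iterated derivative. -/
theorem taylor_along_line [CompleteSpace F] {f : E → F} {k : ℕ} (hf : ContDiff ℝ (k + 1 : ℕ) f)
    (y v : E) {a b : ℝ} (hab : a ≠ b) :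
    f (y + b • v) - ∑ j ∈ Finset.range (k + 1),
        ((j.factorial : ℝ)⁻¹ * (b - a) ^ j) • iteratedFDeriv ℝ j f (y + a • v) (fun _ => v) =
      ∫ t in a..b, ((b - t) ^ k / k.factorial) •
        iteratedFDeriv ℝ (k + 1) f (y + t • v) fun _ => v := by
  let u : ℝ → F := fun s => f (y + s • v)
  have hu : ContDiff ℝ (k + 1 : ℕ) u := hf.comp (by fun_prop)
  have hU : UniqueDiffOn ℝ (uIcc a b) := uniqueDiffOn_uIcc hab
  have h := taylor_integral_remainder (f := u) (x := b) (x₀ := a) (n := k) hu.contDiffOn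
  have hd : ∀ j ≤ k + 1, ∀ t ∈ uIcc a b, iteratedDerivWithin j u (uIcc a b) t =
      iteratedFDeriv ℝ j f (y + t • v) fun _ => v := by
    intro j hj t ht
    have hj' : ((j : ℕ) : WithTop ℕ∞) ≤ ((k + 1 : ℕ) : WithTop ℕ∞) := by exact_mod_cast hj
    rw [iteratedDerivWithin_eq_iteratedDeriv hU (hu.of_le hj').contDiffAt ht]
    exact iteratedDeriv_comp_line (hf.of_le hj') y v t
  rw [taylor_within_apply] at h
  refine Eq.trans ?_ (h.trans ?_)
  · congr 1
    refine Finset.sum_congr rfl fun j hj => ?_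
    rw [hd j (Finset.mem_range.1 hj).le a left_mem_uIcc]
  · refine intervalIntegral.integral_congr fun t ht => ?_
    simp only [hd (k + 1) le_rfl t ht]

/-- The Taylor polynomial of `f` at `y` of degree less than `m`. -/
noncomputable def taylorPoly (m : ℕ) (f : E → F) (y x : E) : F :=
  ∑ j ∈ Finset.range m, (j.factorial : ℝ)⁻¹ • iteratedFDeriv ℝ j f y fun _ => x - y

theorem enorm_sub_taylorPoly_le [CompleteSpace F] {f : E → F} {m : ℕ} [NeZero m]
    (hf : ContDiff ℝ m f) (x y : E) :
    ‖f x - taylorPoly m f y x‖ₑ ≤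
      ‖x - y‖ₑ ^ m * ∫⁻ t in Ioc (0 : ℝ) 1, ‖iteratedFDeriv ℝ m f (y + t • (x - y))‖ₑ := by
  obtain ⟨k, rfl⟩ : ∃ k, m = k + 1 := ⟨m - 1, by have := NeZero.ne m; omega⟩
  have h := taylor_along_line hf y (x - y) (zero_ne_one (α := ℝ))
  simp only [one_smul, zero_smul, add_zero, sub_zero, one_pow, mul_one, add_sub_cancel] at h
  rw [taylorPoly, h, intervalIntegral.integral_of_le zero_le_one,
    ← lintegral_const_mul' _ _ (by finiteness)]
  refine (enorm_integral_le_lintegral_enorm _).trans (setLIntegral_mono' measurableSet_Ioc ?_)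
  intro t ht
  rw [enorm_smul]
  have h1 : ‖(1 - t) ^ k / (k.factorial : ℝ)‖ₑ ≤ 1 := by
    rw [← enorm_one (G := ℝ), enorm_le_iff_norm_le,
      Real.norm_of_nonneg (div_nonneg (pow_nonneg (by linarith [ht.2]) _) (by positivity)),
      norm_one, div_le_one (by positivity)]
    exact (pow_le_one₀ (by linarith [ht.2]) (by linarith [ht.1])).trans
      (by exact_mod_cast Nat.one_le_iff_ne_zero.2 k.factorial_ne_zero)
  calc _ ≤ 1 * (‖iteratedFDeriv ℝ (k + 1) f (y + t • (x - y))‖ₑ * ‖x - y‖ₑ ^ (k + 1)) := by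
        gcongr
        exact enorm_apply_const_le _ _
    _ = _ := by rw [one_mul, mul_comm]

/-- Taylor's formula is expanded at a point of the ray outside the unit ball, where all derivatives
vanish, so that only the remainder survives. Its kernel is at most s ^ (m - 1), and s ^ (m - 1) ‖x‖
^ m = s⁻¹ ‖s x‖ ^ m gives an integral adapted to dilations. -/
theorem enorm_le_lintegral_of_eq_zero_of_one_le_norm [CompleteSpace F] {f : E → F} {m : ℕ}
    [NeZero m] (hf : ContDiff ℝ m f) (hsupp : tsupport f ⊆ Metric.ball 0 1) {x : E} (hx : x ≠ 0) :
    ‖f x‖ₑ ≤ ∫⁻ s in Ioi (1 : ℝ), ENNReal.ofReal s⁻¹ *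
      (‖s • x‖ₑ ^ m * ‖iteratedFDeriv ℝ m f (s • x)‖ₑ) := by
  obtain ⟨k, rfl⟩ : ∃ k, m = k + 1 := ⟨m - 1, by have := NeZero.ne m; omega⟩
  -- Here ‖S • x‖ = 1 + ‖x‖ > 1.
  set S : ℝ := ‖x‖⁻¹ + 1 with hS
  have hxpos : 0 < ‖x‖ := norm_pos_iff.2 hx
  have hS1 : 1 < S := by have := inv_pos.2 hxpos; linarith
  have h := taylor_along_line hf 0 x hS1.ne'
  simp only [one_smul, zero_add] at h
  have hzero : ∀ j, iteratedFDeriv ℝ j f (S • x) = 0 := by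
    intro j
    by_contra hne
    have h1 := hsupp (support_iteratedFDeriv_subset (𝕜 := ℝ) j hne)
    rw [mem_ball_zero_iff, norm_smul, Real.norm_of_nonneg (by positivity), hS, add_mul,
      inv_mul_cancel₀ hxpos.ne'] at h1
    linarith
  rw [Finset.sum_eq_zero (fun j _ => by simp [hzero]), sub_zero,
    intervalIntegral.integral_of_ge hS1.le] at h
  rw [h, enorm_neg]
  refine (enorm_integral_le_lintegral_enorm _).trans ?_
  refine (setLIntegral_mono' measurableSet_Ioc ?_).trans (lintegral_mono_set Ioc_subset_Ioi_self)
  intro s hs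
  have hs0 : 0 < s := zero_lt_one.trans hs.1
  rw [enorm_smul]
  have h1 : ‖(1 - s) ^ k / (k.factorial : ℝ)‖ₑ ≤ ENNReal.ofReal (s ^ k) := by
    rw [← ofReal_norm]
    refine ENNReal.ofReal_le_ofReal ?_
    rw [norm_div, norm_pow, Real.norm_of_nonpos (by linarith [hs.1]), RCLike.norm_natCast]
    refine (div_le_self (by have := hs.1; exact pow_nonneg (by linarith) _)
      (by exact_mod_cast Nat.one_le_iff_ne_zero.2 k.factorial_ne_zero)).trans ?_
    exact pow_le_pow_left₀ (by linarith [hs.1]) (by linarith [hs.1]) _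
  calc _ ≤ ENNReal.ofReal (s ^ k) *
        (‖iteratedFDeriv ℝ (k + 1) f (s • x)‖ₑ * ‖x‖ₑ ^ (k + 1)) := by
        gcongr
        exact enorm_apply_const_le _ _
    _ = _ := by
      have h2 : ENNReal.ofReal s⁻¹ * ‖s‖ₑ ^ (k + 1) = ENNReal.ofReal (s ^ k) := by
        rw [Real.enorm_of_nonneg hs0.le, ← ENNReal.ofReal_pow hs0.le,
          ← ENNReal.ofReal_mul (by positivity)]
        congr 1
        rw [pow_succ]; field_simp
      rw [enorm_smul, mul_pow, ← h2]
      ring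

end Taylor

/-! ### Polynomial approximation on convex sets -/

section Integral

open scoped ENNReal NNReal
open Module

variable {E : Type*} [NormedAddCommGroup E] [NormedSpace ℝ E] [FiniteDimensional ℝ E]
  [MeasurableSpace E] [BorelSpace E] (μ : Measure E) [μ.IsAddHaarMeasure]

theorem lintegral_comp_add_smul {Φ : E → ℝ≥0∞} (hΦ : Measurable Φ) (w : E) {s : ℝ} (hs : 0 < s) :
    ∫⁻ x, Φ (w + s • x) ∂μ = ENNReal.ofReal ((s ^ finrank ℝ E)⁻¹) * ∫⁻ x, Φ x ∂μ := by
  have h1 : ∫⁻ x, Φ (w + s • x) ∂μ = ∫⁻ x, Φ (w + x) ∂(Measure.map (s • ·) μ) := by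
    rw [lintegral_map (by fun_prop) (by fun_prop)]
  rw [h1, Measure.map_addHaar_smul μ hs.ne', lintegral_smul_measure, smul_eq_mul,
    lintegral_add_left_eq_self, abs_of_nonneg (by positivity)]

variable {F : Type*} [NormedAddCommGroup F] [NormedSpace ℝ F] [CompleteSpace F]

/-- The point y + t (x - y) stays in Q by convexity. For t ≥ 1/2 it is used as a new variable in
place of x, for t ≤ 1/2 in place of y; either way the Jacobian costs at most 2 ^ n. -/
theorem lintegral_lintegral_segment_le {Q : Set E} (hQ : Convex ℝ Q) (hQm : MeasurableSet Q)
    {h : E → ℝ≥0∞} (hh : Measurable h) :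
    ∫⁻ y in Q, ∫⁻ x in Q, ∫⁻ t in Ioc (0 : ℝ) 1, h (y + t • (x - y)) ∂volume ∂μ ∂μ ≤
      2 ^ finrank ℝ E * μ Q * ∫⁻ x in Q, h x ∂μ := by
  set n := finrank ℝ E
  set I := ∫⁻ x in Q, h x ∂μ with hI
  have hind : ∀ {w : E} {s : ℝ}, 1 / 2 ≤ s → (∀ x ∈ Q, w + s • x ∈ Q) →
      ∫⁻ x in Q, h (w + s • x) ∂μ ≤ 2 ^ n * I := by
    intro w s hs hw
    have hs0 : 0 < s := by linarith
    calc ∫⁻ x in Q, h (w + s • x) ∂μ = ∫⁻ x in Q, Q.indicator h (w + s • x) ∂μ :=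
          setLIntegral_congr_fun hQm fun x hx => by rw [indicator_of_mem (hw x hx)]
      _ ≤ ∫⁻ x, Q.indicator h (w + s • x) ∂μ := setLIntegral_le_lintegral _ _
      _ = ENNReal.ofReal ((s ^ n)⁻¹) * I := by
          rw [lintegral_comp_add_smul μ (hh.indicator hQm) w hs0, lintegral_indicator hQm]
      _ ≤ 2 ^ n * I := by
          gcongr
          rw [show (2 : ℝ≥0∞) ^ n = ENNReal.ofReal (2 ^ n) by
            rw [ENNReal.ofReal_pow (by norm_num)]; norm_num]
          refine ENNReal.ofReal_le_ofReal ?_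
          rw [← inv_pow]
          refine pow_le_pow_left₀ (by positivity) ?_ _
          rw [inv_le_comm₀ hs0 (by norm_num)]
          linarith
  have hstep : ∀ t ∈ Ioc (0 : ℝ) 1, ∫⁻ y in Q, ∫⁻ x in Q, h (y + t • (x - y)) ∂μ ∂μ ≤
      2 ^ n * μ Q * I := by
    intro t ht
    rcases le_total (1 / 2) t with h2 | h2
    · calc _ ≤ ∫⁻ y in Q, 2 ^ n * I ∂μ := by
            refine setLIntegral_mono' hQm fun y hy => ?_
            have h3 : ∀ x, y + t • (x - y) = (1 - t) • y + t • x := fun x => by module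
            simp only [h3]
            exact hind h2 fun x hx => hQ hy hx (by linarith [ht.2]) ht.1.le (by ring)
        _ = _ := by rw [setLIntegral_const]; ring
    · rw [lintegral_lintegral_swap]
      · calc _ ≤ ∫⁻ x in Q, 2 ^ n * I ∂μ := by
              refine setLIntegral_mono' hQm fun x hx => ?_
              have h3 : ∀ y, y + t • (x - y) = t • x + (1 - t) • y := fun x => by module
              simp only [h3]
              exact hind (by linarith) fun y hy => hQ hx hy ht.1.le (by linarith [ht.2]) (by ring)
          _ = _ := by rw [setLIntegral_const]; ring
      · exact (hh.comp (g := h) (f := fun q : E × E => q.1 + t • (q.2 - q.1)) (by fun_prop)).aemeasurable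
  calc _ = ∫⁻ y in Q, ∫⁻ t in Ioc (0 : ℝ) 1, ∫⁻ x in Q, h (y + t • (x - y)) ∂μ ∂volume ∂μ := by
        refine lintegral_congr fun y => ?_
        rw [lintegral_lintegral_swap]
        exact (hh.comp (g := h) (f := fun q : E × ℝ => y + q.2 • (q.1 - y)) (by fun_prop)).aemeasurable
    _ = ∫⁻ t in Ioc (0 : ℝ) 1, ∫⁻ y in Q, ∫⁻ x in Q, h (y + t • (x - y)) ∂μ ∂μ := by
        rw [lintegral_lintegral_swap]
        refine Measurable.aemeasurable ?_
        exact Measurable.lintegral_prod_right'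
          (f := fun q : (E × ℝ) × E => h (q.1.1 + q.1.2 • (q.2 - q.1.1))) (hh.comp (by fun_prop))
    _ ≤ ∫⁻ t in Ioc (0 : ℝ) 1, 2 ^ n * μ Q * I := setLIntegral_mono' measurableSet_Ioc hstep
    _ = _ := by simp

/-- Polynomial approximation on a convex set: the error in `L_p` is controlled by the derivatives
of order `m`. -/
theorem exists_lintegral_sub_taylorPoly_le {m : ℕ} [NeZero m] {p d : ℝ} (hp : 1 ≤ p) (hd : 0 ≤ d)
    {Q : Set E} (hQ : Convex ℝ Q) (hQm : MeasurableSet Q) (hQ0 : μ Q ≠ 0) (hQt : μ Q ≠ ⊤)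
    (hdiam : ∀ x ∈ Q, ∀ y ∈ Q, ‖x - y‖ ≤ d) {f : E → F} (hf : ContDiff ℝ m f) :
    ∃ y ∈ Q, ∫⁻ x in Q, ‖f x - taylorPoly m f y x‖ₑ ^ p ∂μ ≤
      2 ^ finrank ℝ E * ENNReal.ofReal (d ^ (m * p)) *
        ∫⁻ x in Q, ‖iteratedFDeriv ℝ m f x‖ₑ ^ p ∂μ := by
  have hp0 : 0 < p := by linarith
  let h : E → ℝ≥0∞ := fun x => ‖iteratedFDeriv ℝ m f x‖ₑ ^ p
  have hcont : Continuous (iteratedFDeriv ℝ m f) := hf.continuous_iteratedFDeriv le_rfl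
  have hh : Measurable h :=
    (ENNReal.continuous_rpow_const.comp (continuous_enorm.comp hcont)).measurable
  let G : E → ℝ≥0∞ := fun y => ∫⁻ x in Q, ∫⁻ t in Ioc (0 : ℝ) 1, h (y + t • (x - y)) ∂volume ∂μ
  have hG : Measurable G := by
    refine Measurable.lintegral_prod_right'
      (f := fun q : E × E => ∫⁻ t in Ioc (0 : ℝ) 1, h (q.1 + t • (q.2 - q.1))) ?_
    exact Measurable.lintegral_prod_right'
      (f := fun q : (E × E) × ℝ => h (q.1.1 + q.2 • (q.1.2 - q.1.1))) (hh.comp (by fun_prop))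
  -- Some base point does no worse than the average. It depends on f, which is harmless: all Taylor
  -- polynomials lie in one finite-dimensional space.
  obtain ⟨y, hy, hyG⟩ := exists_le_setLAverage hQ0 hQt hG.aemeasurable
  refine ⟨y, hy, ?_⟩
  have h1 : G y ≤ 2 ^ finrank ℝ E * ∫⁻ x in Q, h x ∂μ := by
    refine hyG.trans ?_
    rw [setLAverage_eq]
    refine ENNReal.div_le_of_le_mul ((lintegral_lintegral_segment_le μ hQ hQm hh).trans_eq ?_)
    ring
  calc ∫⁻ x in Q, ‖f x - taylorPoly m f y x‖ₑ ^ p ∂μ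
      ≤ ∫⁻ x in Q, ENNReal.ofReal (d ^ (m * p)) *
          ∫⁻ t in Ioc (0 : ℝ) 1, h (y + t • (x - y)) ∂volume ∂μ := by
        refine setLIntegral_mono' hQm fun x hx => ?_
        refine (ENNReal.rpow_le_rpow (enorm_sub_taylorPoly_le hf x y) hp0.le).trans ?_
        rw [ENNReal.mul_rpow_of_nonneg _ _ hp0.le]
        gcongr
        · rw [← ENNReal.rpow_natCast, ← ENNReal.rpow_mul,
            ← ENNReal.ofReal_rpow_of_nonneg hd (by positivity)]
          refine ENNReal.rpow_le_rpow ?_ (by positivity)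
          rw [← ofReal_norm]
          exact ENNReal.ofReal_le_ofReal (hdiam x hx y hy)
        · refine (lintegral_rpow_le_measure_univ_mul ?_ hp).trans_eq ?_
          · exact ((continuous_enorm.comp hcont).comp (by fun_prop)).aemeasurable
          · simp [h]
    _ = ENNReal.ofReal (d ^ (m * p)) * G y := lintegral_const_mul' _ _ (by finiteness)
    _ ≤ ENNReal.ofReal (d ^ (m * p)) * (2 ^ finrank ℝ E * ∫⁻ x in Q, h x ∂μ) := by gcongr
    _ = _ := by ring

end Integral

/-! ### Hardy's inequality with a logarithmic weight -/

section Hardy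

open scoped ENNReal NNReal
open Module

theorem lintegral_Ioi_rpow_ne_top {a : ℝ} (ha : 0 < a) :
    ∫⁻ s in Ioi (1 : ℝ), ENNReal.ofReal (s ^ (-1 - a)) ≠ ⊤ := by
  have h := (integrableOn_Ioi_rpow_of_lt (by linarith : -1 - a < -1) one_pos)
  exact (Integrable.lintegral_lt_top h).ne

theorem lintegral_Ioi_rpow_mul_log_ne_top {a b : ℝ} (ha : 0 < a) (hb : 0 ≤ b) :
    ∫⁻ s in Ioi (1 : ℝ), ENNReal.ofReal (s ^ (-1 - a) * (1 + Real.log s) ^ b) ≠ ⊤ := by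
  -- With η b ≤ a / 2, the logarithm, bounded by a multiple of s ^ η, uses up at most half of the
  -- decay.
  set η : ℝ := a / (2 * (b + 1)) with hη
  have hη0 : 0 < η := by positivity
  have hηb : η * b ≤ a / 2 := by
    rw [hη, div_mul_eq_mul_div, div_le_div_iff₀ (by positivity) two_pos]
    nlinarith
  refine ne_top_of_le_ne_top (b := ENNReal.ofReal ((1 + 1 / η) ^ b) *
    ∫⁻ s in Ioi (1 : ℝ), ENNReal.ofReal (s ^ (-1 - a / 2)))
    (ENNReal.mul_ne_top ENNReal.ofReal_ne_top (lintegral_Ioi_rpow_ne_top (by positivity))) ?_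
  rw [← lintegral_const_mul' _ _ ENNReal.ofReal_ne_top]
  refine setLIntegral_mono' measurableSet_Ioi fun s hs => ?_
  have hs1 : (1 : ℝ) < s := hs
  have hs0 : 0 < s := by linarith
  rw [← ENNReal.ofReal_mul (by positivity)]
  refine ENNReal.ofReal_le_ofReal ?_
  have hlog := Real.log_nonneg hs1.le
  have h1 : 1 + Real.log s ≤ (1 + 1 / η) * s ^ η := by
    have h2 := Real.log_le_rpow_div hs0.le hη0
    have h3 := Real.one_le_rpow hs1.le hη0.le
    rw [add_mul, one_mul, one_div_mul_eq_div]
    linarith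
  calc s ^ (-1 - a) * (1 + Real.log s) ^ b ≤ s ^ (-1 - a) * ((1 + 1 / η) * s ^ η) ^ b := by
        gcongr
    _ = (1 + 1 / η) ^ b * s ^ (-1 - a + η * b) := by
        rw [Real.mul_rpow (by positivity) (by positivity), ← Real.rpow_mul hs0.le,
          Real.rpow_add hs0]
        ring
    _ ≤ (1 + 1 / η) ^ b * s ^ (-1 - a / 2) := by
        gcongr
        · exact hs1.le
        · linarith

/-- Write s⁻¹ = s ^ (-1 - a) s ^ a and apply Hölder's inequality for the finite measure s ^ (-1 - a)
ds on (1, ∞). -/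
theorem exists_lintegral_inv_mul_rpow_le {a p : ℝ} (ha : 0 < a) (hp : 1 ≤ p) :
    ∃ C : ℝ≥0∞, C ≠ ⊤ ∧ ∀ g : ℝ → ℝ≥0∞, Measurable g →
      (∫⁻ s in Ioi (1 : ℝ), ENNReal.ofReal s⁻¹ * g s) ^ p ≤
        C * ∫⁻ s in Ioi (1 : ℝ), ENNReal.ofReal (s ^ (-1 - a + a * p)) * g s ^ p := by
  have hp0 : 0 < p := by linarith
  refine ⟨(∫⁻ s in Ioi (1 : ℝ), ENNReal.ofReal (s ^ (-1 - a))) ^ (p - 1),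
    ENNReal.rpow_ne_top_of_nonneg (by linarith) (lintegral_Ioi_rpow_ne_top ha), fun g hg => ?_⟩
  set w : ℝ → ℝ≥0∞ := fun s => ENNReal.ofReal (s ^ (-1 - a)) with hw
  have hwm : Measurable w := by fun_prop
  have hm : Measurable fun s : ℝ => ENNReal.ofReal (s ^ a) * g s := by fun_prop
  have h := lintegral_rpow_le_measure_univ_mul (μ := (volume.restrict (Ioi (1 : ℝ))).withDensity w)
    hm.aemeasurable hp
  rw [lintegral_withDensity_eq_lintegral_mul _ hwm hm,
    lintegral_withDensity_eq_lintegral_mul _ hwm (hm.pow_const p),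
    withDensity_apply _ MeasurableSet.univ, Measure.restrict_univ] at h
  convert! h using 2
  · refine setLIntegral_congr_fun measurableSet_Ioi fun s hs => ?_
    have hs0 : (0 : ℝ) < s := zero_lt_one.trans hs
    simp only [Pi.mul_apply, hw]
    rw [← mul_assoc, ← ENNReal.ofReal_mul (by positivity), ← Real.rpow_add hs0,
      show -1 - a + a = -1 by ring, Real.rpow_neg_one]
  · refine setLIntegral_congr_fun measurableSet_Ioi fun s hs => ?_
    have hs0 : (0 : ℝ) < s := zero_lt_one.trans hs
    simp only [Pi.mul_apply, hw]
    rw [ENNReal.mul_rpow_of_nonneg _ _ hp0.le, ENNReal.ofReal_rpow_of_nonneg (by positivity) hp0.le,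
      ← mul_assoc, ← ENNReal.ofReal_mul (by positivity), ← Real.rpow_mul hs0.le,
      ← Real.rpow_add hs0]

variable {E : Type*} [NormedAddCommGroup E]

/-- The logarithmic weight `(1 + |log |x||) ^ b`. -/
noncomputable def logWeight (b : ℝ) (x : E) : ℝ≥0∞ :=
  ENNReal.ofReal ((1 + |Real.log ‖x‖|) ^ b)

@[fun_prop]
theorem measurable_logWeight [MeasurableSpace E] [OpensMeasurableSpace E] (b : ℝ) : Measurable (logWeight b : E → ℝ≥0∞) := by
  unfold logWeight
  have : Measurable fun x : E => |Real.log ‖x‖| :=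
    (Real.measurable_log.comp measurable_norm).abs
  fun_prop

/-- A dilation shifts log ‖x‖ by log s, and 1 + u + v ≤ (1 + u)(1 + v) for u, v ≥ 0. The loss is a
power of 1 + log s, uniformly in x. -/
theorem logWeight_le_of_one_lt [NormedSpace ℝ E] {b : ℝ} (hb : 0 ≤ b) {s : ℝ} (hs : 1 < s) {x : E} (hx : x ≠ 0) :
    logWeight b x ≤ ENNReal.ofReal ((1 + Real.log s) ^ b) * logWeight b (s • x) := by
  have hs0 : 0 < s := by linarith
  have hlog := Real.log_nonneg hs.le
  rw [logWeight, logWeight, ← ENNReal.ofReal_mul (by positivity),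
    ← Real.mul_rpow (by positivity) (by positivity)]
  refine ENNReal.ofReal_le_ofReal (Real.rpow_le_rpow (by positivity) ?_ hb)
  have h1 : Real.log ‖s • x‖ = Real.log s + Real.log ‖x‖ := by
    rw [norm_smul, Real.norm_of_nonneg hs0.le, Real.log_mul hs0.ne' (norm_ne_zero_iff.2 hx)]
  have h2 : |Real.log ‖x‖| ≤ Real.log s + |Real.log ‖s • x‖| := by
    rw [show Real.log ‖x‖ = Real.log ‖s • x‖ - Real.log s by rw [h1]; ring]
    refine (abs_sub _ _).trans ?_
    rw [abs_of_nonneg hlog, add_comm]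
  nlinarith [abs_nonneg (Real.log ‖s • x‖)]

variable [NormedSpace ℝ E] [FiniteDimensional ℝ E] [Nontrivial E] [MeasurableSpace E]
  [BorelSpace E] (μ : Measure E) [μ.IsAddHaarMeasure]
  {F : Type*} [NormedAddCommGroup F] [NormedSpace ℝ F] [CompleteSpace F]

/-- A Hardy inequality of order `m` with a logarithmic weight. -/
theorem exists_hardy (m : ℕ) [NeZero m] {p b : ℝ} (hp : 1 ≤ p) (hb : 0 ≤ b) :
    ∃ C : ℝ≥0∞, C ≠ ⊤ ∧ ∀ f : E → F, ContDiff ℝ m f → tsupport f ⊆ Metric.ball 0 1 →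
      ∫⁻ x in Metric.ball 0 1, logWeight b x * ‖f x‖ₑ ^ p ∂μ ≤
        C * ∫⁻ x in Metric.ball 0 1,
          logWeight b x * (‖x‖ₑ ^ m * ‖iteratedFDeriv ℝ m f x‖ₑ) ^ p ∂μ := by
  have hp0 : 0 < p := by linarith
  set n : ℕ := finrank ℝ E with hn
  have hn0 : (0 : ℝ) < n := by exact_mod_cast finrank_pos
  -- With a p = n the factor s ^ (a p) cancels the Jacobian s ^ (-n) of x ↦ s • x. What remains is s
  -- ^ (-1 - a) (1 + log s) ^ b, which is integrable on (1, ∞).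
  set a : ℝ := n / p with ha
  have ha0 : 0 < a := by positivity
  have hap : a * p = n := by rw [ha]; field_simp
  obtain ⟨C, hC, hCg⟩ := exists_lintegral_inv_mul_rpow_le ha0 hp
  refine ⟨C * ∫⁻ s in Ioi (1 : ℝ), ENNReal.ofReal (s ^ (-1 - a) * (1 + Real.log s) ^ b),
    ENNReal.mul_ne_top hC (lintegral_Ioi_rpow_mul_log_ne_top ha0 hb), fun f hf hsupp => ?_⟩
  have hcont : Continuous (iteratedFDeriv ℝ m f) := hf.continuous_iteratedFDeriv le_rfl
  let G : E → ℝ≥0∞ := fun x => ‖x‖ₑ ^ m * ‖iteratedFDeriv ℝ m f x‖ₑ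
  have hG : Measurable G :=
    (measurable_enorm.pow_const m).mul (continuous_enorm.comp hcont).measurable
  let Φ : E → ℝ≥0∞ := (Metric.ball 0 1).indicator fun x => logWeight b x * G x ^ p
  have hΦ : Measurable Φ :=
    ((measurable_logWeight b).mul (hG.pow_const p)).indicator measurableSet_ball
  have hG0 : ∀ x, x ∉ Metric.ball (0 : E) 1 → G x = 0 := by
    intro x hx
    have : iteratedFDeriv ℝ m f x = 0 := by
      by_contra hne
      exact hx (hsupp (support_iteratedFDeriv_subset (𝕜 := ℝ) m hne))
    simp only [G, this]
    rw [← ofReal_norm (0 : ContinuousMultilinearMap ℝ (fun _ : Fin m => E) F), norm_zero,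
      ENNReal.ofReal_zero, mul_zero]
  let κ : ℝ → ℝ≥0∞ := fun s => ENNReal.ofReal (s ^ (-1 - a + n) * (1 + Real.log s) ^ b)
  have hκ : Measurable κ := by
    have := Real.measurable_log
    fun_prop
  have hpt : ∀ x : E, x ≠ 0 → logWeight b x * ‖f x‖ₑ ^ p ≤
      C * ∫⁻ s in Ioi (1 : ℝ), κ s * Φ (s • x) := by
    intro x hx
    have h1 := ENNReal.rpow_le_rpow
      (enorm_le_lintegral_of_eq_zero_of_one_le_norm hf hsupp hx) hp0.le
    have h2 := h1.trans (hCg (fun s => G (s • x)) (hG.comp (by fun_prop)))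
    calc _ ≤ logWeight b x * (C * ∫⁻ s in Ioi (1 : ℝ),
            ENNReal.ofReal (s ^ (-1 - a + a * p)) * G (s • x) ^ p) := by gcongr
      _ = C * ∫⁻ s in Ioi (1 : ℝ), logWeight b x *
            (ENNReal.ofReal (s ^ (-1 - a + a * p)) * G (s • x) ^ p) := by
          rw [lintegral_const_mul' _ _ (by simp [logWeight])]; ring
      _ ≤ _ := by
          gcongr C * ?_
          refine setLIntegral_mono' measurableSet_Ioi fun s hs => ?_
          have hs1 : (1 : ℝ) < s := hs
          have hs0 : 0 < s := by linarith
          by_cases hsx : s • x ∈ Metric.ball (0 : E) 1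
          · simp only [Φ, indicator_of_mem hsx, κ]
            rw [ENNReal.ofReal_mul (by positivity), hap]
            calc _ ≤ ENNReal.ofReal ((1 + Real.log s) ^ b) * logWeight b (s • x) *
                  (ENNReal.ofReal (s ^ (-1 - a + n)) * G (s • x) ^ p) := by
                  gcongr
                  exact logWeight_le_of_one_lt hb hs1 hx
              _ = _ := by ring
          · simp [hG0 _ hsx, hp0]
  -- The ray argument breaks down at the origin only, a null set.
  have hne : ∀ᵐ x ∂μ, x ≠ 0 := Measure.ae_ne μ 0
  calc _ ≤ ∫⁻ x, logWeight b x * ‖f x‖ₑ ^ p ∂μ := setLIntegral_le_lintegral _ _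
    _ ≤ ∫⁻ x, C * ∫⁻ s in Ioi (1 : ℝ), κ s * Φ (s • x) ∂volume ∂μ :=
        lintegral_mono_ae (hne.mono hpt)
    _ = C * ∫⁻ x, ∫⁻ s in Ioi (1 : ℝ), κ s * Φ (s • x) ∂volume ∂μ := lintegral_const_mul' _ _ hC
    _ = C * ∫⁻ s in Ioi (1 : ℝ), ∫⁻ x, κ s * Φ (s • x) ∂μ ∂volume := by
        rw [lintegral_lintegral_swap]
        exact ((hκ.comp measurable_snd).mul
          (hΦ.comp (measurable_snd.smul measurable_fst))).aemeasurable
    _ = C * ∫⁻ s in Ioi (1 : ℝ), ENNReal.ofReal (s ^ (-1 - a) * (1 + Real.log s) ^ b) *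
          ∫⁻ x, Φ x ∂μ := by
        congr 1
        refine setLIntegral_congr_fun measurableSet_Ioi fun s hs => ?_
        have hs1 : (1 : ℝ) < s := hs
        have hs0 : (0 : ℝ) < s := by linarith
        have hlog := Real.log_nonneg hs1.le
        have h := lintegral_comp_add_smul μ hΦ 0 hs0
        simp only [zero_add] at h
        rw [lintegral_const_mul' _ _ ENNReal.ofReal_ne_top, h, ← mul_assoc,
          ← ENNReal.ofReal_mul (by positivity)]
        congr 2
        rw [Real.rpow_add hs0, Real.rpow_natCast, ← hn]
        field_simp
    _ = _ := by
        rw [lintegral_mul_const, lintegral_indicator measurableSet_ball, mul_assoc]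
        have := Real.measurable_log
        fun_prop

end Hardy

/-! ### Symmetry of iterated derivatives -/

section Symmetry

variable {E F : Type*} [NormedAddCommGroup E] [NormedSpace ℝ E]
  [NormedAddCommGroup F] [NormedSpace ℝ F]

theorem fderiv_iteratedFDeriv_apply {f : E → F} {k : ℕ} (hf : ContDiff ℝ (k + 1 : ℕ) f)
    (x u : E) (w : Fin k → E) :
    fderiv ℝ (iteratedFDeriv ℝ k f) x u w = fderiv ℝ (fun y => iteratedFDeriv ℝ k f y w) x u := by
  have hd : DifferentiableAt ℝ (iteratedFDeriv ℝ k f) x :=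
    (hf.differentiable_iteratedFDeriv (by exact_mod_cast Nat.lt_succ_self k)) x
  have h := ((ContinuousMultilinearMap.apply ℝ (fun _ : Fin k => E) F w).hasFDerivAt.comp x
    hd.hasFDerivAt).fderiv
  exact (DFunLike.congr_fun h u).symm

/-- Swapping the first two directions is the symmetry of the second derivative of a lower iterated
derivative. Any other adjacent swap leaves the first direction alone and is the induction
hypothesis, differentiated once. Adjacent swaps generate all permutations. -/
theorem iteratedFDeriv_comp_swap {k : ℕ} : ∀ {f : E → F}, ContDiff ℝ (k + 1 : ℕ) f → ∀ (x : E)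
    (i : Fin k) (v : Fin (k + 1) → E),
    iteratedFDeriv ℝ (k + 1) f x (v ∘ Equiv.swap i.castSucc i.succ) =
      iteratedFDeriv ℝ (k + 1) f x v := by
  induction k with
  | zero => intro f _ _ i; exact i.elim0
  | succ k ih =>
    intro f hf x i v
    have hle : ((k + 1 : ℕ) : WithTop ℕ∞) ≤ (k + 1 + 1 : ℕ) := by exact_mod_cast Nat.le_succ _
    rw [iteratedFDeriv_succ_apply_left, iteratedFDeriv_succ_apply_left]
    induction i using Fin.cases with
    | zero =>
      have h0 : (v ∘ Equiv.swap (Fin.castSucc 0) (Fin.succ 0)) 0 = v 1 := by simp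
      have h1 : Fin.tail (v ∘ Equiv.swap (Fin.castSucc (0 : Fin (k + 1))) (Fin.succ 0)) 0 = v 0 := by
        simp [Fin.tail]
      have h2 : Fin.tail (Fin.tail (v ∘ Equiv.swap (Fin.castSucc (0 : Fin (k + 1)))
          (Fin.succ 0))) = Fin.tail (Fin.tail v) := by
        ext j
        simp only [Fin.tail, Function.comp]
        rw [Equiv.swap_apply_of_ne_of_ne]
        · exact Fin.succ_ne_zero _
        · intro h
          exact Fin.succ_ne_zero j (Fin.succ_injective _ h)
      have key : ∀ (u : E) (w : Fin (k + 1) → E),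
          fderiv ℝ (fun y => iteratedFDeriv ℝ (k + 1) f y w) x u =
            (fderiv ℝ (fderiv ℝ (iteratedFDeriv ℝ k f)) x u (w 0)) (Fin.tail w) := by
        intro u w
        have hg : ContDiff ℝ 2 (iteratedFDeriv ℝ k f) :=
          hf.iteratedFDeriv_right (by norm_cast; omega)
        have hd : DifferentiableAt ℝ (fderiv ℝ (iteratedFDeriv ℝ k f)) x :=
          ((hg.fderiv_right (m := 1) (by norm_num)).differentiable (by norm_num)) x
        have h1 := hd.hasFDerivAt.clm_apply (hasFDerivAt_const (w 0) x)
        have h := ((ContinuousMultilinearMap.apply ℝ (fun _ : Fin k => E) F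
          (Fin.tail w)).hasFDerivAt.comp x h1).fderiv
        refine (DFunLike.congr_fun h u).trans ?_
        simp
      rw [fderiv_iteratedFDeriv_apply hf, fderiv_iteratedFDeriv_apply hf, key, key, h0, h1, h2]
      have hg : ContDiffAt ℝ 2 (iteratedFDeriv ℝ k f) x :=
        (hf.iteratedFDeriv_right (by norm_cast; omega)).contDiffAt
      have hs := (hg.isSymmSndFDerivAt (by simp)).eq (v 1) (v 0)
      rw [hs]
      rfl
    | succ j =>
      have h0 : (v ∘ Equiv.swap (Fin.castSucc j.succ) (Fin.succ j.succ)) 0 = v 0 := by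
        simp only [Function.comp]
        rw [Equiv.swap_apply_of_ne_of_ne]
        · rw [Fin.castSucc_succ]; exact (Fin.succ_ne_zero _).symm
        · exact (Fin.succ_ne_zero _).symm
      have h1 : Fin.tail (v ∘ Equiv.swap (Fin.castSucc j.succ) (Fin.succ j.succ)) =
          Fin.tail v ∘ Equiv.swap j.castSucc j.succ := by
        ext l
        simp only [Fin.tail, Function.comp, Fin.castSucc_succ]
        rw [← (Fin.succ_injective _).swap_apply]
      rw [h0, h1, fderiv_iteratedFDeriv_apply hf, fderiv_iteratedFDeriv_apply hf]
      simp only [ih (hf.of_le hle) _ j]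

/-- The `k`-th derivative of a `C^k` function is symmetric. -/
theorem iteratedFDeriv_comp_perm_of_contDiff {k : ℕ} {f : E → F} (hf : ContDiff ℝ k f) (x : E)
    (v : Fin k → E) (s : Equiv.Perm (Fin k)) :
    iteratedFDeriv ℝ k f x (v ∘ s) = iteratedFDeriv ℝ k f x v := by
  cases k with
  | zero => congr 1; ext i; exact i.elim0
  | succ k =>
    have hs : s ∈ Submonoid.closure
        (Set.range fun i : Fin k => Equiv.swap i.castSucc i.succ) := by
      rw [Equiv.Perm.mclosure_swap_castSucc_succ]; trivial
    induction hs using Submonoid.closure_induction generalizing v with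
    | mem s hs =>
      obtain ⟨i, rfl⟩ := hs
      exact iteratedFDeriv_comp_swap hf x i v
    | one => rfl
    | mul s t _ _ hs ht =>
      rw [← hs v, ← ht (v ∘ s)]
      rfl

/-- An equivalence in place of a permutation spares the cast between ∑ i, α i and m. -/
theorem iteratedFDeriv_comp_equiv {k l : ℕ} (e : Fin l ≃ Fin k) {f : E → F}
    (hf : ContDiff ℝ k f) (x : E) (v : Fin k → E) :
    iteratedFDeriv ℝ l f x (v ∘ e) = iteratedFDeriv ℝ k f x v := by
  obtain rfl : l = k := by simpa using Fintype.card_congr e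
  exact iteratedFDeriv_comp_perm_of_contDiff hf x v e

end Symmetry

/-! ### Partial derivatives against the full derivative -/

section MultiDeriv

open scoped ENNReal NNReal

variable {n : ℕ}

theorem norm_multiDeriv_le (α : Fin n → ℕ) (f : EuclideanSpace ℝ (Fin n) → ℂ)
    (x : EuclideanSpace ℝ (Fin n)) :
    ‖multiDeriv α f x‖ ≤ ‖iteratedFDeriv ℝ (∑ i, α i) f x‖ := by
  refine (ContinuousMultilinearMap.le_opNorm _ _).trans_eq ?_
  simp

theorem iteratedFDeriv_single_eq_multiDeriv {m : ℕ} {f : EuclideanSpace ℝ (Fin n) → ℂ}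
    (hf : ContDiff ℝ m f) (x : EuclideanSpace ℝ (Fin n)) (i : Fin m → Fin n) :
    ∃ α ∈ Finset.Nat.antidiagonalTuple n m,
      iteratedFDeriv ℝ m f x (fun k => EuclideanSpace.single (i k) (1 : ℝ)) =
        multiDeriv α f x := by
  -- α counts how often each direction occurs in the list i, and e matches the sorted list in
  -- `multiDeriv` with i.
  let α : Fin n → ℕ := fun j => Fintype.card {k // i k = j}
  let e : Fin (∑ j, α j) ≃ Fin m :=
    (finSigmaFinEquiv.symm.trans (Equiv.sigmaCongrRight fun j =>
      (Fintype.equivFin {k // i k = j}).symm)).trans (Equiv.sigmaFiberEquiv i)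
  refine ⟨α, ?_, ?_⟩
  · rw [Finset.Nat.mem_antidiagonalTuple]
    simpa using Fintype.card_congr e
  · rw [multiDeriv, ← iteratedFDeriv_comp_equiv e hf]
    congr 1
    ext1 l
    have : i (e l) = (finSigmaFinEquiv.symm l).1 :=
      ((Fintype.equivFin {k // i k = (finSigmaFinEquiv.symm l).1}).symm
        (finSigmaFinEquiv.symm l).2).2
    simp only [Function.comp, this]

/-- Expanding every argument in coordinates produces n ^ m terms, and each is a partial derivative
by symmetry. -/
theorem norm_iteratedFDeriv_le_sum_multiDeriv {m : ℕ} {f : EuclideanSpace ℝ (Fin n) → ℂ}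
    (hf : ContDiff ℝ m f) (x : EuclideanSpace ℝ (Fin n)) :
    ‖iteratedFDeriv ℝ m f x‖ ≤
      (n : ℝ) ^ m * ∑ α ∈ Finset.Nat.antidiagonalTuple n m, ‖multiDeriv α f x‖ := by
  have hS : 0 ≤ ∑ α ∈ Finset.Nat.antidiagonalTuple n m, ‖multiDeriv α f x‖ :=
    Finset.sum_nonneg fun _ _ => norm_nonneg _
  refine ContinuousMultilinearMap.opNorm_le_bound (by positivity) fun v => ?_
  have hv : v = fun k => ∑ j, v k j • EuclideanSpace.single j (1 : ℝ) := by
    ext k l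
    simp [Finset.sum_apply, Pi.single_apply]
  conv_lhs => rw [hv]
  rw [ContinuousMultilinearMap.map_sum]
  refine (norm_sum_le _ _).trans ?_
  calc ∑ i : Fin m → Fin n, ‖iteratedFDeriv ℝ m f x fun k =>
          v k (i k) • EuclideanSpace.single (i k) (1 : ℝ)‖
      ≤ ∑ _i : Fin m → Fin n, (∏ k, ‖v k‖) *
          ∑ α ∈ Finset.Nat.antidiagonalTuple n m, ‖multiDeriv α f x‖ := by
        refine Finset.sum_le_sum fun i _ => ?_
        rw [ContinuousMultilinearMap.map_smul_univ, norm_smul, norm_prod]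
        obtain ⟨α, hα, h⟩ := iteratedFDeriv_single_eq_multiDeriv hf x i
        rw [h]
        gcongr
        · exact PiLp.norm_apply_le _ _
        · exact Finset.single_le_sum (f := fun α => ‖multiDeriv α f x‖)
            (fun _ _ => norm_nonneg _) hα
    _ = _ := by simp; ring

end MultiDeriv

/-! ### The norm as an energy, and boundedness into L_p -/

section Energy

open scoped ENNReal NNReal

variable {n m : ℕ} {p σ : ℝ}

theorem exists_enorm_iteratedFDeriv_rpow_le (n m : ℕ) {p : ℝ} (hp : 1 ≤ p) :
    ∃ C : ℝ≥0∞, C ≠ ⊤ ∧ ∀ f : EuclideanSpace ℝ (Fin n) → ℂ, ContDiff ℝ m f → ∀ x,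
      ‖iteratedFDeriv ℝ m f x‖ₑ ^ p ≤
        C * ∑ α ∈ Finset.Nat.antidiagonalTuple n m, ‖multiDeriv α f x‖ₑ ^ p := by
  have hp0 : 0 < p := by linarith
  set c : ℝ := ((n : ℝ) ^ m) ^ p * ((Finset.Nat.antidiagonalTuple n m).card : ℝ) ^ (p - 1)
  refine ⟨ENNReal.ofReal c, ENNReal.ofReal_ne_top, fun f hf x => ?_⟩
  have h1 : ‖iteratedFDeriv ℝ m f x‖ ^ p ≤
      c * ∑ α ∈ Finset.Nat.antidiagonalTuple n m, ‖multiDeriv α f x‖ ^ p := by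
    refine (Real.rpow_le_rpow (norm_nonneg _) (norm_iteratedFDeriv_le_sum_multiDeriv hf x)
      hp0.le).trans ?_
    rw [Real.mul_rpow (by positivity) (Finset.sum_nonneg fun _ _ => norm_nonneg _), mul_assoc]
    gcongr
    exact Real.rpow_sum_le_const_mul_sum_rpow_of_nonneg _ hp fun _ _ => norm_nonneg _
  have h2 := ENNReal.ofReal_le_ofReal h1
  rw [ENNReal.ofReal_mul (by positivity), ENNReal.ofReal_sum_of_nonneg
    (fun _ _ => by positivity)] at h2
  simpa only [← ENNReal.ofReal_rpow_of_nonneg (norm_nonneg _) hp0.le, ofReal_norm] using h2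

namespace CZero

theorem tsupport_subset (φ : CZero n m p σ) :
    tsupport (φ : EuclideanSpace ℝ (Fin n) → ℂ) ⊆ Metric.ball 0 1 :=
  TestFunction.tsupport_subset' φ

theorem continuous (φ : CZero n m p σ) : Continuous (φ : EuclideanSpace ℝ (Fin n) → ℂ) :=
  φ.contDiff.continuous

/-- The integral of the weighted derivatives of order `m` to the power `p`. -/
noncomputable def energy (φ : CZero n m p σ) : ℝ≥0∞ :=
  ∫⁻ x in Metric.ball 0 1, logWeight (σ * p) x *
    (‖x‖ₑ ^ m * ‖iteratedFDeriv ℝ m (φ : EuclideanSpace ℝ (Fin n) → ℂ) x‖ₑ) ^ p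

theorem enorm_weighted_rpow (hp : 1 ≤ p) (φ : CZero n m p σ) (α : Fin n → ℕ)
    (x : EuclideanSpace ℝ (Fin n)) :
    ‖φ.weighted α x‖ₑ ^ p = logWeight (σ * p) x * (‖x‖ₑ ^ m * ‖multiDeriv α φ x‖ₑ) ^ p := by
  have hp0 : 0 < p := by linarith
  rw [weighted, enorm_mul, ENNReal.mul_rpow_of_nonneg _ _ hp0.le,
    ENNReal.mul_rpow_of_nonneg _ _ hp0.le, ← mul_assoc]
  congr 1
  rw [← ofReal_norm, Complex.norm_real, Real.norm_of_nonneg (weight_nonneg x), weight, logWeight,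
    mul_comm, ENNReal.ofReal_mul (by positivity), ENNReal.mul_rpow_of_nonneg _ _ hp0.le,
    ENNReal.ofReal_rpow_of_nonneg (by positivity) hp0.le, ← Real.rpow_mul (by positivity),
    ENNReal.ofReal_pow (norm_nonneg _), ofReal_norm]

theorem ofReal_part_rpow [NeZero m] (hp : 1 ≤ p) (φ : CZero n m p σ) {α : Fin n → ℕ}
    (hα : ∑ i, α i = m) :
    ENNReal.ofReal (φ.part α ^ p) = ∫⁻ x in (unitBall n : Set _), ‖φ.weighted α x‖ₑ ^ p := by
  have hp0 : 0 < p := by linarith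
  have hmem := φ.memLp_weighted hα (ENNReal.ofReal p)
  rw [part, ← ENNReal.ofReal_rpow_of_nonneg ENNReal.toReal_nonneg hp0.le,
    ENNReal.ofReal_toReal hmem.2.ne, eLpNorm_eq_lintegral_rpow_enorm_toReal (by simpa using hp0)
    ENNReal.ofReal_ne_top, ENNReal.toReal_ofReal hp0.le, ← ENNReal.rpow_mul,
    one_div_mul_cancel hp0.ne', ENNReal.rpow_one]

theorem enorm_rpow_eq [NeZero m] [hp : Fact (1 ≤ p)] (φ : CZero n m p σ) :
    ‖φ‖ₑ ^ p = ∑ α ∈ Finset.Nat.antidiagonalTuple n m,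
      ∫⁻ x in (unitBall n : Set _), ‖φ.weighted α x‖ₑ ^ p := by
  have hp0 : 0 < p := by linarith [hp.out]
  have h0 : 0 ≤ ∑ α ∈ Finset.Nat.antidiagonalTuple n m, φ.part α ^ p :=
    Finset.sum_nonneg fun _ _ => Real.rpow_nonneg (part_nonneg _ _) _
  rw [← ofReal_norm, ENNReal.ofReal_rpow_of_nonneg (norm_nonneg _) hp0.le, norm_def,
    eNorm_eq hp.out, ← Real.rpow_mul h0, one_div_mul_cancel hp0.ne', Real.rpow_one,
    ENNReal.ofReal_sum_of_nonneg fun _ _ => Real.rpow_nonneg (part_nonneg _ _) _]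
  exact Finset.sum_congr rfl fun α hα =>
    ofReal_part_rpow hp.out φ (Finset.Nat.mem_antidiagonalTuple.1 hα)

theorem measurable_weighted_rpow (hp : 1 ≤ p) (φ : CZero n m p σ) {α : Fin n → ℕ}
    (hα : ∑ i, α i = m) : Measurable fun x => ‖φ.weighted α x‖ₑ ^ p := by
  simp only [enorm_weighted_rpow hp]
  have := (φ.continuous_multiDeriv hα).measurable
  fun_prop

/-- With `enorm_rpow_le_card_mul_energy` this makes the energy equivalent to the p-th power of the
norm. The energy involves the full m-th derivative, which suits Taylor's formula and rescaling. -/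
theorem exists_energy_le (n m : ℕ) [NeZero m] (p σ : ℝ) [hp : Fact (1 ≤ p)] :
    ∃ C : ℝ≥0∞, C ≠ ⊤ ∧ ∀ φ : CZero n m p σ, φ.energy ≤ C * ‖φ‖ₑ ^ p := by
  have hp0 : 0 < p := by linarith [hp.out]
  obtain ⟨C, hC, h⟩ := exists_enorm_iteratedFDeriv_rpow_le n m hp.out
  refine ⟨C, hC, fun φ => ?_⟩
  rw [enorm_rpow_eq, ← lintegral_finsetSum' _ fun α hα => (measurable_weighted_rpow hp.out φ
    (Finset.Nat.mem_antidiagonalTuple.1 hα)).aemeasurable, ← lintegral_const_mul' _ _ hC]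
  refine lintegral_mono fun x => ?_
  simp only [enorm_weighted_rpow hp.out]
  simp only [ENNReal.mul_rpow_of_nonneg _ _ hp0.le, ← Finset.mul_sum]
  calc _ ≤ logWeight (σ * p) x * ((‖x‖ₑ ^ m) ^ p *
        (C * ∑ α ∈ Finset.Nat.antidiagonalTuple n m, ‖multiDeriv α φ x‖ₑ ^ p)) := by
        gcongr
        exact h φ φ.contDiff x
    _ = _ := by ring

theorem enorm_rpow_le_card_mul_energy [NeZero m] [hp : Fact (1 ≤ p)] (φ : CZero n m p σ) :
    ‖φ‖ₑ ^ p ≤ (Finset.Nat.antidiagonalTuple n m).card * φ.energy := by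
  have hp0 : 0 < p := by linarith [hp.out]
  rw [enorm_rpow_eq, ← nsmul_eq_mul]
  refine Finset.sum_le_card_nsmul _ _ _ fun α hα => ?_
  refine lintegral_mono fun x => ?_
  simp only [enorm_weighted_rpow hp.out]
  gcongr
  have h := norm_multiDeriv_le α φ x
  rw [Finset.Nat.mem_antidiagonalTuple.1 hα] at h
  rw [← ofReal_norm, ← ofReal_norm]
  exact ENNReal.ofReal_le_ofReal h

theorem memLp (φ : CZero n m p σ) :
    MemLp (φ : EuclideanSpace ℝ (Fin n) → ℂ) (ENNReal.ofReal p)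
      (volume.restrict (unitBall n : Set (EuclideanSpace ℝ (Fin n)))) :=
  (φ.continuous.memLp_of_hasCompactSupport (TestFunction.hasCompactSupport' φ)).restrict _

/-- The inclusion of `C₀^m(B)` into `L_p(B)`. -/
noncomputable def toLpBall (n m : ℕ) (p σ : ℝ) [Fact (1 ≤ p)] :
    CZero n m p σ →ₗ[ℂ] LpBall n p where
  toFun φ := φ.memLp.toLp φ
  map_add' _ _ := rfl
  map_smul' _ _ := rfl

/-- The map that sends `φ` to its weighted derivative in `L_p(B)`. -/
noncomputable def weightedLp [NeZero m] [Fact (1 ≤ p)] (σ : ℝ) {α : Fin n → ℕ}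
    (hα : ∑ i, α i = m) : CZero n m p σ →ₗ[ℂ] LpBall n p where
  toFun φ := (φ.memLp_weighted hα (ENNReal.ofReal p)).toLp (φ.weighted α)
  map_add' φ ψ := by
    rw [← MemLp.toLp_add]
    congr 1
    ext x
    simp only [weighted, Pi.add_apply, multiDeriv_add φ ψ hα, mul_add]
  map_smul' c φ := by
    rw [RingHom.id_apply, ← MemLp.toLp_const_smul]
    congr 1
    ext x
    simp only [weighted, Pi.smul_apply, multiDeriv_smul c φ hα, smul_eq_mul]
    ring

end CZero

theorem enorm_toLp_rpow [hp : Fact (1 ≤ p)] {g : EuclideanSpace ℝ (Fin n) → ℂ}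
    (hg : MemLp g (ENNReal.ofReal p)
      (volume.restrict (unitBall n : Set (EuclideanSpace ℝ (Fin n))))) :
    ‖hg.toLp g‖ₑ ^ p = ∫⁻ x in Metric.ball 0 1, ‖g x‖ₑ ^ p := by
  have hp0 : 0 < p := by linarith [hp.out]
  rw [← ofReal_norm, Lp.norm_toLp, ENNReal.ofReal_toReal hg.2.ne,
    eLpNorm_eq_lintegral_rpow_enorm_toReal (by simpa using hp0)
    ENNReal.ofReal_ne_top, ENNReal.toReal_ofReal hp0.le, ← ENNReal.rpow_mul,
    one_div_mul_cancel hp0.ne', ENNReal.rpow_one]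
  rfl

theorem norm_le_of_enorm_rpow_le {X Y : Type*} [SeminormedAddCommGroup X]
    [SeminormedAddCommGroup Y] (hp : 0 < p) {C : ℝ≥0∞} (hC : C ≠ ⊤) {x : X} {y : Y}
    (h : ‖y‖ₑ ^ p ≤ C * ‖x‖ₑ ^ p) : ‖y‖ ≤ (C ^ (1 / p)).toReal * ‖x‖ := by
  have h2 : ‖y‖ₑ ≤ C ^ (1 / p) * ‖x‖ₑ := by
    have := ENNReal.rpow_le_rpow h (one_div_nonneg.2 hp.le)
    rwa [ENNReal.mul_rpow_of_nonneg _ _ (one_div_nonneg.2 hp.le), ← ENNReal.rpow_mul,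
      ← ENNReal.rpow_mul, mul_one_div_cancel hp.ne', ENNReal.rpow_one, ENNReal.rpow_one] at this
  have hC' : C ^ (1 / p) ≠ ⊤ := ENNReal.rpow_ne_top_of_nonneg (one_div_nonneg.2 hp.le) hC
  have h3 := ENNReal.toReal_mono (ENNReal.mul_ne_top hC' enorm_ne_top) h2
  rwa [ENNReal.toReal_mul, toReal_enorm, toReal_enorm] at h3

namespace CZero

/-- Hardy's inequality with b = σ p. The weight on the left is at least 1, which gives boundedness
into L_p, and it is large near the origin, which pays for dropping φ there. -/
theorem exists_lintegral_logWeight_le (n m : ℕ) [NeZero n] [NeZero m] (p : ℝ) {σ : ℝ}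
    [hp : Fact (1 ≤ p)] (hσ : 0 < σ) :
    ∃ C : ℝ≥0∞, C ≠ ⊤ ∧ ∀ φ : CZero n m p σ,
      ∫⁻ x in Metric.ball 0 1, logWeight (σ * p) x * ‖φ x‖ₑ ^ p ≤ C * ‖φ‖ₑ ^ p := by
  have hp0 : 0 < p := by linarith [hp.out]
  obtain ⟨C₁, hC₁, h₁⟩ := exists_hardy (F := ℂ)
    (volume : Measure (EuclideanSpace ℝ (Fin n))) m hp.out (by positivity : 0 ≤ σ * p)
  obtain ⟨C₂, hC₂, h₂⟩ := exists_energy_le n m p σ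
  refine ⟨C₁ * C₂, ENNReal.mul_ne_top hC₁ hC₂, fun φ => ?_⟩
  refine (h₁ φ φ.contDiff φ.tsupport_subset).trans ?_
  rw [mul_assoc]
  gcongr
  exact h₂ φ

theorem one_le_logWeight {b : ℝ} (hb : 0 ≤ b) (x : EuclideanSpace ℝ (Fin n)) :
    1 ≤ logWeight b x := by
  rw [logWeight, ENNReal.one_le_ofReal]
  exact Real.one_le_rpow (by linarith [abs_nonneg (Real.log ‖x‖)]) hb

theorem exists_norm_toLpBall_le (n m : ℕ) [NeZero n] [NeZero m] (p : ℝ) {σ : ℝ}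
    [hp : Fact (1 ≤ p)] (hσ : 0 < σ) :
    ∃ C : ℝ, ∀ φ : CZero n m p σ, ‖toLpBall n m p σ φ‖ ≤ C * ‖φ‖ := by
  have hp0 : 0 < p := by linarith [hp.out]
  obtain ⟨C, hC, h⟩ := exists_lintegral_logWeight_le n m p hσ
  refine ⟨(C ^ (1 / p)).toReal, fun φ => norm_le_of_enorm_rpow_le hp0 hC ((h φ).trans' ?_)⟩
  refine (enorm_toLp_rpow φ.memLp).trans_le (lintegral_mono fun x => ?_)
  exact le_mul_of_one_le_left zero_le (one_le_logWeight (by positivity) x)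

theorem norm_weightedLp [NeZero m] [Fact (1 ≤ p)] {α : Fin n → ℕ}
    (hα : ∑ i, α i = m) (φ : CZero n m p σ) : ‖weightedLp σ hα φ‖ = φ.part α :=
  Lp.norm_toLp _ (φ.memLp_weighted hα _)

theorem norm_rpow_eq_sum_part [NeZero m] [hp : Fact (1 ≤ p)] (φ : CZero n m p σ) :
    ‖φ‖ ^ p = ∑ α ∈ Finset.Nat.antidiagonalTuple n m, φ.part α ^ p := by
  have hp0 : 0 < p := by linarith [hp.out]
  have h0 : 0 ≤ ∑ α ∈ Finset.Nat.antidiagonalTuple n m, φ.part α ^ p :=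
    Finset.sum_nonneg fun _ _ => Real.rpow_nonneg (part_nonneg _ _) _
  rw [norm_def, eNorm_eq hp.out, ← Real.rpow_mul h0, one_div_mul_cancel hp0.ne', Real.rpow_one]

/-- The weighted derivatives embed C₀^m(B) isometrically into an ℓ_p-sum of copies of L_p(B). In
this form the norm formula passes to the completion. -/
theorem norm_rpow_eq [NeZero m] [hp : Fact (1 ≤ p)] (φ : CZero n m p σ) :
    ‖φ‖ ^ p = ∑ α ∈ (Finset.Nat.antidiagonalTuple n m).attach,
      ‖weightedLp σ (Finset.Nat.mem_antidiagonalTuple.1 α.2) φ‖ ^ p := by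
  simp only [norm_rpow_eq_sum_part, norm_weightedLp]
  rw [Finset.sum_attach _ fun α => φ.part α ^ p]

theorem norm_weightedLp_le [NeZero m] [hp : Fact (1 ≤ p)] {α : Fin n → ℕ}
    (hα : ∑ i, α i = m) (φ : CZero n m p σ) : ‖weightedLp σ hα φ‖ ≤ 1 * ‖φ‖ := by
  have hp0 : 0 < p := by linarith [hp.out]
  have h : φ.part α ^ p ≤ ‖φ‖ ^ p := by
    rw [norm_rpow_eq_sum_part]
    exact Finset.single_le_sum (f := fun α => φ.part α ^ p)
      (fun _ _ => Real.rpow_nonneg (part_nonneg _ _) _) (Finset.Nat.mem_antidiagonalTuple.2 hα)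
  rw [one_mul, norm_weightedLp]
  exact (Real.rpow_le_rpow_iff (part_nonneg _ _) (norm_nonneg _) hp0).1 h

end CZero

end Energy

/-! ### The operator id and its injectivity -/

section Embedding

open scoped ENNReal NNReal ContDiff

/-- Integration by parts in one direction after the other. Ψ does not depend on f, so the identity
survives limits in f. -/
theorem exists_integral_mul_iteratedFDeriv_eq {E : Type*} [NormedAddCommGroup E] [NormedSpace ℝ E]
    [FiniteDimensional ℝ E] [MeasurableSpace E] [BorelSpace E] (μ : Measure E)
    [μ.IsAddHaarMeasure] {m : ℕ} (v : Fin m → E) :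
    ∀ {ψ : E → ℂ}, ContDiff ℝ ∞ ψ → HasCompactSupport ψ →
      ∃ Ψ : E → ℂ, Continuous Ψ ∧ HasCompactSupport Ψ ∧ tsupport Ψ ⊆ tsupport ψ ∧
        ∀ f : E → ℂ, ContDiff ℝ m f →
          ∫ x, ψ x * iteratedFDeriv ℝ m f x v ∂μ = ∫ x, Ψ x * f x ∂μ := by
  induction m with
  | zero =>
    intro ψ hψ hψc
    exact ⟨ψ, hψ.continuous, hψc, subset_rfl, fun f _ => by simp⟩
  | succ m ih =>
    intro ψ hψ hψc
    let ψ' : E → ℂ := fun x => -fderiv ℝ ψ x (v 0)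
    have hψ's : tsupport ψ' ⊆ tsupport ψ := by
      refine closure_minimal (fun x hx => ?_) (isClosed_tsupport _)
      by_contra h
      refine hx ?_
      have : fderiv ℝ ψ x = 0 := by
        by_contra h'
        exact h (support_fderiv_subset ℝ h')
      simp [ψ', this]
    have hψ'c : HasCompactSupport ψ' := hψc.of_isClosed_subset (isClosed_tsupport _) hψ's
    have hψ'd : ContDiff ℝ ∞ ψ' :=
      ((hψ.fderiv_right (m := ∞) (by simp)).clm_apply contDiff_const).neg
    obtain ⟨Ψ, hΨ, hΨc, hΨs, h⟩ := ih (Fin.tail v) hψ'd hψ'c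
    refine ⟨Ψ, hΨ, hΨc, hΨs.trans hψ's, fun f hf => ?_⟩
    have hle : ((m : ℕ) : WithTop ℕ∞) ≤ (m + 1 : ℕ) := by exact_mod_cast Nat.le_succ _
    rw [← h f (hf.of_le hle)]
    let G : E → ℂ := fun y => iteratedFDeriv ℝ m f y (Fin.tail v)
    have hG : ContDiff ℝ 1 G :=
      (ContinuousMultilinearMap.apply ℝ (fun _ : Fin m => E) ℂ (Fin.tail v)).contDiff.comp
        (hf.iteratedFDeriv_right (by norm_cast; omega))
    have hGv : Continuous fun x => fderiv ℝ G x (v 0) :=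
      (hG.continuous_fderiv one_ne_zero).clm_apply continuous_const
    have hint : ∀ {a b : E → ℂ}, Continuous a → Continuous b → HasCompactSupport a →
        Integrable (fun x => a x * b x) μ := fun ha hb hac =>
      (ha.mul hb).integrable_of_hasCompactSupport hac.mul_right
    have hp := integral_mul_fderiv_eq_neg_fderiv_mul_of_integrable (μ := μ) (f := ψ) (g := G)
      (v := v 0) ?_ (hint hψ.continuous hGv hψc) (hint hψ.continuous hG.continuous hψc)
      (fun x _ => hψ.differentiable (by simp) x) (fun x _ => hG.differentiable one_ne_zero x)
    · calc _ = ∫ x, ψ x * fderiv ℝ G x (v 0) ∂μ := by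
            refine integral_congr_ae (Filter.Eventually.of_forall fun x => ?_)
            simp only [G]
            rw [iteratedFDeriv_succ_apply_left, fderiv_iteratedFDeriv_apply hf]
        _ = _ := by
            rw [hp, ← integral_neg]
            simp only [ψ', G, neg_mul]
    · have := (hint hψ'd.continuous hG.continuous hψ'c).neg
      refine this.congr (Filter.Eventually.of_forall fun x => ?_)
      simp [ψ']

/-- The extension of a bounded linear map from a seminormed space to its completion. -/
noncomputable def completionExtension {X Y : Type*} [SeminormedAddCommGroup X] [NormedSpace ℂ X]
    [NormedAddCommGroup Y] [NormedSpace ℂ Y] [CompleteSpace Y] (f : X →ₗ[ℂ] Y) :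
    UniformSpace.Completion X →L[ℂ] Y :=
  f.extendOfNorm (UniformSpace.Completion.toComplL (𝕜 := ℂ) (E := X)).toLinearMap

theorem completionExtension_coe {X Y : Type*} [SeminormedAddCommGroup X] [NormedSpace ℂ X]
    [NormedAddCommGroup Y] [NormedSpace ℂ Y] [CompleteSpace Y] {f : X →ₗ[ℂ] Y}
    (hf : ∃ C, ∀ x, ‖f x‖ ≤ C * ‖x‖) (x : X) :
    completionExtension f (x : UniformSpace.Completion X) = f x := by
  obtain ⟨C, hC⟩ := hf
  exact LinearMap.extendOfNorm_eq (f := f)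
    (e := (UniformSpace.Completion.toComplL (𝕜 := ℂ) (E := X)).toLinearMap)
    UniformSpace.Completion.denseRange_coe
    ⟨C, fun x => (hC x).trans_eq (by simp [UniformSpace.Completion.norm_coe])⟩ x

variable {n m : ℕ} {p σ : ℝ}

theorem integrable_lpBall [hp : Fact (1 ≤ p)] (g : LpBall n p) :
    Integrable g (volume.restrict (unitBall n : Set (EuclideanSpace ℝ (Fin n)))) := by
  have : IsFiniteMeasure (volume.restrict (unitBall n : Set (EuclideanSpace ℝ (Fin n)))) :=
    ⟨by simpa [unitBall] using measure_ball_lt_top⟩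
  exact (Lp.memLp g).integrable (by simpa using hp.out)

/-- B has finite measure, so L_p(B) embeds continuously into L_1(B), where a bounded k acts. This
makes the weak derivative identity a closed condition. -/
theorem continuous_integral_mul [hp : Fact (1 ≤ p)] {k : EuclideanSpace ℝ (Fin n) → ℂ}
    (hk : Continuous k) (hkc : HasCompactSupport k) :
    Continuous fun g : LpBall n p =>
      ∫ x in (unitBall n : Set (EuclideanSpace ℝ (Fin n))), k x * g x := by
  have hfin : IsFiniteMeasure (volume.restrict (unitBall n : Set (EuclideanSpace ℝ (Fin n)))) :=
    ⟨by simpa [unitBall] using measure_ball_lt_top⟩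
  set ν := volume.restrict (unitBall n : Set (EuclideanSpace ℝ (Fin n)))
  obtain ⟨M, hM⟩ := hkc.exists_bound_of_continuous hk
  have hint : ∀ g : LpBall n p, Integrable (fun x => k x * g x) ν := fun g =>
    (integrable_lpBall g).bdd_mul hk.aestronglyMeasurable (Filter.Eventually.of_forall hM)
  let L : LpBall n p →ₗ[ℂ] ℂ :=
    { toFun := fun g => ∫ x, k x * g x ∂ν
      map_add' := fun g h => by
        rw [← integral_add (hint g) (hint h)]
        refine integral_congr_ae ?_
        filter_upwards [Lp.coeFn_add g h] with x hx
        rw [hx, Pi.add_apply, mul_add]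
      map_smul' := fun c g => by
        rw [RingHom.id_apply, smul_eq_mul, ← integral_const_mul]
        refine integral_congr_ae ?_
        filter_upwards [Lp.coeFn_smul c g] with x hx
        rw [hx, Pi.smul_apply, smul_eq_mul]
        ring }
  let c : ℝ≥0∞ := ν univ ^ (1 / (1 : ℝ≥0∞).toReal - 1 / (ENNReal.ofReal p).toReal)
  have hc : c ≠ ⊤ := by
    refine ENNReal.rpow_ne_top_of_nonneg ?_ (measure_ne_top _ _)
    rw [ENNReal.toReal_ofReal (by linarith [hp.out]), ENNReal.toReal_one, sub_nonneg, one_div_one]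
    exact (div_le_one (by linarith [hp.out])).2 hp.out
  refine (L.mkContinuous (M * c.toReal) fun g => ?_).continuous
  change ‖∫ x, k x * g x ∂ν‖ ≤ _
  calc ‖∫ x, k x * g x ∂ν‖ ≤ ∫ x, M * ‖g x‖ ∂ν := by
        refine norm_integral_le_of_norm_le ((integrable_lpBall g).norm.const_mul M)
          (Filter.Eventually.of_forall fun x => ?_)
        rw [norm_mul]
        gcongr
        exact hM x
    _ = M * (eLpNorm g 1 ν).toReal := by
        rw [integral_const_mul, integral_norm_eq_lintegral_enorm (integrable_lpBall g).1,
          eLpNorm_one_eq_lintegral_enorm]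
    _ ≤ M * (eLpNorm g (ENNReal.ofReal p) ν * c).toReal := by
        have hM0 : 0 ≤ M := (norm_nonneg _).trans (hM 0)
        gcongr
        · exact ENNReal.mul_ne_top (Lp.memLp g).2.ne hc
        · exact eLpNorm_le_eLpNorm_mul_rpow_measure_univ (by simpa using hp.out)
            (Lp.memLp g).1
    _ = M * c.toReal * ‖g‖ := by rw [ENNReal.toReal_mul, Lp.norm_def]; ring

theorem weight_pos {x : EuclideanSpace ℝ (Fin n)} (hx : x ≠ 0) : 0 < CZero.weight m σ x := by
  have := norm_pos_iff.2 hx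
  unfold CZero.weight
  positivity

theorem continuousOn_weight {s : Set (EuclideanSpace ℝ (Fin n))} (hs : ∀ x ∈ s, x ≠ 0) :
    ContinuousOn (CZero.weight m σ : EuclideanSpace ℝ (Fin n) → ℝ) s := by
  unfold CZero.weight
  refine (continuous_norm.pow m).continuousOn.mul (ContinuousOn.rpow_const ?_ fun x _ => ?_)
  · exact continuousOn_const.add
      (continuous_norm.continuousOn.log fun x hx => norm_ne_zero_iff.2 (hs x hx)).abs
  · left; positivity

variable [NeZero m] [hp : Fact (1 ≤ p)]

/-- The extension of the inclusion `C₀^m(B) ⊆ L_p(B)` to the completion. -/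
noncomputable def idEmbedding (n m : ℕ) [NeZero m] (p σ : ℝ) [Fact (1 ≤ p)] :
    ESpace n m p σ →L[ℂ] LpBall n p :=
  completionExtension (CZero.toLpBall n m p σ)

theorem idEmbedding_coe [NeZero n] (hσ : 0 < σ) (φ : CZero n m p σ) :
    idEmbedding n m p σ φ = CZero.toLpBall n m p σ φ :=
  completionExtension_coe (CZero.exists_norm_toLpBall_le n m p hσ) φ

/-- The extension to the completion of the map to a weighted derivative. -/
noncomputable def weightedExtension (σ : ℝ) {α : Fin n → ℕ} (hα : ∑ i, α i = m) :
    ESpace n m p σ →L[ℂ] LpBall n p :=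
  completionExtension (CZero.weightedLp σ hα)

theorem weightedExtension_coe {α : Fin n → ℕ} (hα : ∑ i, α i = m) (φ : CZero n m p σ) :
    weightedExtension σ hα (φ : ESpace n m p σ) = CZero.weightedLp σ hα φ :=
  completionExtension_coe ⟨1, CZero.norm_weightedLp_le hα⟩ φ

theorem norm_rpow_eq_weightedExtension (u : ESpace n m p σ) :
    ‖u‖ ^ p = ∑ α ∈ (Finset.Nat.antidiagonalTuple n m).attach,
      ‖weightedExtension σ (Finset.Nat.mem_antidiagonalTuple.1 α.2) u‖ ^ p := by
  have hp0 : 0 ≤ p := by linarith [hp.out]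
  induction u using UniformSpace.Completion.induction_on with
  | hp =>
    refine isClosed_eq (continuous_norm.rpow_const fun _ => Or.inr hp0) ?_
    exact continuous_finsetSum _ fun α _ =>
      ((ContinuousLinearMap.continuous _).norm.rpow_const fun _ => Or.inr hp0)
  | ih φ =>
    simp only [weightedExtension_coe, UniformSpace.Completion.norm_coe]
    exact CZero.norm_rpow_eq φ

/-- Weak differentiation away from the origin passes to the completion. -/
theorem exists_integral_weightedExtension_eq [NeZero n] (hσ : 0 < σ) {α : Fin n → ℕ}
    (hα : ∑ i, α i = m) {ψ : EuclideanSpace ℝ (Fin n) → ℂ} (hψ : ContDiff ℝ ∞ ψ)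
    (hψc : HasCompactSupport ψ) (hψs : tsupport ψ ⊆ Metric.ball 0 1 \ {0}) :
    ∃ Ψ : EuclideanSpace ℝ (Fin n) → ℂ, ∀ u : ESpace n m p σ,
      ∫ x in (unitBall n : Set (EuclideanSpace ℝ (Fin n))),
          ψ x / CZero.weight m σ x * weightedExtension σ hα u x =
        ∫ x in (unitBall n : Set (EuclideanSpace ℝ (Fin n))), Ψ x * idEmbedding n m p σ u x := by
  subst hα
  obtain ⟨Ψ, hΨ, hΨc, hΨs, h⟩ := exists_integral_mul_iteratedFDeriv_eq
    (volume : Measure (EuclideanSpace ℝ (Fin n)))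
    (fun j => EuclideanSpace.single (finSigmaFinEquiv.symm j : Σ i : Fin n, Fin (α i)).1 (1 : ℝ))
    hψ hψc
  -- The weight vanishes at the origin only, and the support of ψ avoids it; hence k is continuous.
  let k : EuclideanSpace ℝ (Fin n) → ℂ := fun x => ψ x / CZero.weight (∑ i, α i) σ x
  have hks : Function.support k ⊆ Function.support ψ := fun x hx h => hx (by simp [k, h])
  have hkts : tsupport k ⊆ tsupport ψ := closure_mono hks
  have hkc : HasCompactSupport k := hψc.of_isClosed_subset (isClosed_tsupport _) hkts
  have hopen : IsOpen (Metric.ball (0 : EuclideanSpace ℝ (Fin n)) 1 \ {0}) :=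
    Metric.isOpen_ball.sdiff isClosed_singleton
  have hk : Continuous k := by
    have hon : ContinuousOn k (Metric.ball 0 1 \ {0}) := by
      refine hψ.continuous.continuousOn.div ?_ fun x hx => ?_
      · exact Complex.continuous_ofReal.comp_continuousOn (continuousOn_weight fun x hx => hx.2)
      · exact_mod_cast (weight_pos hx.2).ne'
    exact continuous_of_tsupport fun x hx =>
      hon.continuousAt (hopen.mem_nhds (hψs (hkts hx)))
  refine ⟨Ψ, fun u => ?_⟩
  induction u using UniformSpace.Completion.induction_on with
  | hp =>
    exact isClosed_eq ((continuous_integral_mul hk hkc).comp (ContinuousLinearMap.continuous _))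
      ((continuous_integral_mul hΨ hΨc).comp (ContinuousLinearMap.continuous _))
  | ih φ =>
    rw [weightedExtension_coe, idEmbedding_coe hσ]
    have h1 := (φ.memLp_weighted rfl (ENNReal.ofReal p)).coeFn_toLp
    have h2 := φ.memLp.coeFn_toLp
    calc _ = ∫ x in (unitBall n : Set (EuclideanSpace ℝ (Fin n))), ψ x * multiDeriv α φ x := by
          refine integral_congr_ae ?_
          filter_upwards [h1] with x hx
          have : CZero.weightedLp σ rfl φ x = φ.weighted α x := hx
          rw [this, CZero.weighted]
          by_cases hx0 : x ∈ tsupport ψ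
          · have : (CZero.weight (∑ i, α i) σ x : ℂ) ≠ 0 := by
              exact_mod_cast (weight_pos (hψs hx0).2).ne'
            field_simp
          · simp [image_eq_zero_of_notMem_tsupport hx0]
      _ = ∫ x, ψ x * multiDeriv α φ x := by
          refine setIntegral_eq_integral_of_forall_compl_eq_zero fun x hx => ?_
          rw [image_eq_zero_of_notMem_tsupport fun h => hx (hψs h).1, zero_mul]
      _ = ∫ x, Ψ x * φ x := h φ φ.contDiff
      _ = ∫ x in (unitBall n : Set (EuclideanSpace ℝ (Fin n))), Ψ x * φ x := by
          refine (setIntegral_eq_integral_of_forall_compl_eq_zero fun x hx => ?_).symm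
          rw [image_eq_zero_of_notMem_tsupport fun h => hx (hψs (hΨs h)).1, zero_mul]
      _ = _ := by
          refine integral_congr_ae ?_
          filter_upwards [h2] with x hx
          have : CZero.toLpBall n _ p σ φ x = φ x := hx
          rw [this]

/-- Divided by the weight, the extension integrates to zero against every test function on the
punctured ball. The fundamental lemma of the calculus of variations applies there, and the origin is
a null set. -/
theorem weightedExtension_eq_zero [NeZero n] (hσ : 0 < σ) {α : Fin n → ℕ}
    (hα : ∑ i, α i = m) {u : ESpace n m p σ} (hu : idEmbedding n m p σ u = 0) :
    weightedExtension σ hα u = 0 := by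
  set g := weightedExtension σ hα u
  have hopen : IsOpen (Metric.ball (0 : EuclideanSpace ℝ (Fin n)) 1 \ {0}) :=
    Metric.isOpen_ball.sdiff isClosed_singleton
  let G : EuclideanSpace ℝ (Fin n) → ℂ := fun x => (CZero.weight m σ x)⁻¹ • g x
  have hloc : LocallyIntegrableOn G (Metric.ball 0 1 \ {0}) volume := by
    have h1 : LocallyIntegrableOn g (Metric.ball 0 1 \ {0}) volume :=
      (IntegrableOn.mono_set (integrable_lpBall g) sdiff_subset).locallyIntegrableOn
    refine h1.continuousOn_smul hopen.isLocallyClosed ?_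
    exact (continuousOn_weight fun x hx => hx.2).inv₀ fun x hx => (weight_pos hx.2).ne'
  have hzero := hopen.ae_eq_zero_of_integral_contDiff_smul_eq_zero hloc fun ψ hψ hψc hψs => ?_
  · rw [Lp.eq_zero_iff_ae_eq_zero]
    have hne : ∀ᵐ x ∂(volume : Measure (EuclideanSpace ℝ (Fin n))), x ≠ 0 := Measure.ae_ne _ 0
    filter_upwards [ae_restrict_of_ae hzero, ae_restrict_of_ae hne,
      ae_restrict_mem (unitBall n).isOpen.measurableSet] with x h1 h2 h3
    have := h1 ⟨h3, h2⟩
    simpa [G, (weight_pos h2).ne'] using this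
  · obtain ⟨Ψ, h⟩ := exists_integral_weightedExtension_eq (p := p) hσ hα
      (ψ := fun x => (ψ x : ℂ)) (Complex.ofRealCLM.contDiff.comp hψ)
      (hψc.comp_left (g := Complex.ofReal) Complex.ofReal_zero)
      ((closure_mono (Function.support_comp_subset (g := Complex.ofReal)
        Complex.ofReal_zero ψ)).trans hψs)
    have h1 := h u
    have h2 : ∫ x in (unitBall n : Set (EuclideanSpace ℝ (Fin n))),
        Ψ x * idEmbedding n m p σ u x = 0 := by
      rw [hu]
      refine integral_eq_zero_of_ae ?_
      filter_upwards [Lp.coeFn_zero ℂ (ENNReal.ofReal p)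
        (volume.restrict (unitBall n : Set (EuclideanSpace ℝ (Fin n))))] with x hx
      change Ψ x * (0 : LpBall n p) x = 0
      rw [hx, Pi.zero_apply, mul_zero]
    rw [h2] at h1
    rw [← h1, ← setIntegral_eq_integral_of_forall_compl_eq_zero
      (s := (unitBall n : Set (EuclideanSpace ℝ (Fin n)))) fun x hx => ?_]
    · refine integral_congr_ae (Filter.Eventually.of_forall fun x => ?_)
      simp only [G, Complex.real_smul]
      push_cast
      ring
    · rw [image_eq_zero_of_notMem_tsupport fun h => hx (hψs h).1, zero_smul]

theorem isIdEmbedding_idEmbedding [NeZero n] (hσ : 0 < σ) :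
    IsIdEmbedding (idEmbedding n m p σ) := by
  have hp0 : 0 < p := by linarith [hp.out]
  refine ⟨fun φ => ?_, ?_⟩
  · rw [idEmbedding_coe hσ]
    exact φ.memLp.coeFn_toLp
  · refine (injective_iff_map_eq_zero _).2 fun u hu => ?_
    have h := norm_rpow_eq_weightedExtension u
    rw [Finset.sum_eq_zero fun α _ => ?_, Real.rpow_eq_zero (norm_nonneg _) hp0.ne',
      norm_eq_zero] at h
    · exact h
    · rw [weightedExtension_eq_zero hσ _ hu, norm_zero, Real.zero_rpow hp0.ne']

end Embedding

/-! ### A finite-dimensional space of polynomials -/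

section Polynomial

variable (n : ℕ)

/-- The complex polynomial functions of degree at most `d` in `n` real variables. -/
noncomputable def polySpace : ℕ → Submodule ℂ (EuclideanSpace ℝ (Fin n) → ℂ)
  | 0 => Submodule.span ℂ {1}
  | d + 1 => polySpace d ⊔ ⨆ i : Fin n, (polySpace d).map
      (LinearMap.mulLeft ℂ fun x : EuclideanSpace ℝ (Fin n) => ((x i : ℝ) : ℂ))

instance finiteDimensional_polySpace (d : ℕ) : FiniteDimensional ℂ (polySpace n d) := by
  induction d with
  | zero => rw [polySpace]; infer_instance
  | succ d ih => rw [polySpace]; infer_instance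

variable {n}

theorem polySpace_le_succ (d : ℕ) : polySpace n d ≤ polySpace n (d + 1) := le_sup_left

theorem polySpace_mono : Monotone (polySpace n) := monotone_nat_of_le_succ polySpace_le_succ

theorem continuous_of_mem_polySpace {d : ℕ} {g : EuclideanSpace ℝ (Fin n) → ℂ}
    (hg : g ∈ polySpace n d) : Continuous g := by
  let S : Submodule ℂ (EuclideanSpace ℝ (Fin n) → ℂ) :=
    { carrier := {g | Continuous g}
      add_mem' := fun ha hb => ha.add hb
      zero_mem' := continuous_const
      smul_mem' := fun c _ hg => hg.const_smul c }
  suffices h : polySpace n d ≤ S from h hg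
  clear hg
  induction d with
  | zero =>
    rw [polySpace, Submodule.span_singleton_le_iff_mem]
    exact continuous_const
  | succ d ih =>
    refine sup_le ih (iSup_le fun i => ?_)
    rintro _ ⟨g, hg, rfl⟩
    have h1 : Continuous g := ih hg
    have h2 : Continuous fun x : EuclideanSpace ℝ (Fin n) => ((x i : ℝ) : ℂ) := by fun_prop
    exact h2.mul h1

theorem sub_const_mul_mem_polySpace {d : ℕ} {g : EuclideanSpace ℝ (Fin n) → ℂ}
    (hg : g ∈ polySpace n d) (i : Fin n) (c : ℝ) :
    (fun x => ((x i - c : ℝ) : ℂ) * g x) ∈ polySpace n (d + 1) := by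
  have h1 : (fun x : EuclideanSpace ℝ (Fin n) => ((x i : ℝ) : ℂ)) * g ∈ polySpace n (d + 1) :=
    Submodule.mem_sup_right (Submodule.mem_iSup_of_mem i ⟨g, hg, rfl⟩)
  have h2 := (polySpace n (d + 1)).smul_mem (c : ℂ) (polySpace_le_succ d hg)
  convert! (polySpace n (d + 1)).sub_mem h1 h2 using 1
  ext x
  simp [sub_mul]

/-- Expanding only the first argument, M(v, …, v) = ∑ v_i M(e_i, v, …, v), lowers the degree by one.
-/
theorem multilinear_sub_mem_polySpace (y : EuclideanSpace ℝ (Fin n)) {d : ℕ}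
    (M : ContinuousMultilinearMap ℝ (fun _ : Fin d => EuclideanSpace ℝ (Fin n)) ℂ) :
    (fun x => M fun _ => x - y) ∈ polySpace n d := by
  induction d with
  | zero =>
    refine Submodule.mem_span_singleton.2 ⟨M 0, ?_⟩
    ext x
    simp only [Pi.smul_apply, Pi.one_apply, smul_eq_mul, mul_one]
    congr 1
    exact Subsingleton.elim _ _
  | succ d ih =>
    have key : (fun x => M fun _ => x - y) = ∑ i : Fin n, fun x : EuclideanSpace ℝ (Fin n) =>
        ((x i - y i : ℝ) : ℂ) *
          (M.curryLeft (EuclideanSpace.single i (1 : ℝ))) fun _ => x - y := by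
      ext x
      have h1 : M (fun _ => x - y) = M.curryLeft (x - y) fun _ => x - y := by
        rw [ContinuousMultilinearMap.curryLeft_apply]
        congr 1
        ext1 k
        induction k using Fin.cases <;> rfl
      have h2 : x - y = ∑ i, (x i - y i) • EuclideanSpace.single i (1 : ℝ) := by
        ext l
        simp [Finset.sum_apply, Pi.single_apply]
      rw [h1, Finset.sum_apply]
      conv_lhs => enter [1, 2]; rw [h2]
      rw [map_sum, _root_.sum_apply]
      simp only [map_smul, _root_.smul_apply, Complex.real_smul]
    rw [key]
    exact Submodule.sum_mem _ fun i _ => sub_const_mul_mem_polySpace (ih _) i (y i)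

theorem taylorPoly_mem_polySpace (m : ℕ) (f : EuclideanSpace ℝ (Fin n) → ℂ)
    (y : EuclideanSpace ℝ (Fin n)) : taylorPoly m f y ∈ polySpace n m := by
  have key : taylorPoly m f y = ∑ j ∈ Finset.range m, ((j.factorial : ℝ)⁻¹ : ℂ) •
      fun x => iteratedFDeriv ℝ j f y fun _ => x - y := by
    ext x
    simp only [taylorPoly, Finset.sum_apply, Pi.smul_apply]
    refine Finset.sum_congr rfl fun j _ => ?_
    rw [Complex.real_smul]
    push_cast
    rfl
  rw [key]
  exact Submodule.sum_mem _ fun j hj => Submodule.smul_mem _ _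
    (polySpace_mono (Finset.mem_range.1 hj).le (multilinear_sub_mem_polySpace y _))

end Polynomial

/-! ### Dyadic shells and their grids -/

section Cell

variable {n : ℕ}

theorem norm_le_of_forall_abs_le {x : EuclideanSpace ℝ (Fin n)} {c : ℝ} (hc : 0 ≤ c)
    (h : ∀ i, |x i| ≤ c) : ‖x‖ ≤ n * c := by
  rw [EuclideanSpace.norm_eq]
  refine Real.sqrt_le_iff.2 ⟨by positivity, ?_⟩
  calc ∑ i, ‖x i‖ ^ 2 ≤ ∑ _i : Fin n, c ^ 2 := by
        refine Finset.sum_le_sum fun i _ => ?_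
        rw [Real.norm_eq_abs]
        exact pow_le_pow_left₀ (abs_nonneg _) (h i) 2
    _ = n * c ^ 2 := by simp
    _ ≤ (n : ℝ) ^ 2 * c ^ 2 := by
        gcongr
        exact_mod_cast Nat.le_self_pow two_ne_zero n
    _ = _ := by ring

/-- The half-open cube with side `2 r` centred at the origin. -/
def box (n : ℕ) (r : ℝ) : Set (EuclideanSpace ℝ (Fin n)) := {x | ∀ i, x i ∈ Ico (-r) r}

/-- The cell with index `z` of the grid of half-open cubes with side `δ`. -/
def cell (δ : ℝ) (z : Fin n → ℤ) : Set (EuclideanSpace ℝ (Fin n)) := {x | ∀ i, ⌊x i / δ⌋ = z i}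

theorem mem_cell_iff {δ : ℝ} (hδ : 0 < δ) {z : Fin n → ℤ} {x : EuclideanSpace ℝ (Fin n)} :
    x ∈ cell δ z ↔ ∀ i, x i ∈ Ico (z i * δ) ((z i + 1) * δ) := by
  refine forall_congr' fun i => ?_
  rw [Int.floor_eq_iff, le_div_iff₀ hδ, div_lt_iff₀ hδ, mem_Ico]

theorem mem_box_iff_floor {δ : ℝ} (hδ : 0 < δ) {M : ℕ} {x : EuclideanSpace ℝ (Fin n)} :
    x ∈ box n (M * δ) ↔ ∀ i, ⌊x i / δ⌋ ∈ Finset.Ico (-(M : ℤ)) M := by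
  refine forall_congr' fun i => ?_
  rw [Finset.mem_Ico, Int.le_floor, Int.floor_lt, le_div_iff₀ hδ, div_lt_iff₀ hδ, mem_Ico]
  push_cast
  rw [neg_mul]

theorem convex_cell {δ : ℝ} (hδ : 0 < δ) (z : Fin n → ℤ) : Convex ℝ (cell δ z) := by
  intro x hx y hy a b ha hb hab
  rw [mem_cell_iff hδ] at hx hy ⊢
  exact fun i => (convex_Ico _ _) (hx i) (hy i) ha hb hab

theorem measurableSet_cell {δ : ℝ} (hδ : 0 < δ) (z : Fin n → ℤ) : MeasurableSet (cell δ z) := by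
  have : cell δ z = ⋂ i, {x | x i ∈ Ico (z i * δ) ((z i + 1) * δ)} := by
    ext x
    rw [mem_cell_iff hδ, mem_iInter]
    rfl
  rw [this]
  exact MeasurableSet.iInter fun i => measurableSet_Ico.preimage (by fun_prop)

theorem norm_sub_le_of_mem_cell {δ : ℝ} (hδ : 0 < δ) {z : Fin n → ℤ}
    {x y : EuclideanSpace ℝ (Fin n)} (hx : x ∈ cell δ z) (hy : y ∈ cell δ z) :
    ‖x - y‖ ≤ n * δ := by
  refine norm_le_of_forall_abs_le hδ.le fun i => ?_
  have h1 := (mem_cell_iff hδ).1 hx i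
  have h2 := (mem_cell_iff hδ).1 hy i
  rw [PiLp.sub_apply, abs_le]
  constructor <;> linarith [h1.1, h1.2, h2.1, h2.2]

theorem volume_cell_ne_zero {δ : ℝ} (hδ : 0 < δ) (z : Fin n → ℤ) : volume (cell δ z) ≠ 0 := by
  let U : Set (EuclideanSpace ℝ (Fin n)) := ⋂ i, {x | x i ∈ Ioo (z i * δ) ((z i + 1) * δ)}
  have hU : IsOpen U := isOpen_iInter_of_finite fun i => isOpen_Ioo.preimage (by fun_prop)
  have hne : U.Nonempty := by
    refine ⟨WithLp.toLp 2 fun i => (z i + 1 / 2) * δ, mem_iInter.2 fun i => ?_⟩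
    change (z i + 1 / 2) * δ ∈ Ioo (z i * δ) ((z i + 1) * δ)
    constructor <;> nlinarith
  refine ((hU.measure_pos volume hne).trans_le (measure_mono fun x hx => ?_)).ne'
  exact (mem_cell_iff hδ).2 fun i => Ioo_subset_Ico_self (mem_iInter.1 hx i)

theorem volume_cell_ne_top {δ : ℝ} (hδ : 0 < δ) (z : Fin n → ℤ) : volume (cell δ z) ≠ ⊤ := by
  have hb : Bornology.IsBounded (cell δ z) := Metric.isBounded_iff.2
    ⟨n * δ, fun x hx y hy => (dist_eq_norm x y).trans_le (norm_sub_le_of_mem_cell hδ hx hy)⟩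
  exact hb.measure_lt_top.ne

theorem box_anti {r s : ℝ} (h : r ≤ s) : box n r ⊆ box n s :=
  fun _ hx i => Ico_subset_Ico (neg_le_neg h) h (hx i)

theorem ball_subset_box : Metric.ball (0 : EuclideanSpace ℝ (Fin n)) 1 ⊆ box n 1 := by
  intro x hx i
  have h1 : ‖x‖ < 1 := by simpa using hx
  have h2 := abs_lt.1 ((PiLp.norm_apply_le x i).trans_lt h1)
  exact ⟨h2.1.le, h2.2⟩

theorem le_norm_of_notMem_box {r : ℝ} {x : EuclideanSpace ℝ (Fin n)} (hx : x ∉ box n r) :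
    r ≤ ‖x‖ := by
  simp only [box, mem_ofPred_eq, not_forall, mem_Ico, not_and_or, not_le, not_lt] at hx
  obtain ⟨i, hi⟩ := hx
  have h := PiLp.norm_apply_le x i
  rw [Real.norm_eq_abs] at h
  rcases hi with hi | hi
  · linarith [neg_le_abs (x i)]
  · exact (hi.trans (le_abs_self _)).trans h

theorem norm_le_of_mem_box {r : ℝ} (hr : 0 ≤ r) {x : EuclideanSpace ℝ (Fin n)}
    (hx : x ∈ box n r) : ‖x‖ ≤ n * r :=
  norm_le_of_forall_abs_le hr fun i => abs_le.2 ⟨(hx i).1, (hx i).2.le⟩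

theorem exists_shell {J : ℕ} {x : EuclideanSpace ℝ (Fin n)} (hx : x ∈ box n 1)
    (hx' : x ∉ box n ((1 / 2) ^ J)) :
    ∃ j < J, x ∈ box n ((1 / 2) ^ j) ∧ x ∉ box n ((1 / 2) ^ (j + 1)) := by
  induction J with
  | zero => simp [hx] at hx'
  | succ J ih =>
    by_cases h : x ∈ box n ((1 / 2) ^ J)
    · exact ⟨J, Nat.lt_succ_self J, h, hx'⟩
    · obtain ⟨j, hj, h⟩ := ih h
      exact ⟨j, hj.trans (Nat.lt_succ_self J), h⟩

/-- The side of the grid in the `j`-th shell. -/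
noncomputable def side (N : ℕ → ℕ) (j : ℕ) : ℝ := (1 / 2) ^ (j + 1) / N j

open Classical in
/-- The indices of the cells that form the first `J` shells. -/
noncomputable def shellIndex (n : ℕ) (N : ℕ → ℕ) (J : ℕ) : Finset (Σ _ : ℕ, Fin n → ℤ) :=
  (Finset.range J).sigma fun j =>
    Fintype.piFinset (fun _ : Fin n => Finset.Ico (-((2 * N j : ℕ) : ℤ)) (2 * N j : ℕ)) \
      Fintype.piFinset (fun _ : Fin n => Finset.Ico (-(N j : ℤ)) (N j))

theorem card_shellIndex_le (N : ℕ → ℕ) (J : ℕ) :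
    (shellIndex n N J).card ≤ ∑ j ∈ Finset.range J, (4 * N j) ^ n := by
  classical
  rw [shellIndex, Finset.card_sigma]
  refine Finset.sum_le_sum fun j _ => (Finset.card_le_card Finset.sdiff_subset).trans ?_
  rw [Fintype.card_piFinset, Finset.prod_const, Int.card_Ico, Finset.card_univ, Fintype.card_fin]
  refine Nat.pow_le_pow_left ?_ n
  omega

variable {N : ℕ → ℕ} (hN : ∀ j, 1 ≤ N j)

include hN

theorem side_pos (j : ℕ) : 0 < side N j := by
  have : (0 : ℝ) < N j := by exact_mod_cast hN j
  unfold side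
  positivity

/-- From the origin to a face, the inner cube measures exactly N j sides and the outer one 2 N j, so
that the shell is a union of whole cells. -/
theorem mem_shell_iff_floor (j : ℕ) (x : EuclideanSpace ℝ (Fin n)) :
    (x ∈ box n ((1 / 2) ^ j) ∧ x ∉ box n ((1 / 2) ^ (j + 1))) ↔
      (∀ i, ⌊x i / side N j⌋ ∈ Finset.Ico (-((2 * N j : ℕ) : ℤ)) (2 * N j : ℕ)) ∧
        ¬ ∀ i, ⌊x i / side N j⌋ ∈ Finset.Ico (-(N j : ℤ)) (N j) := by
  have h0 : (N j : ℝ) ≠ 0 := by exact_mod_cast Nat.one_le_iff_ne_zero.1 (hN j)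
  rw [← mem_box_iff_floor (side_pos hN j), ← mem_box_iff_floor (side_pos hN j)]
  have h1 : ((2 * N j : ℕ) : ℝ) * side N j = (1 / 2) ^ j := by
    rw [side, pow_succ]; push_cast; field_simp
  have h2 : (N j : ℝ) * side N j = (1 / 2) ^ (j + 1) := by
    rw [side]; field_simp
  rw [h1, h2]

theorem exists_mem_cell {J : ℕ} {x : EuclideanSpace ℝ (Fin n)} (hx : x ∈ box n 1)
    (hx' : x ∉ box n ((1 / 2) ^ J)) : ∃ a ∈ shellIndex n N J, x ∈ cell (side N a.1) a.2 := by
  classical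
  obtain ⟨j, hj, h⟩ := exists_shell hx hx'
  rw [mem_shell_iff_floor hN] at h
  refine ⟨⟨j, fun i => ⌊x i / side N j⌋⟩, ?_, fun i => rfl⟩
  simp only [shellIndex, Finset.mem_sigma, Finset.mem_sdiff, Fintype.mem_piFinset]
  exact ⟨Finset.mem_range.2 hj, h⟩

theorem mem_shell_of_mem_cell {J : ℕ} {a : Σ _ : ℕ, Fin n → ℤ} (ha : a ∈ shellIndex n N J)
    {x : EuclideanSpace ℝ (Fin n)} (hx : x ∈ cell (side N a.1) a.2) :
    a.1 < J ∧ x ∈ box n ((1 / 2) ^ a.1) ∧ x ∉ box n ((1 / 2) ^ (a.1 + 1)) := by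
  classical
  simp only [shellIndex, Finset.mem_sigma, Finset.mem_sdiff, Fintype.mem_piFinset,
    Finset.mem_range] at ha
  rw [mem_shell_iff_floor hN]
  have hz : ∀ i, ⌊x i / side N a.1⌋ = a.2 i := hx
  simp only [hz]
  exact ha

/-- Nested boxes make different shells disjoint; within a shell the floors determine the index. -/
theorem eq_of_mem_cell {J : ℕ} {a b : Σ _ : ℕ, Fin n → ℤ} (ha : a ∈ shellIndex n N J)
    (hb : b ∈ shellIndex n N J) {x : EuclideanSpace ℝ (Fin n)}
    (hxa : x ∈ cell (side N a.1) a.2) (hxb : x ∈ cell (side N b.1) b.2) : a = b := by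
  have key : ∀ {a b : Σ _ : ℕ, Fin n → ℤ}, a ∈ shellIndex n N J → b ∈ shellIndex n N J →
      x ∈ cell (side N a.1) a.2 → x ∈ cell (side N b.1) b.2 → b.1 ≤ a.1 := by
    intro a b ha hb hxa hxb
    by_contra! h
    refine (mem_shell_of_mem_cell hN ha hxa).2.2 (box_anti ?_ (mem_shell_of_mem_cell hN hb hxb).2.1)
    exact pow_le_pow_of_le_one (by norm_num) (by norm_num) h
  obtain ⟨j, z⟩ := a
  obtain ⟨k, w⟩ := b
  obtain rfl : j = k := le_antisymm (key hb ha hxb hxa) (key ha hb hxa hxb)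
  congr 1
  ext1 i
  exact (hxa i).symm.trans (hxb i)

end Cell

/-! ### Approximation by piecewise polynomials -/

section Width

open scoped ENNReal NNReal
open Module

variable {n m : ℕ} {p σ : ℝ}

/-- From ‖x‖ ≤ n 2 ^ (-j) follows -log ‖x‖ ≥ j log 2 - log n. -/
theorem one_add_le_mul_one_add_abs_log {x : EuclideanSpace ℝ (Fin n)} (hx0 : x ≠ 0) {j : ℕ}
    (hx : x ∈ box n ((1 / 2) ^ j)) :
    (1 + j : ℝ) ≤ (2 + 2 * n) * (1 + |Real.log ‖x‖|) := by
  have hpos : 0 < ‖x‖ := norm_pos_iff.2 hx0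
  have h1 : ‖x‖ ≤ n * (1 / 2) ^ j := norm_le_of_mem_box (by positivity) hx
  have hn : (0 : ℝ) < n := by
    by_contra! h
    have : (n : ℝ) * (1 / 2) ^ j ≤ 0 := mul_nonpos_of_nonpos_of_nonneg h (by positivity)
    linarith
  have h2 : Real.log ‖x‖ ≤ Real.log n - j * Real.log 2 := by
    refine (Real.log_le_log hpos h1).trans_eq ?_
    rw [Real.log_mul hn.ne' (by positivity), Real.log_pow, one_div, Real.log_inv]
    ring
  have h3 : Real.log n ≤ n := (Real.log_le_sub_one_of_pos hn).trans (by linarith)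
  have h4 := Real.log_two_gt_d9
  have h5 := neg_abs_le (Real.log ‖x‖)
  have h6 : (j : ℝ) * (1 / 2) ≤ j * Real.log 2 := by gcongr; linarith
  nlinarith [abs_nonneg (Real.log ‖x‖)]

theorem one_le_mul_logWeight (hp : 0 ≤ p) (hσ : 0 ≤ σ) {x : EuclideanSpace ℝ (Fin n)} (hx0 : x ≠ 0)
    {j : ℕ} (hx : x ∈ box n ((1 / 2) ^ j)) {η : ℝ} (hη : (1 + j : ℝ) ^ (-σ) ≤ η) :
    1 ≤ ENNReal.ofReal (((2 + 2 * n : ℝ) ^ σ * η) ^ p) * logWeight (σ * p) x := by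
  have hη0 : 0 ≤ η := le_trans (by positivity) hη
  rw [logWeight, ← ENNReal.ofReal_mul (by positivity), ENNReal.one_le_ofReal,
    Real.rpow_mul (by positivity), ← Real.mul_rpow (by positivity) (by positivity)]
  refine Real.one_le_rpow ?_ hp
  have h1 := Real.rpow_le_rpow (by positivity) (one_add_le_mul_one_add_abs_log hx0 hx) hσ
  rw [Real.mul_rpow (by positivity) (by positivity)] at h1
  rw [Real.rpow_neg (by positivity), inv_le_iff_one_le_mul₀ (by positivity)] at hη
  calc 1 ≤ η * (1 + j : ℝ) ^ σ := hη
    _ ≤ η * ((2 + 2 * n : ℝ) ^ σ * (1 + |Real.log ‖x‖|) ^ σ) := by gcongr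
    _ = _ := by ring

namespace CZero

/-- The integrand of the energy, cut off to the ball. -/
noncomputable def energyDensity (φ : CZero n m p σ) : EuclideanSpace ℝ (Fin n) → ℝ≥0∞ :=
  (Metric.ball 0 1).indicator fun x => logWeight (σ * p) x *
    (‖x‖ₑ ^ m * ‖iteratedFDeriv ℝ m (φ : EuclideanSpace ℝ (Fin n) → ℂ) x‖ₑ) ^ p

theorem lintegral_energyDensity (φ : CZero n m p σ) : ∫⁻ x, φ.energyDensity x = φ.energy :=
  lintegral_indicator measurableSet_ball _

theorem iteratedFDeriv_eq_zero (φ : CZero n m p σ) {x : EuclideanSpace ℝ (Fin n)}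
    (hx : x ∉ Metric.ball 0 1) :
    ‖iteratedFDeriv ℝ m (φ : EuclideanSpace ℝ (Fin n) → ℂ) x‖ₑ = 0 := by
  have : iteratedFDeriv ℝ m (φ : EuclideanSpace ℝ (Fin n) → ℂ) x = 0 := by
    by_contra hne
    exact hx (φ.tsupport_subset (support_iteratedFDeriv_subset (𝕜 := ℝ) m hne))
  rw [← ofReal_norm, this, norm_zero, ENNReal.ofReal_zero]

/-- On the cell, side * N ≤ ‖x‖ and N ^ (-m) ≤ η (1 + j) ^ σ. Hence the factor side ^ m of Taylor
approximation is at most η ‖x‖ ^ m (1 + j) ^ σ, which is the weight of the energy up to η and a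
constant. -/
theorem exists_lintegral_cell_le [NeZero n] [NeZero m] (hp : 1 ≤ p) (hσ : 0 ≤ σ) {N : ℕ → ℕ}
    (hN : ∀ j, 1 ≤ N j) {J : ℕ} {a : Σ _ : ℕ, Fin n → ℤ} (ha : a ∈ shellIndex n N J) {η : ℝ}
    (hη0 : 0 ≤ η)
    (hη : (1 + a.1 : ℝ) ^ (-σ) ≤ η * (N a.1 : ℝ) ^ m) (φ : CZero n m p σ) :
    ∃ y, ∫⁻ x in cell (side N a.1) a.2, ‖φ x - taylorPoly m φ y x‖ₑ ^ p ≤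
      2 ^ n * ENNReal.ofReal ((n : ℝ) ^ (m * p)) *
        (ENNReal.ofReal (((2 + 2 * n : ℝ) ^ σ * η) ^ p) *
          ∫⁻ x in cell (side N a.1) a.2, φ.energyDensity x) := by
  have hp0 : 0 < p := by linarith
  have hδ := side_pos hN a.1
  have hmeas := measurableSet_cell hδ a.2
  have hNpos : (0 : ℝ) < N a.1 := by exact_mod_cast hN a.1
  obtain ⟨y, -, hy⟩ := exists_lintegral_sub_taylorPoly_le
    (volume : Measure (EuclideanSpace ℝ (Fin n))) hp (by positivity : 0 ≤ n * side N a.1)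
    (convex_cell hδ a.2) hmeas (volume_cell_ne_zero hδ a.2)
    (volume_cell_ne_top hδ a.2) (fun x hx y hy => norm_sub_le_of_mem_cell hδ hx hy) φ.contDiff
  refine ⟨y, hy.trans ?_⟩
  rw [finrank_euclideanSpace_fin, Real.mul_rpow (by positivity) hδ.le,
    ENNReal.ofReal_mul (by positivity), ← mul_assoc, mul_assoc]
  gcongr _ * ?_
  rw [← lintegral_const_mul' _ _ ENNReal.ofReal_ne_top,
    ← lintegral_const_mul' _ _ ENNReal.ofReal_ne_top]
  refine lintegral_mono_ae ?_
  have hne : ∀ᵐ x ∂(volume : Measure (EuclideanSpace ℝ (Fin n))), x ≠ 0 := Measure.ae_ne _ 0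
  filter_upwards [ae_restrict_of_ae hne, ae_restrict_mem hmeas] with x hx0 hx
  by_cases hxB : x ∈ Metric.ball (0 : EuclideanSpace ℝ (Fin n)) 1
  · obtain ⟨-, hx1, hx2⟩ := mem_shell_of_mem_cell hN ha hx
    have h1 := one_le_mul_logWeight hp0.le hσ hx0 hx1 hη
    have hnorm := le_norm_of_notMem_box hx2
    rw [energyDensity, indicator_of_mem hxB, ENNReal.mul_rpow_of_nonneg _ _ hp0.le]
    set D := ‖iteratedFDeriv ℝ m (φ : EuclideanSpace ℝ (Fin n) → ℂ) x‖ₑ ^ p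
    have h2 : ENNReal.ofReal (side N a.1 ^ (m * p)) *
        ENNReal.ofReal (((2 + 2 * n : ℝ) ^ σ * (η * (N a.1 : ℝ) ^ m)) ^ p) ≤
          ENNReal.ofReal (((2 + 2 * n : ℝ) ^ σ * η) ^ p) * (‖x‖ₑ ^ m) ^ p := by
      rw [← ofReal_norm, ← ENNReal.ofReal_pow (norm_nonneg _),
        ENNReal.ofReal_rpow_of_nonneg (by positivity) hp0.le, ← ENNReal.ofReal_mul (by positivity),
        ← ENNReal.ofReal_mul (by positivity), Real.rpow_mul hδ.le, Real.rpow_natCast,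
        ← Real.mul_rpow (by positivity) (by positivity),
        ← Real.mul_rpow (by positivity) (by positivity)]
      refine ENNReal.ofReal_le_ofReal (Real.rpow_le_rpow (by positivity) ?_ hp0.le)
      have h3 : side N a.1 * N a.1 ≤ ‖x‖ := by
        refine le_trans (le_of_eq ?_) hnorm
        rw [side]; field_simp
      calc side N a.1 ^ m * ((2 + 2 * n : ℝ) ^ σ * (η * (N a.1 : ℝ) ^ m))
          = (2 + 2 * n : ℝ) ^ σ * η * (side N a.1 * N a.1) ^ m := by rw [mul_pow]; ring
        _ ≤ _ := by gcongr
    calc ENNReal.ofReal (side N a.1 ^ (m * p)) * D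
        ≤ ENNReal.ofReal (side N a.1 ^ (m * p)) * D *
          (ENNReal.ofReal (((2 + 2 * n : ℝ) ^ σ * (η * (N a.1 : ℝ) ^ m)) ^ p) *
            logWeight (σ * p) x) := le_mul_of_one_le_right zero_le h1
      _ = ENNReal.ofReal (side N a.1 ^ (m * p)) *
          ENNReal.ofReal (((2 + 2 * n : ℝ) ^ σ * (η * (N a.1 : ℝ) ^ m)) ^ p) *
            (logWeight (σ * p) x * D) := by ring
      _ ≤ ENNReal.ofReal (((2 + 2 * n : ℝ) ^ σ * η) ^ p) * (‖x‖ₑ ^ m) ^ p *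
            (logWeight (σ * p) x * D) := by gcongr
      _ = _ := by ring
  · simp [φ.iteratedFDeriv_eq_zero hxB, hp0]

end CZero

theorem memLp_indicator_of_continuous {g : EuclideanSpace ℝ (Fin n) → ℂ} (hg : Continuous g)
    {S : Set (EuclideanSpace ℝ (Fin n))} (hS : MeasurableSet S) (q : ℝ≥0∞) :
    MemLp (S.indicator g) q
      (volume.restrict (unitBall n : Set (EuclideanSpace ℝ (Fin n)))) := by
  have : IsFiniteMeasure (volume.restrict (unitBall n : Set (EuclideanSpace ℝ (Fin n)))) :=
    ⟨by simpa [unitBall] using measure_ball_lt_top⟩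
  obtain ⟨M, hM⟩ := (isCompact_closedBall (0 : EuclideanSpace ℝ (Fin n)) 1).exists_bound_of_continuousOn
    hg.continuousOn
  refine MemLp.indicator hS (MemLp.of_bound hg.aestronglyMeasurable M ?_)
  refine (ae_restrict_mem (unitBall n).isOpen.measurableSet).mono fun x hx => hM x ?_
  exact Metric.ball_subset_closedBall hx

/-- The function that equals the polynomial `c a` on the cell with index `a`. -/
noncomputable def piecewisePoly (N : ℕ → ℕ) (m : ℕ) (T : Finset (Σ _ : ℕ, Fin n → ℤ))
    (c : T → polySpace n m) (x : EuclideanSpace ℝ (Fin n)) : ℂ :=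
  ∑ a : T, (cell (side N a.1.1) a.1.2).indicator (c a : EuclideanSpace ℝ (Fin n) → ℂ) x

theorem memLp_piecewisePoly {N : ℕ → ℕ} (hN : ∀ j, 1 ≤ N j) (T : Finset (Σ _ : ℕ, Fin n → ℤ))
    (c : T → polySpace n m) (q : ℝ≥0∞) : MemLp (piecewisePoly N m T c) q
      (volume.restrict (unitBall n : Set (EuclideanSpace ℝ (Fin n)))) :=
  memLp_finsetSum _ fun a _ => memLp_indicator_of_continuous
    (continuous_of_mem_polySpace (c a).2) (measurableSet_cell (side_pos hN _) _) q

/-- The linear map that sends a family of polynomials to the associated piecewise polynomial. -/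
noncomputable def piecewisePolyMap (p : ℝ) (m : ℕ) {N : ℕ → ℕ} (hN : ∀ j, 1 ≤ N j)
    (T : Finset (Σ _ : ℕ, Fin n → ℤ)) [Fact (1 ≤ p)] :
    (T → polySpace n m) →ₗ[ℂ] LpBall n p where
  toFun c := (memLp_piecewisePoly hN T c (ENNReal.ofReal p)).toLp _
  map_add' c d := by
    rw [← MemLp.toLp_add]
    congr 1
    ext x
    simp only [piecewisePoly, Pi.add_apply, Submodule.coe_add, ← Finset.sum_add_distrib,
      indicator_add']
  map_smul' r c := by
    rw [RingHom.id_apply, ← MemLp.toLp_const_smul]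
    congr 1
    ext x
    simp only [piecewisePoly, Pi.smul_apply, Submodule.coe_smul, Finset.smul_sum]
    refine Finset.sum_congr rfl fun a _ => ?_
    by_cases hx : x ∈ cell (side N a.1.1) a.1.2 <;> simp [hx]

theorem finrank_range_piecewisePolyMap_le [Fact (1 ≤ p)] {N : ℕ → ℕ} (hN : ∀ j, 1 ≤ N j)
    (T : Finset (Σ _ : ℕ, Fin n → ℤ)) :
    finrank ℂ (LinearMap.range (piecewisePolyMap p m hN T)) ≤
      T.card * finrank ℂ (polySpace n m) := by
  refine (LinearMap.finrank_range_le _).trans_eq ?_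
  rw [finrank_pi_fintype]
  simp

/-- A point lies either in the innermost cube, where the piecewise polynomial is 0, or in exactly
one cell. -/
theorem enorm_sub_piecewisePoly_rpow_le {N : ℕ → ℕ} (hN : ∀ j, 1 ≤ N j) {J : ℕ}
    (f : EuclideanSpace ℝ (Fin n) → ℂ) (c : shellIndex n N J → polySpace n m)
    {x : EuclideanSpace ℝ (Fin n)} (hx : x ∈ box n 1) :
    ‖f x - piecewisePoly N m (shellIndex n N J) c x‖ₑ ^ p ≤
      (box n ((1 / 2) ^ J)).indicator (fun x => ‖f x‖ₑ ^ p) x +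
        ∑ a : shellIndex n N J, (cell (side N a.1.1) a.1.2).indicator
          (fun x => ‖f x - (c a : EuclideanSpace ℝ (Fin n) → ℂ) x‖ₑ ^ p) x := by
  by_cases hxJ : x ∈ box n ((1 / 2) ^ J)
  · refine le_add_right ?_
    have h0 : piecewisePoly N m (shellIndex n N J) c x = 0 := by
      refine Finset.sum_eq_zero fun a _ => indicator_of_notMem (fun hxa => ?_) _
      obtain ⟨h1, -, h3⟩ := mem_shell_of_mem_cell hN a.2 hxa
      exact h3 (box_anti (pow_le_pow_of_le_one (by norm_num) (by norm_num) h1) hxJ)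
    rw [h0, sub_zero, indicator_of_mem hxJ]
  · obtain ⟨a, ha, hxa⟩ := exists_mem_cell hN hx hxJ
    refine le_add_left ?_
    have h0 : piecewisePoly N m (shellIndex n N J) c x =
        (c ⟨a, ha⟩ : EuclideanSpace ℝ (Fin n) → ℂ) x := by
      rw [piecewisePoly, Finset.sum_eq_single ⟨a, ha⟩, indicator_of_mem hxa]
      · intro b _ hb
        refine indicator_of_notMem (fun hxb => hb ?_) _
        exact Subtype.ext (eq_of_mem_cell hN b.2 ha hxb hxa)
      · exact fun h => absurd (Finset.mem_univ _) h
    refine le_trans (le_of_eq ?_) (Finset.single_le_sum (fun _ _ => zero_le)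
      (Finset.mem_univ (⟨a, ha⟩ : shellIndex n N J)))
    rw [h0, indicator_of_mem hxa]

/-- Approximation by piecewise polynomials on a grid that is refined towards the origin. -/
theorem exists_subspace_approx (n m : ℕ) [NeZero n] [NeZero m] (p : ℝ) {σ : ℝ} [hp : Fact (1 ≤ p)]
    (hσ : 0 < σ) :
    ∃ C₀ C₁ : ℝ, 0 < C₁ ∧ ∀ (J : ℕ) (N : ℕ → ℕ) (η : ℝ), (∀ j, 1 ≤ N j) → 0 ≤ η →
      (∀ j < J, (1 + j : ℝ) ^ (-σ) ≤ η * (N j : ℝ) ^ m) → (1 + J : ℝ) ^ (-σ) ≤ η →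
      ∃ V : Submodule ℂ (LpBall n p), FiniteDimensional ℂ V ∧
        (finrank ℂ V : ℝ) ≤ C₁ * ∑ j ∈ Finset.range J, (N j : ℝ) ^ n ∧
        ∀ φ : CZero n m p σ, ∃ v ∈ V, ‖CZero.toLpBall n m p σ φ - v‖ ≤ C₀ * η * ‖φ‖ := by
  have hp0 : 0 < p := by linarith [hp.out]
  obtain ⟨CH, hCH, hHardy⟩ := CZero.exists_lintegral_logWeight_le n m p hσ
  obtain ⟨CE, hCE, hEnergy⟩ := CZero.exists_energy_le n m p σ
  set A : ℝ := (2 + 2 * n : ℝ) ^ σ with hA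
  set C : ℝ≥0∞ := CH + 2 ^ n * ENNReal.ofReal ((n : ℝ) ^ (m * p)) * CE with hC
  have hCtop : C ≠ ⊤ := by rw [hC]; finiteness
  refine ⟨A * (C ^ (1 / p)).toReal, 4 ^ n * (finrank ℂ (polySpace n m) + 1), by positivity,
    fun J N η hN hη0 hη hηJ => ?_⟩
  set T := shellIndex n N J with hT
  refine ⟨LinearMap.range (piecewisePolyMap p m hN T), inferInstance, ?_, fun φ => ?_⟩
  · have h1 := (finrank_range_piecewisePolyMap_le (p := p) (m := m) hN T).trans
      (Nat.mul_le_mul_right _ (card_shellIndex_le N J))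
    have h2 : ((finrank ℂ (LinearMap.range (piecewisePolyMap p m hN T)) : ℕ) : ℝ) ≤
        ((∑ j ∈ Finset.range J, (4 * N j) ^ n) * finrank ℂ (polySpace n m) : ℕ) := by
      exact_mod_cast h1
    refine h2.trans ?_
    push_cast
    simp only [mul_pow, ← Finset.mul_sum]
    rw [mul_right_comm]
    gcongr
    linarith
  · choose! y hy using fun a (ha : a ∈ T) =>
      CZero.exists_lintegral_cell_le hp.out hσ.le hN ha hη0
        (hη a.1 (Finset.mem_range.1 (Finset.mem_sigma.1 ha).1)) φ
    let c : T → polySpace n m := fun a => ⟨taylorPoly m φ (y a), taylorPoly_mem_polySpace _ _ _⟩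
    refine ⟨piecewisePolyMap p m hN T c, ⟨c, rfl⟩, ?_⟩
    have hmemc := memLp_piecewisePoly hN T c (ENNReal.ofReal p)
    have hsub : CZero.toLpBall n m p σ φ - piecewisePolyMap p m hN T c =
        (φ.memLp.sub hmemc).toLp _ := (MemLp.toLp_sub φ.memLp hmemc).symm
    have hcell : ∀ a : T, MeasurableSet (cell (side N a.1.1) a.1.2) :=
      fun a => measurableSet_cell (side_pos hN _) _
    have hmeas : ∀ a : T, Measurable ((cell (side N a.1.1) a.1.2).indicator
        (fun x => ‖φ x - (c a : EuclideanSpace ℝ (Fin n) → ℂ) x‖ₑ ^ p)) := fun a =>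
      (((φ.continuous.sub (continuous_of_mem_polySpace (c a).2)).enorm.measurable).pow_const
        p).indicator (hcell a)
    have hmain : ‖CZero.toLpBall n m p σ φ - piecewisePolyMap p m hN T c‖ₑ ^ p ≤
        ENNReal.ofReal ((A * η) ^ p) * (C * ‖φ‖ₑ ^ p) := by
      rw [hsub, enorm_toLp_rpow]
      calc ∫⁻ x in Metric.ball 0 1, ‖φ x - piecewisePoly N m T c x‖ₑ ^ p
          ≤ ∫⁻ x in Metric.ball 0 1, ((box n ((1 / 2) ^ J)).indicator (fun x => ‖φ x‖ₑ ^ p) x +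
            ∑ a : T, (cell (side N a.1.1) a.1.2).indicator
              (fun x => ‖φ x - (c a : EuclideanSpace ℝ (Fin n) → ℂ) x‖ₑ ^ p) x) :=
            setLIntegral_mono' measurableSet_ball fun x hx =>
              enorm_sub_piecewisePoly_rpow_le hN φ c (ball_subset_box hx)
        _ = (∫⁻ x in Metric.ball 0 1,
              (box n ((1 / 2) ^ J)).indicator (fun x => ‖φ x‖ₑ ^ p) x) +
            ∑ a : T, ∫⁻ x in Metric.ball 0 1, (cell (side N a.1.1) a.1.2).indicator
              (fun x => ‖φ x - (c a : EuclideanSpace ℝ (Fin n) → ℂ) x‖ₑ ^ p) x := by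
            rw [lintegral_add_right _ (Finset.measurable_fun_sum _ fun a _ => hmeas a),
              lintegral_finsetSum _ fun a _ => hmeas a]
        _ ≤ ENNReal.ofReal ((A * η) ^ p) * (CH * ‖φ‖ₑ ^ p) +
            2 ^ n * ENNReal.ofReal ((n : ℝ) ^ (m * p)) *
              (ENNReal.ofReal ((A * η) ^ p) * (CE * ‖φ‖ₑ ^ p)) := by
            gcongr ?_ + ?_
            -- On the innermost cube (A η) ^ p times the logarithmic weight is at least 1, so
            -- Hardy's inequality bounds all of φ there.
            · refine le_trans ?_ (mul_le_mul_right (hHardy φ) _)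
              rw [← lintegral_const_mul' _ _ ENNReal.ofReal_ne_top]
              refine lintegral_mono_ae ?_
              have hne : ∀ᵐ x ∂(volume : Measure (EuclideanSpace ℝ (Fin n))), x ≠ 0 :=
                Measure.ae_ne _ 0
              filter_upwards [ae_restrict_of_ae hne] with x hx0
              by_cases hxJ : x ∈ box n ((1 / 2) ^ J)
              · rw [indicator_of_mem hxJ, ← mul_assoc]
                exact le_mul_of_one_le_left zero_le
                  (one_le_mul_logWeight hp0.le hσ.le hx0 hxJ hηJ)
              · rw [indicator_of_notMem hxJ]
                exact zero_le
            -- The cells are disjoint, so the local energies sum to at most the total energy.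
            · calc _ ≤ ∑ a : T, 2 ^ n * ENNReal.ofReal ((n : ℝ) ^ (m * p)) *
                    (ENNReal.ofReal ((A * η) ^ p) *
                      ∫⁻ x in cell (side N a.1.1) a.1.2, φ.energyDensity x) := by
                    refine Finset.sum_le_sum fun a _ => ?_
                    refine (setLIntegral_le_lintegral _ _).trans ?_
                    rw [lintegral_indicator (hcell a)]
                    exact hy a.1 a.2
                _ = 2 ^ n * ENNReal.ofReal ((n : ℝ) ^ (m * p)) * (ENNReal.ofReal ((A * η) ^ p) *
                    ∫⁻ x in ⋃ a ∈ T, cell (side N a.1) a.2, φ.energyDensity x) := by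
                    rw [← Finset.mul_sum, ← Finset.mul_sum,
                      lintegral_biUnion_finset (fun a ha b hb hab => ?_)
                        fun a _ => measurableSet_cell (side_pos hN _) _]
                    · rw [Finset.sum_coe_sort T fun a =>
                        ∫⁻ x in cell (side N a.1) a.2, φ.energyDensity x]
                    · exact disjoint_left.2 fun x hxa hxb =>
                        hab (eq_of_mem_cell hN ha hb hxa hxb)
                _ ≤ _ := by
                    gcongr
                    refine (setLIntegral_le_lintegral _ _).trans ?_
                    rw [φ.lintegral_energyDensity]
                    exact hEnergy φ
        _ = _ := by rw [hC]; ring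
    have h3 := norm_le_of_enorm_rpow_le hp0
      (C := ENNReal.ofReal ((A * η) ^ p) * C) (by finiteness) (hmain.trans_eq (mul_assoc _ _ _).symm)
    refine h3.trans_eq ?_
    rw [ENNReal.mul_rpow_of_nonneg _ _ (by positivity), ENNReal.toReal_mul,
      ENNReal.ofReal_rpow_of_nonneg (by positivity) (by positivity),
      ← Real.rpow_mul (by positivity), mul_one_div_cancel hp0.ne', Real.rpow_one,
      ENNReal.toReal_ofReal (by positivity)]
    ring

end Width

/-! ### Choice of the grid, and the upper bound -/

section Count

open Module

/-- The distance to V is continuous, so its bound extends from the dense subspace. The factor 2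
provides the slack for choosing an actual v. -/
theorem exists_mem_norm_sub_le_of_completion {X Y : Type*} [SeminormedAddCommGroup X]
    [NormedSpace ℂ X] [NormedAddCommGroup Y] [NormedSpace ℂ Y]
    (T : UniformSpace.Completion X →L[ℂ] Y) (V : Submodule ℂ Y) {c : ℝ} (hc : 0 < c)
    (h : ∀ x : X, ∃ v ∈ V, ‖T x - v‖ ≤ c * ‖x‖) {u : UniformSpace.Completion X} (hu : ‖u‖ ≤ 1) :
    ∃ v ∈ V, ‖T u - v‖ ≤ 2 * c := by
  have hne : (V : Set Y).Nonempty := ⟨0, V.zero_mem⟩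
  have h1 : Metric.infDist (T u) (V : Set Y) ≤ c * ‖u‖ := by
    clear hu
    induction u using UniformSpace.Completion.induction_on with
    | hp =>
      exact isClosed_le ((Metric.continuous_infDist_pt _).comp T.continuous)
        (continuous_const.mul continuous_norm)
    | ih x =>
      obtain ⟨v, hv, hv'⟩ := h x
      rw [UniformSpace.Completion.norm_coe]
      exact (Metric.infDist_le_dist_of_mem hv).trans ((dist_eq_norm _ _).trans_le hv')
  have h2 : Metric.infDist (T u) (V : Set Y) < 2 * c := by nlinarith
  obtain ⟨v, hv, hv'⟩ := (Metric.infDist_lt_iff hne).1 h2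
  exact ⟨v, hv, by rw [← dist_eq_norm]; exact hv'.le⟩

/-- By Bernoulli's inequality for the exponent 1 - s, each term is at most ((1 + j) ^ (1 - s) - j ^
(1 - s)) / (1 - s), and these telescope. -/
theorem sum_one_add_rpow_neg_le {s : ℝ} (hs0 : 0 ≤ s) (hs : s < 1) (J : ℕ) :
    ∑ j ∈ Finset.range J, (1 + j : ℝ) ^ (-s) ≤ (J : ℝ) ^ (1 - s) / (1 - s) := by
  have h1s : 0 < 1 - s := by linarith
  induction J with
  | zero => simp [Real.zero_rpow h1s.ne']
  | succ J ih =>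
    rw [Finset.sum_range_succ]
    have hJ : (0 : ℝ) < 1 + J := by positivity
    have h2 := rpow_one_add_le_one_add_mul_self (s := -(1 / (1 + J : ℝ))) (p := 1 - s)
      (by rw [neg_le_neg_iff, div_le_one hJ]; linarith [(Nat.cast_nonneg J : (0 : ℝ) ≤ J)])
      h1s.le (by linarith)
    have h3 : (1 + -(1 / (1 + J : ℝ))) = J / (1 + J) := by field_simp; ring
    rw [h3, Real.div_rpow (by positivity) hJ.le, div_le_iff₀ (by positivity)] at h2
    have h4 : (1 + J : ℝ) ^ (1 - s) = (1 + J) * (1 + J : ℝ) ^ (-s) := by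
      rw [sub_eq_add_neg, Real.rpow_add hJ, Real.rpow_one]
    have h5 : (J : ℝ) ^ (1 - s) ≤ (1 + J : ℝ) ^ (1 - s) - (1 - s) * (1 + J : ℝ) ^ (-s) := by
      refine h2.trans_eq ?_
      rw [h4]; field_simp; ring
    push_cast
    rw [add_comm (J : ℝ) 1, le_div_iff₀ h1s]
    rw [le_div_iff₀ h1s] at ih
    nlinarith

/-- The three regimes separate here, with r = m / n: a power sum for σ < r, the harmonic sum for σ =
r, a convergent series for σ > r. -/
theorem exists_rpow_mul_sum_le {r σ : ℝ} (hr : 0 < r) (hσ : 0 < σ) :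
    ∃ C : ℝ, 0 < C ∧ ∀ K : ℝ, 1 ≤ K → ∀ J : ℕ, (J : ℝ) ≤ 2 * K →
      K ^ (min r σ / r) * ∑ j ∈ Finset.range J, (1 + j : ℝ) ^ (-(σ / r)) ≤
        C * (K * if σ = r then 1 + Real.log K else 1) := by
  rcases lt_trichotomy σ r with h | h | h
  · have hs : σ / r < 1 := (div_lt_one hr).2 h
    have hs0 : 0 < σ / r := by positivity
    refine ⟨2 / (1 - σ / r), div_pos two_pos (by linarith), fun K hK J hJ => ?_⟩
    rw [if_neg h.ne, min_eq_right h.le]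
    have hK0 : 0 < K := by linarith
    have h1 : (J : ℝ) ^ (1 - σ / r) ≤ 2 * K ^ (1 - σ / r) := by
      refine (Real.rpow_le_rpow (by positivity) hJ (by linarith)).trans ?_
      rw [Real.mul_rpow (by norm_num) hK0.le]
      gcongr
      calc (2 : ℝ) ^ (1 - σ / r) ≤ 2 ^ (1 : ℝ) :=
            Real.rpow_le_rpow_of_exponent_le (by norm_num) (by linarith)
        _ = 2 := Real.rpow_one 2
    calc K ^ (σ / r) * ∑ j ∈ Finset.range J, (1 + j : ℝ) ^ (-(σ / r))
        ≤ K ^ (σ / r) * ((2 * K ^ (1 - σ / r)) / (1 - σ / r)) := by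
          gcongr
          refine (sum_one_add_rpow_neg_le hs0.le hs J).trans ?_
          have : 0 ≤ 1 - σ / r := by linarith
          gcongr
      _ = 2 / (1 - σ / r) * (K ^ (σ / r) * K ^ (1 - σ / r)) := by ring
      _ = _ := by rw [← Real.rpow_add hK0]; simp
  · refine ⟨2, two_pos, fun K hK J hJ => ?_⟩
    have hK0 : 0 < K := by linarith
    have hlog := Real.log_nonneg hK
    rw [if_pos h, h, min_self, div_self hr.ne', Real.rpow_one]
    have h1 : ∑ j ∈ Finset.range J, (1 + j : ℝ) ^ (-1 : ℝ) ≤ 2 * (1 + Real.log K) := by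
      have h2 : ∑ j ∈ Finset.range J, (1 + j : ℝ) ^ (-1 : ℝ) = (harmonic J : ℚ) := by
        rw [harmonic]
        push_cast
        refine Finset.sum_congr rfl fun j _ => ?_
        rw [Real.rpow_neg_one, add_comm]
      rw [h2]
      refine (harmonic_le_one_add_log J).trans ?_
      rcases J.eq_zero_or_pos with rfl | hJ0
      · simp; linarith
      · have h3 : Real.log J ≤ Real.log 2 + Real.log K := by
          rw [← Real.log_mul (by norm_num) hK0.ne']
          exact Real.log_le_log (by exact_mod_cast hJ0) hJ
        have := Real.log_two_lt_d9
        linarith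
    calc _ ≤ K * (2 * (1 + Real.log K)) := by gcongr
      _ = _ := by ring
  · have hs : 1 < σ / r := (one_lt_div hr).2 h
    have hsum : Summable fun j : ℕ => (1 + j : ℝ) ^ (-(σ / r)) := by
      have h1 := (summable_nat_add_iff 1).2 (Real.summable_nat_rpow.2 (neg_lt_neg hs))
      refine h1.congr fun j => ?_
      push_cast
      rw [add_comm]
    refine ⟨∑' j : ℕ, (1 + j : ℝ) ^ (-(σ / r)), ?_, fun K hK J hJ => ?_⟩
    · exact hsum.tsum_pos (fun j => by positivity) 0 (by positivity)
    · rw [if_neg h.ne', min_eq_left h.le, div_self hr.ne', Real.rpow_one, mul_one, mul_comm]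
      gcongr
      exact hsum.sum_le_tsum _ fun j _ => by positivity

theorem exists_grid {n m : ℕ} [NeZero n] [NeZero m] {σ : ℝ} (hσ : 0 < σ) :
    ∃ C : ℝ, 0 < C ∧ ∀ K : ℝ, 1 ≤ K → ∃ (J : ℕ) (N : ℕ → ℕ), (∀ j, 1 ≤ N j) ∧
      (∀ j < J, (1 + j : ℝ) ^ (-σ) ≤ K ^ (-min ((m : ℝ) / n) σ) * (N j : ℝ) ^ m) ∧
      (1 + J : ℝ) ^ (-σ) ≤ K ^ (-min ((m : ℝ) / n) σ) ∧
      ∑ j ∈ Finset.range J, (N j : ℝ) ^ n ≤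
        C * (K * if σ = (m : ℝ) / n then 1 + Real.log K else 1) := by
  have hn : (0 : ℝ) < n := by exact_mod_cast Nat.pos_of_ne_zero (NeZero.ne n)
  have hm : (0 : ℝ) < m := by exact_mod_cast Nat.pos_of_ne_zero (NeZero.ne m)
  set r : ℝ := (m : ℝ) / n with hr
  have hr0 : 0 < r := by positivity
  set τ := min r σ with hτ
  have hτ0 : 0 < τ := lt_min hr0 hσ
  obtain ⟨C, hC, hsum⟩ := exists_rpow_mul_sum_le hr0 hσ
  refine ⟨2 ^ n * (2 + C), by positivity, fun K hK => ?_⟩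
  have hK0 : 0 < K := by linarith
  have hx : ∀ j : ℕ, 0 < K ^ (τ / m) * (1 + j : ℝ) ^ (-(σ / m)) := fun j => by positivity
  -- The conditions (1 + J) ^ (-σ) ≤ K ^ (-τ) and (1 + j) ^ (-σ) ≤ K ^ (-τ) N_j ^ m, solved for J
  -- and N_j. Rounding up adds at most a constant times J ≤ 2 K cells, because τ ≤ σ.
  refine ⟨⌈K ^ (τ / σ)⌉₊, fun j => ⌈K ^ (τ / m) * (1 + j : ℝ) ^ (-(σ / m))⌉₊,
    fun j => Nat.one_le_ceil_iff.2 (hx j), fun j _ => ?_, ?_, ?_⟩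
  · have h1 : (K ^ (τ / m) * (1 + j : ℝ) ^ (-(σ / m))) ^ m ≤
        (⌈K ^ (τ / m) * (1 + j : ℝ) ^ (-(σ / m))⌉₊ : ℝ) ^ m := by
      gcongr
      exact Nat.le_ceil _
    rw [mul_pow, ← Real.rpow_mul_natCast hK0.le, ← Real.rpow_mul_natCast (by positivity),
      div_mul_cancel₀ _ hm.ne', neg_mul, div_mul_cancel₀ _ hm.ne'] at h1
    calc (1 + j : ℝ) ^ (-σ) = K ^ (-τ) * (K ^ τ * (1 + j : ℝ) ^ (-σ)) := by
          rw [← mul_assoc, ← Real.rpow_add hK0, neg_add_cancel, Real.rpow_zero, one_mul]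
      _ ≤ _ := by gcongr
  · have h1 : K ^ (τ / σ) ≤ 1 + (⌈K ^ (τ / σ)⌉₊ : ℝ) := (Nat.le_ceil _).trans (by linarith)
    refine (Real.rpow_le_rpow_of_nonpos (by positivity) h1 (by linarith)).trans_eq ?_
    rw [← Real.rpow_mul hK0.le]
    congr 1
    field_simp
  · have hJ : (⌈K ^ (τ / σ)⌉₊ : ℝ) ≤ 2 * K := by
      have h1 : K ^ (τ / σ) ≤ K := by
        conv_rhs => rw [← Real.rpow_one K]
        exact Real.rpow_le_rpow_of_exponent_le hK ((div_le_one hσ).2 (min_le_right _ _))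
      have := Nat.ceil_lt_add_one (by positivity : 0 ≤ K ^ (τ / σ))
      linarith
    have hΛ : 1 ≤ if σ = r then 1 + Real.log K else 1 := by
      split_ifs
      · linarith [Real.log_nonneg hK]
      · exact le_rfl
    have hN : ∀ j : ℕ, (⌈K ^ (τ / m) * (1 + j : ℝ) ^ (-(σ / m))⌉₊ : ℝ) ^ n ≤
        2 ^ n * (1 + K ^ (τ / r) * (1 + j : ℝ) ^ (-(σ / r))) := by
      intro j
      set x := K ^ (τ / m) * (1 + j : ℝ) ^ (-(σ / m)) with hxdef
      have hxn : x ^ n = K ^ (τ / r) * (1 + j : ℝ) ^ (-(σ / r)) := by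
        rw [hxdef, mul_pow, ← Real.rpow_mul_natCast hK0.le,
          ← Real.rpow_mul_natCast (by positivity), hr, div_div_eq_mul_div, div_div_eq_mul_div]
        congr 2 <;> ring
      rw [← hxn]
      have h1 := (Nat.ceil_lt_add_one (hx j).le).le
      have hx0 := hx j
      rcases le_total x 1 with hx1 | hx1
      · calc (⌈x⌉₊ : ℝ) ^ n ≤ 2 ^ n := by gcongr; linarith
          _ ≤ _ := le_mul_of_one_le_right (by positivity) (by linarith [pow_pos hx0 n])
      · calc (⌈x⌉₊ : ℝ) ^ n ≤ (2 * x) ^ n := by gcongr; linarith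
          _ = 2 ^ n * x ^ n := mul_pow _ _ _
          _ ≤ _ := by gcongr; linarith
    set Λ := if σ = r then 1 + Real.log K else 1
    calc _ ≤ ∑ j ∈ Finset.range ⌈K ^ (τ / σ)⌉₊,
          2 ^ n * (1 + K ^ (τ / r) * (1 + j : ℝ) ^ (-(σ / r))) := Finset.sum_le_sum fun j _ => hN j
      _ = 2 ^ n * ((⌈K ^ (τ / σ)⌉₊ : ℝ) + K ^ (τ / r) *
            ∑ j ∈ Finset.range ⌈K ^ (τ / σ)⌉₊, (1 + j : ℝ) ^ (-(σ / r))) := by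
          rw [← Finset.mul_sum, Finset.sum_add_distrib, ← Finset.mul_sum]
          simp
      _ ≤ 2 ^ n * (2 * K * Λ + C * (K * Λ)) := by
          have h1 := hsum K hK _ hJ
          have h2 := hJ.trans (le_mul_of_one_le_right (by positivity) hΛ)
          gcongr 2 ^ n * ?_
          exact add_le_add h2 h1
      _ = _ := by ring

theorem exists_entropyNumber_idEmbedding_le (n m : ℕ) [NeZero n] [NeZero m] (p : ℝ) {σ : ℝ}
    [Fact (1 ≤ p)] (hσ : 0 < σ) :
    (∃ C, 0 < C ∧ ∀ k : ℕ, 1 ≤ k → entropyNumber (idEmbedding n m p σ) k ≤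
      C * ((if σ = (m : ℝ) / n then 1 + Real.log k else 1) / k) ^ min ((m : ℝ) / n) σ) ∧
    IsCompactOperator (idEmbedding n m p σ) := by
  have hn : (0 : ℝ) < n := by exact_mod_cast Nat.pos_of_ne_zero (NeZero.ne n)
  have hm : (0 : ℝ) < m := by exact_mod_cast Nat.pos_of_ne_zero (NeZero.ne m)
  obtain ⟨C₀, C₁, hC₁, happrox⟩ := exists_subspace_approx n m p hσ
  obtain ⟨C, hC, hgrid⟩ := exists_grid (n := n) (m := m) hσ
  have key := exists_entropyNumber_le (idEmbedding n m p σ) (τ := min ((m : ℝ) / n) σ)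
    (C₀ := 2 * (|C₀| + 1)) (C₁ := C₁ * C) (lt_min (by positivity) hσ) (by positivity)
    (fun K => if σ = (m : ℝ) / n then 1 + Real.log K else 1)
    (fun K hK => by
      split_ifs
      · linarith [Real.log_nonneg hK]
      · exact le_rfl)
    (fun x y hx hxy => by
      split_ifs
      · linarith [Real.log_le_log (by linarith) hxy]
      · exact le_rfl)
    (fun K hK => by
      have hK0 : 0 < K := by linarith
      obtain ⟨J, N, hN, h1, h2, h3⟩ := hgrid K hK
      obtain ⟨V, hV, hrank, hdist⟩ := happrox J N _ hN (by positivity) h1 h2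
      refine ⟨V, hV, ?_, fun u hu => ?_⟩
      · refine hrank.trans ?_
        rw [mul_assoc]
        gcongr
      · rw [mul_assoc]
        refine exists_mem_norm_sub_le_of_completion _ V (by positivity) (fun φ => ?_) hu
        obtain ⟨v, hv, hv'⟩ := hdist φ
        refine ⟨v, hv, ?_⟩
        rw [idEmbedding_coe hσ]
        refine hv'.trans ?_
        gcongr
        linarith [le_abs_self C₀])
  refine ⟨key.1, (isCompactOperator_iff_isCompact_closure_image_closedBall _ one_pos).2 ?_⟩
  exact key.2.closure.isCompact_of_isClosed isClosed_closure

end Count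

/-! ### Functions with disjoint supports -/

section Disjoint

open scoped ENNReal
open Module

variable {n m : ℕ} {p σ : ℝ} {ι : Type*} [Fintype ι]

theorem enorm_sum_rpow_of_forall_eq {G : Type*} [NormedAddCommGroup G] (hp : 0 < p) {v : ι → G}
    (hv : ∀ a b, v a ≠ 0 → v b ≠ 0 → a = b) : ‖∑ a, v a‖ₑ ^ p = ∑ a, ‖v a‖ₑ ^ p := by
  have h0 : ‖(0 : G)‖ₑ ^ p = 0 := by
    rw [← ofReal_norm, norm_zero, ENNReal.ofReal_zero, ENNReal.zero_rpow_of_pos hp]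
  by_cases h : ∃ a, v a ≠ 0
  · obtain ⟨a, ha⟩ := h
    have hb : ∀ b, b ≠ a → v b = 0 := fun b hba => by
      by_contra hne
      exact hba (hv b a hne ha)
    rw [Finset.sum_eq_single a (fun b _ hba => hb b hba) (by simp),
      Finset.sum_eq_single a (fun b _ hba => by rw [hb b hba, h0]) (by simp)]
  · push Not at h
    simp only [h, Finset.sum_const_zero, h0]

theorem iteratedFDeriv_sum_const_smul {E : Type*} [NormedAddCommGroup E] [NormedSpace ℝ E]
    {g : ι → E → ℂ} (hg : ∀ a, ContDiff ℝ m (g a)) (c : ι → ℂ) (x : E) :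
    iteratedFDeriv ℝ m (∑ a, c a • g a) x = ∑ a, c a • iteratedFDeriv ℝ m (g a) x := by
  have h : ∀ a, ContDiff ℝ m (c a • g a) := fun a => (hg a).const_smul (c a)
  rw [iteratedFDeriv_sum_apply fun a _ => (h a).contDiffAt]
  exact Finset.sum_congr rfl fun a _ => iteratedFDeriv_const_smul_apply (hg a).contDiffAt

namespace CZero

/-- The underlying function, as a linear map. -/
def coeLinearMap : CZero n m p σ →ₗ[ℂ] (EuclideanSpace ℝ (Fin n) → ℂ) where
  toFun φ := φ
  map_add' _ _ := rfl
  map_smul' _ _ := rfl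

theorem coe_sum_smul (f : ι → CZero n m p σ) (c : ι → ℂ) :
    ((∑ a, c a • f a : CZero n m p σ) : EuclideanSpace ℝ (Fin n) → ℂ) =
      ∑ a, c a • (f a : EuclideanSpace ℝ (Fin n) → ℂ) := by
  change coeLinearMap (∑ a, c a • f a) = ∑ a, c a • coeLinearMap (f a)
  simp only [map_sum, map_smul]

variable {f : ι → CZero n m p σ}
  (hf : ∀ a b x, x ∈ tsupport (f a : EuclideanSpace ℝ (Fin n) → ℂ) →
    x ∈ tsupport (f b : EuclideanSpace ℝ (Fin n) → ℂ) → a = b)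

include hf

/-- At each point at most one summand has a nonzero derivative. Disjointness is required of the
closed supports because these contain the supports of the derivatives. -/
theorem energy_sum_smul (hp : 0 < p) (c : ι → ℂ) :
    energy (∑ a, c a • f a) = ∑ a, ‖c a‖ₑ ^ p * (f a).energy := by
  have hmeas : ∀ φ : CZero n m p σ, Measurable fun x => logWeight (σ * p) x *
      (‖x‖ₑ ^ m * ‖iteratedFDeriv ℝ m (φ : EuclideanSpace ℝ (Fin n) → ℂ) x‖ₑ) ^ p := fun φ =>
    (measurable_logWeight _).mul (((measurable_enorm.pow_const m).mul
      (φ.contDiff.continuous_iteratedFDeriv le_rfl).enorm.measurable).pow_const p)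
  simp only [energy]
  rw [Finset.sum_congr rfl fun a _ => (lintegral_const_mul (‖c a‖ₑ ^ p) (hmeas (f a))).symm,
    ← lintegral_finsetSum _ fun a _ => (hmeas (f a)).const_mul _]
  refine lintegral_congr fun x => ?_
  have h1 : iteratedFDeriv ℝ m ((∑ a, c a • f a : CZero n m p σ) : EuclideanSpace ℝ (Fin n) → ℂ) x
      = ∑ a, c a • iteratedFDeriv ℝ m (f a : EuclideanSpace ℝ (Fin n) → ℂ) x := by
    rw [coe_sum_smul]
    exact iteratedFDeriv_sum_const_smul (fun a => (f a).contDiff) c x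
  have h2 : ∀ a, c a • iteratedFDeriv ℝ m (f a : EuclideanSpace ℝ (Fin n) → ℂ) x ≠ 0 →
      x ∈ tsupport (f a : EuclideanSpace ℝ (Fin n) → ℂ) := fun a ha => by
    refine support_iteratedFDeriv_subset (𝕜 := ℝ) m fun h0 => ha ?_
    rw [h0, smul_zero]
  rw [h1, ENNReal.mul_rpow_of_nonneg _ _ hp.le,
    enorm_sum_rpow_of_forall_eq hp fun a b ha hb => hf a b x (h2 a ha) (h2 b hb),
    Finset.mul_sum, Finset.mul_sum]
  refine Finset.sum_congr rfl fun a _ => ?_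
  rw [enorm_smul, ENNReal.mul_rpow_of_nonneg _ _ hp.le, ENNReal.mul_rpow_of_nonneg _ _ hp.le]
  ring

theorem lintegral_sum_smul (hp : 0 < p) (c : ι → ℂ) :
    ∫⁻ x in Metric.ball 0 1, ‖(∑ a, c a • f a : CZero n m p σ) x‖ₑ ^ p =
      ∑ a, ‖c a‖ₑ ^ p * ∫⁻ x in Metric.ball 0 1, ‖f a x‖ₑ ^ p := by
  have hmeas : ∀ φ : CZero n m p σ, Measurable fun x => ‖φ x‖ₑ ^ p := fun φ =>
    φ.continuous.enorm.measurable.pow_const p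
  rw [Finset.sum_congr rfl fun a _ => (lintegral_const_mul (‖c a‖ₑ ^ p) (hmeas (f a))).symm,
    ← lintegral_finsetSum _ fun a _ => (hmeas (f a)).const_mul _]
  refine lintegral_congr fun x => ?_
  have h2 : ∀ a, c a • f a x ≠ 0 → x ∈ tsupport (f a : EuclideanSpace ℝ (Fin n) → ℂ) :=
    fun a ha => subset_tsupport _ fun h0 => ha (by rw [h0, smul_zero])
  rw [coe_sum_smul, Finset.sum_apply]
  simp only [Pi.smul_apply]
  rw [enorm_sum_rpow_of_forall_eq hp fun a b ha hb => hf a b x (h2 a ha) (h2 b hb)]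
  refine Finset.sum_congr rfl fun a _ => ?_
  rw [enorm_smul, ENNReal.mul_rpow_of_nonneg _ _ hp.le]

/-- Energy and p-th power of the L_p norm are both additive on the span, so a bound for each f a
carries over to all combinations, with the same D. -/
theorem exists_subspace_norm_le [NeZero n] [NeZero m] [hp : Fact (1 ≤ p)] (hσ : 0 < σ) {D : ℝ≥0∞}
    (hD : D ≠ ⊤)
    (hf0 : ∀ a, ∫⁻ x in Metric.ball 0 1, ‖f a x‖ₑ ^ p ≠ 0)
    (hfD : ∀ a, (f a).energy ≤ D * ∫⁻ x in Metric.ball 0 1, ‖f a x‖ₑ ^ p) :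
    ∃ V : Submodule ℂ (ESpace n m p σ), FiniteDimensional ℂ V ∧ finrank ℂ V = Fintype.card ι ∧
      ∀ u ∈ V, ‖u‖ ≤ (((Finset.Nat.antidiagonalTuple n m).card * D) ^ (1 / p)).toReal *
        ‖idEmbedding n m p σ u‖ := by
  have hp0 : 0 < p := by linarith [hp.out]
  let L : (ι → ℂ) →ₗ[ℂ] ESpace n m p σ :=
    (UniformSpace.Completion.toComplL : CZero n m p σ →L[ℂ] ESpace n m p σ).toLinearMap ∘ₗ
      Fintype.linearCombination ℂ f
  have hL : ∀ c, L c = ((∑ a, c a • f a : CZero n m p σ) : ESpace n m p σ) := fun c => rfl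
  have hJ : ∀ c, ‖idEmbedding n m p σ (L c)‖ₑ ^ p =
      ∑ a, ‖c a‖ₑ ^ p * ∫⁻ x in Metric.ball 0 1, ‖f a x‖ₑ ^ p := fun c => by
    rw [hL, idEmbedding_coe hσ, ← lintegral_sum_smul hf hp0 c]
    exact enorm_toLp_rpow (memLp _)
  have hinj : Function.Injective L := by
    rw [← LinearMap.ker_eq_bot, LinearMap.ker_eq_bot']
    intro c hc
    have h1 := hJ c
    rw [hc, map_zero, enorm_zero, ENNReal.zero_rpow_of_pos hp0, eq_comm,
      Finset.sum_eq_zero_iff] at h1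
    funext a
    have h2 := (mul_eq_zero.1 (h1 a (Finset.mem_univ a))).resolve_right (hf0 a)
    simpa [hp0.le, hp0, ENNReal.rpow_eq_zero_iff] using h2
  refine ⟨LinearMap.range L, inferInstance, ?_, ?_⟩
  · rw [LinearMap.finrank_range_of_inj hinj, finrank_fintype_fun_eq_card]
  · rintro _ ⟨c, rfl⟩
    refine norm_le_of_enorm_rpow_le hp0 (by finiteness) ?_
    rw [hJ]
    have h1 : ‖L c‖ₑ = ‖(∑ a, c a • f a : CZero n m p σ)‖ₑ := by
      rw [hL, ← ofReal_norm, ← ofReal_norm, UniformSpace.Completion.norm_coe]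
    rw [h1, mul_assoc]
    refine (enorm_rpow_le_card_mul_energy _).trans ?_
    gcongr
    rw [energy_sum_smul hf hp0, Finset.mul_sum]
    refine Finset.sum_le_sum fun a _ => ?_
    calc ‖c a‖ₑ ^ p * (f a).energy
        ≤ ‖c a‖ₑ ^ p * (D * ∫⁻ x in Metric.ball 0 1, ‖f a x‖ₑ ^ p) := by gcongr; exact hfD a
      _ = _ := by ring

end CZero

end Disjoint

/-! ### Bump functions in the cells, and the general lower bound -/

section Bump

open scoped ENNReal
open Module

variable {n m : ℕ} {p σ : ℝ}

theorem norm_iteratedFDeriv_comp_add_smul_le {E F : Type*} [NormedAddCommGroup E] [NormedSpace ℝ E]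
    [NormedAddCommGroup F] [NormedSpace ℝ F] {u : E → F} (hu : ContDiff ℝ m u) (w : E) {s : ℝ}
    (hs : 0 ≤ s) (x : E) :
    ‖iteratedFDeriv ℝ m (fun x => u (w + s • x)) x‖ ≤ s ^ m * ‖iteratedFDeriv ℝ m u (w + s • x)‖ := by
  have h1 := ContinuousLinearMap.iteratedFDeriv_comp_right (s • ContinuousLinearMap.id ℝ E)
    (f := fun y => u (w + y)) (hu.comp (contDiff_const.add contDiff_id)) x (i := m) le_rfl
  have h2 : (fun y => u (w + y)) ∘ (s • ContinuousLinearMap.id ℝ E) = fun x => u (w + s • x) := rfl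
  rw [h2, iteratedFDeriv_comp_add_left] at h1
  rw [h1, mul_comm]
  refine (ContinuousMultilinearMap.norm_compContinuousLinearMap_le _ _).trans ?_
  simp only [Finset.prod_const, Finset.card_univ, Fintype.card_fin]
  have h3 : ‖s • ContinuousLinearMap.id ℝ E‖ ≤ s :=
    ContinuousLinearMap.opNorm_le_bound _ hs fun y => by simp [norm_smul, abs_of_nonneg hs]
  gcongr
  exact le_rfl

/-- A complex-valued smooth bump function supported in the closed ball of radius `1 / 4`. -/
noncomputable def bump (n : ℕ) (x : EuclideanSpace ℝ (Fin n)) : ℂ :=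
  ((⟨1 / 8, 1 / 4, by norm_num, by norm_num⟩ : ContDiffBump (0 : EuclideanSpace ℝ (Fin n))) x : ℝ)

theorem contDiff_bump {k : ℕ∞} : ContDiff ℝ k (bump n) :=
  Complex.ofRealCLM.contDiff.comp (ContDiffBump.contDiff _)

theorem bump_zero : bump n 0 = 1 := by
  rw [bump, ContDiffBump.one_of_mem_closedBall]
  · simp
  · simp

theorem bump_eq_zero {x : EuclideanSpace ℝ (Fin n)} (hx : 1 / 4 ≤ ‖x‖) : bump n x = 0 := by
  rw [bump, ContDiffBump.zero_of_le_dist]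
  · simp
  · simpa using hx

theorem hasCompactSupport_bump : HasCompactSupport (bump n) :=
  HasCompactSupport.intro (isCompact_closedBall 0 (1 / 4)) fun x hx =>
    bump_eq_zero (by simpa using (not_le.1 fun h => hx (by simpa using h)).le)

theorem lintegral_enorm_rpow_ne_top {F : Type*} [NormedAddCommGroup F]
    {g : EuclideanSpace ℝ (Fin n) → F} (hg : Continuous g) (hc : HasCompactSupport g) (hp : 0 < p) :
    ∫⁻ x, ‖g x‖ₑ ^ p ≠ ⊤ := by
  have h := (hg.memLp_of_hasCompactSupport (μ := volume) (p := ENNReal.ofReal p) hc).2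
  have h1 := lintegral_rpow_enorm_lt_top_of_eLpNorm_lt_top (by simpa using hp)
    ENNReal.ofReal_ne_top h
  rwa [ENNReal.toReal_ofReal hp.le, lt_top_iff_ne_top] at h1

theorem lintegral_bump_ne_zero (hp : 0 < p) : ∫⁻ x, ‖bump n x‖ₑ ^ p ≠ 0 := by
  intro h
  have hcont : Continuous (bump n) := (contDiff_bump (k := 0)).continuous
  rw [lintegral_eq_zero_iff (hcont.enorm.measurable.pow_const p)] at h
  have h1 : bump n =ᵐ[volume] fun _ => (0 : ℂ) := by
    filter_upwards [h] with x hx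
    simpa [ENNReal.rpow_eq_zero_iff, hp, hp.le] using hx
  have h2 := (hcont.ae_eq_iff_eq volume continuous_const).1 h1
  simpa [bump_zero] using congrFun h2 0

/-- The centre of the cell with index `z`, in units of the side of the cell. -/
noncomputable def cellCenter (z : Fin n → ℤ) : EuclideanSpace ℝ (Fin n) :=
  WithLp.toLp 2 fun i => (z i : ℝ) + 1 / 2

/-- The bump function scaled to the cell with side `δ` and index `z`. -/
noncomputable def cellBump (δ : ℝ) (z : Fin n → ℤ) (x : EuclideanSpace ℝ (Fin n)) : ℂ :=
  bump n (-cellCenter z + δ⁻¹ • x)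

theorem contDiff_cellBump (δ : ℝ) (z : Fin n → ℤ) {k : ℕ∞} : ContDiff ℝ k (cellBump δ z) :=
  contDiff_bump.comp (contDiff_const.add (contDiff_id.const_smul _))

theorem tsupport_cellBump_subset (δ : ℝ) (z : Fin n → ℤ) :
    tsupport (cellBump δ z) ⊆ cell δ z := by
  have h1 : tsupport (cellBump δ z) ⊆ {x | ‖-cellCenter z + δ⁻¹ • x‖ ≤ 1 / 4} := by
    refine closure_minimal (fun x hx => ?_) (isClosed_le (by fun_prop) continuous_const)
    by_contra h
    exact hx (bump_eq_zero (not_le.1 h).le)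
  refine h1.trans fun x hx i => ?_
  have h2 := (PiLp.norm_apply_le (-cellCenter z + δ⁻¹ • x) i).trans hx
  have h3 : (-cellCenter z + δ⁻¹ • x) i = x i / δ - ((z i : ℝ) + 1 / 2) := by
    simp [cellCenter]; ring
  rw [h3, Real.norm_eq_abs, abs_le] at h2
  rw [Int.floor_eq_iff]
  constructor <;> linarith [h2.1, h2.2]

/-- The indices of cells in the positive orthant of the shells with numbers in `[n, J)`. -/
noncomputable def bumpIndex (n : ℕ) (N : ℕ → ℕ) (J : ℕ) : Finset (Σ _ : ℕ, Fin n → ℤ) :=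
  (Finset.Ico n J).sigma fun j =>
    Fintype.piFinset fun _ : Fin n => Finset.Ico (N j : ℤ) (2 * N j : ℕ)

theorem card_bumpIndex (N : ℕ → ℕ) (J : ℕ) :
    (bumpIndex n N J).card = ∑ j ∈ Finset.Ico n J, N j ^ n := by
  rw [bumpIndex, Finset.card_sigma]
  refine Finset.sum_congr rfl fun j _ => ?_
  rw [Fintype.card_piFinset, Finset.prod_const, Int.card_Ico, Finset.card_univ, Fintype.card_fin]
  congr 1
  omega

theorem bumpIndex_subset [NeZero n] (N : ℕ → ℕ) (J : ℕ) : bumpIndex n N J ⊆ shellIndex n N J := by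
  classical
  rintro ⟨j, z⟩ hz
  simp only [bumpIndex, shellIndex, Finset.mem_sigma, Finset.mem_sdiff, Fintype.mem_piFinset,
    Finset.mem_Ico, Finset.mem_range] at hz ⊢
  refine ⟨hz.1.2, fun i => ⟨by have := hz.2 i; omega, (hz.2 i).2⟩, fun h => ?_⟩
  have h1 := hz.2 0
  have h2 := h 0
  omega

variable {N : ℕ → ℕ} (hN : ∀ j, 1 ≤ N j)

include hN

/-- The reason for starting at the shell n: n 2 ^ (-j) < 1 for j ≥ n. -/
theorem norm_lt_one_of_mem_cell [NeZero n] {J : ℕ} {a : Σ _ : ℕ, Fin n → ℤ}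
    (ha : a ∈ bumpIndex n N J) {x : EuclideanSpace ℝ (Fin n)} (hx : x ∈ cell (side N a.1) a.2) :
    ‖x‖ < 1 := by
  have h1 := norm_le_of_mem_box (by positivity)
    (mem_shell_of_mem_cell hN (bumpIndex_subset N J ha) hx).2.1
  have h2 : n ≤ a.1 := (Finset.mem_Ico.1 (Finset.mem_sigma.1 ha).1).1
  have h3 : n < 2 ^ a.1 := n.lt_two_pow_self.trans_le (Nat.pow_le_pow_right two_pos h2)
  have h4 : (n : ℝ) < 2 ^ a.1 := by exact_mod_cast h3
  refine h1.trans_lt ?_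
  rw [one_div, inv_pow, ← div_eq_mul_inv, div_lt_one (by positivity)]
  exact h4

/-- The scaled bump functions as elements of `C₀^m(B)`. -/
noncomputable def bumpFamily [NeZero n] (m : ℕ) (p σ : ℝ) (J : ℕ) (a : bumpIndex n N J) :
    CZero n m p σ where
  toFun := cellBump (side N a.1.1) a.1.2
  contDiff' := contDiff_cellBump _ _
  hasCompactSupport' := (isCompact_closedBall 0 1).of_isClosed_subset (isClosed_tsupport _)
    fun _ hx => by
      simpa using (norm_lt_one_of_mem_cell hN a.2
        (tsupport_cellBump_subset _ _ hx)).le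
  tsupport_subset' := fun _ hx => by
    simpa [unitBall] using norm_lt_one_of_mem_cell hN a.2
      (tsupport_cellBump_subset _ _ hx)

theorem eq_of_mem_tsupport_bumpFamily [NeZero n] (J : ℕ) (a b : bumpIndex n N J)
    (x : EuclideanSpace ℝ (Fin n))
    (ha : x ∈ tsupport (bumpFamily hN m p σ J a : EuclideanSpace ℝ (Fin n) → ℂ))
    (hb : x ∈ tsupport (bumpFamily hN m p σ J b : EuclideanSpace ℝ (Fin n) → ℂ)) : a = b :=
  Subtype.ext (eq_of_mem_cell hN (bumpIndex_subset N J a.2) (bumpIndex_subset N J b.2)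
    (tsupport_cellBump_subset _ _ ha) (tsupport_cellBump_subset _ _ hb))

theorem lintegral_bumpFamily [NeZero n] (hp : 0 < p) (J : ℕ) (a : bumpIndex n N J) :
    ∫⁻ x in Metric.ball 0 1, ‖bumpFamily hN m p σ J a x‖ₑ ^ p =
      ENNReal.ofReal (((side N a.1.1)⁻¹ ^ n)⁻¹) * ∫⁻ x, ‖bump n x‖ₑ ^ p := by
  have hcont : Continuous (bump n) := (contDiff_bump (k := 0)).continuous
  have h1 := lintegral_comp_add_smul (volume : Measure (EuclideanSpace ℝ (Fin n)))
    (hcont.enorm.measurable.pow_const p) (-cellCenter a.1.2) (inv_pos.2 (side_pos hN a.1.1))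
  rw [finrank_euclideanSpace_fin] at h1
  rw [← h1, ← lintegral_indicator measurableSet_ball]
  refine lintegral_congr fun x => ?_
  by_cases hx : x ∈ Metric.ball (0 : EuclideanSpace ℝ (Fin n)) 1
  · rw [indicator_of_mem hx]; rfl
  · rw [indicator_of_notMem hx]
    have h2 : cellBump (side N a.1.1) a.1.2 x = 0 :=
      image_eq_zero_of_notMem_tsupport fun h => hx ((bumpFamily hN m p σ J a).tsupport_subset h)
    rw [cellBump] at h2
    rw [h2, enorm_zero, ENNReal.zero_rpow_of_pos hp]

/-- On the cell ‖x‖ / side ≤ 2 n N_j, and the logarithmic factor is at most (2 (1 + j)) ^ σ. The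
weighted derivative therefore gains at most a constant times N_j ^ m (1 + j) ^ σ ≤ 1 / δ. -/
theorem energy_bumpFamily_le [NeZero n] (hp : 0 < p) (hσ : 0 ≤ σ) (J : ℕ) (a : bumpIndex n N J)
    {δ : ℝ} (hδ : 0 < δ) (ha : δ * ((N a.1.1 : ℝ) ^ m * (1 + a.1.1 : ℝ) ^ σ) ≤ 1) :
    (bumpFamily hN m p σ J a).energy ≤ ENNReal.ofReal ((2 ^ σ * (2 * n) ^ m / δ) ^ p) *
      (ENNReal.ofReal (((side N a.1.1)⁻¹ ^ n)⁻¹) * ∫⁻ x, ‖iteratedFDeriv ℝ m (bump n) x‖ₑ ^ p) := by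
  have hside := side_pos hN a.1.1
  have hcd : ContDiff ℝ m (bump n) := contDiff_bump
  have h1 := lintegral_comp_add_smul (volume : Measure (EuclideanSpace ℝ (Fin n)))
    ((hcd.continuous_iteratedFDeriv le_rfl).enorm.measurable.pow_const p) (-cellCenter a.1.2)
    (inv_pos.2 hside)
  rw [finrank_euclideanSpace_fin] at h1
  rw [← h1, ← lintegral_const_mul' _ _ ENNReal.ofReal_ne_top]
  refine (lintegral_mono fun x => ?_).trans (setLIntegral_le_lintegral _ _)
  by_cases hx : x ∈ tsupport (bumpFamily hN m p σ J a : EuclideanSpace ℝ (Fin n) → ℂ)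
  · have hxc := tsupport_cellBump_subset _ _ hx
    obtain ⟨-, hx1, hx2⟩ := mem_shell_of_mem_cell hN (bumpIndex_subset N J a.2) hxc
    have hlt := norm_lt_one_of_mem_cell hN a.2 hxc
    have hle := norm_le_of_mem_box (by positivity) hx1
    have hge := le_norm_of_notMem_box hx2
    have hpos : 0 < ‖x‖ := lt_of_lt_of_le (by positivity) hge
    have hlog : 1 + |Real.log ‖x‖| ≤ 2 * (1 + a.1.1) := by
      rw [abs_of_nonpos (Real.log_nonpos hpos.le hlt.le)]
      have h2 := Real.log_le_log (by positivity) hge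
      rw [Real.log_pow, one_div, Real.log_inv] at h2
      have h3 := Real.log_two_lt_d9
      push_cast at h2
      have h4 : (0 : ℝ) ≤ a.1.1 := Nat.cast_nonneg _
      nlinarith
    have hD : ‖iteratedFDeriv ℝ m (bumpFamily hN m p σ J a : EuclideanSpace ℝ (Fin n) → ℂ) x‖ ≤
        (side N a.1.1)⁻¹ ^ m *
          ‖iteratedFDeriv ℝ m (bump n) (-cellCenter a.1.2 + (side N a.1.1)⁻¹ • x)‖ :=
      norm_iteratedFDeriv_comp_add_smul_le hcd _ (inv_pos.2 hside).le x
    set Du := iteratedFDeriv ℝ m (bump n) (-cellCenter a.1.2 + (side N a.1.1)⁻¹ • x)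
    rw [logWeight, ← ofReal_norm, ← ofReal_norm, ← ofReal_norm,
      ← ENNReal.ofReal_pow (norm_nonneg _), ← ENNReal.ofReal_mul (by positivity),
      ENNReal.ofReal_rpow_of_nonneg (by positivity) hp.le,
      ENNReal.ofReal_rpow_of_nonneg (by positivity) hp.le, ← ENNReal.ofReal_mul (by positivity),
      ← ENNReal.ofReal_mul (by positivity), Real.rpow_mul (by positivity),
      ← Real.mul_rpow (by positivity) (by positivity),
      ← Real.mul_rpow (by positivity) (by positivity)]
    refine ENNReal.ofReal_le_ofReal (Real.rpow_le_rpow (by positivity) ?_ hp.le)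
    have hNpos : (0 : ℝ) < N a.1.1 := by exact_mod_cast hN a.1.1
    calc (1 + |Real.log ‖x‖|) ^ σ * (‖x‖ ^ m *
          ‖iteratedFDeriv ℝ m (bumpFamily hN m p σ J a : EuclideanSpace ℝ (Fin n) → ℂ) x‖)
        ≤ (2 * (1 + a.1.1)) ^ σ * ((n * (1 / 2) ^ a.1.1) ^ m *
          ((side N a.1.1)⁻¹ ^ m * ‖Du‖)) := by gcongr
      _ = 2 ^ σ * (2 * n) ^ m * ((N a.1.1 : ℝ) ^ m * (1 + a.1.1 : ℝ) ^ σ) * ‖Du‖ := by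
          have h5 : (n * (1 / 2) ^ a.1.1) * (side N a.1.1)⁻¹ = 2 * n * (N a.1.1 : ℝ) := by
            rw [side, pow_succ]; field_simp
          rw [Real.mul_rpow (by norm_num) (by positivity), ← mul_assoc (_ ^ m), ← mul_pow, h5,
            mul_pow]
          ring
      _ ≤ 2 ^ σ * (2 * n) ^ m * (1 / δ) * ‖Du‖ := by
          gcongr
          rwa [le_div_iff₀ hδ, mul_comm]
      _ = _ := by ring
  · have h2 : iteratedFDeriv ℝ m (bumpFamily hN m p σ J a : EuclideanSpace ℝ (Fin n) → ℂ) x = 0 := by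
      by_contra hne
      exact hx (support_iteratedFDeriv_subset (𝕜 := ℝ) m hne)
    rw [h2, ← ofReal_norm, ← ofReal_norm, norm_zero, ENNReal.ofReal_zero, mul_zero,
      ENNReal.zero_rpow_of_pos hp, mul_zero]
    exact zero_le

-- Bernstein's bound on the span of the bumps, whose dimension is ∑ N_j ^ n. The Jacobian of the
-- rescaling cancels between energy and L_p norm, so c is independent of the grid.
omit hN in
theorem exists_le_entropyNumber_idEmbedding (n m : ℕ) [NeZero n] [NeZero m] (p : ℝ) {σ : ℝ}
    [hp : Fact (1 ≤ p)] (hσ : 0 < σ) :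
    ∃ c : ℝ, 0 < c ∧ ∀ (J : ℕ) (N : ℕ → ℕ) (δ : ℝ) (k : ℕ), (∀ j, 1 ≤ N j) → 0 < δ → 1 ≤ k →
      (∀ j ∈ Finset.Ico n J, δ * ((N j : ℝ) ^ m * (1 + j : ℝ) ^ σ) ≤ 1) →
      k ≤ ∑ j ∈ Finset.Ico n J, N j ^ n → c * δ ≤ entropyNumber (idEmbedding n m p σ) k := by
  have hp0 : 0 < p := by linarith [hp.out]
  have hn : (0 : ℝ) < n := by exact_mod_cast Nat.pos_of_ne_zero (NeZero.ne n)
  set I₀ := ∫⁻ x, ‖bump n x‖ₑ ^ p with hI₀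
  set I₁ := ∫⁻ x, ‖iteratedFDeriv ℝ m (bump n) x‖ₑ ^ p with hI₁
  have hI₀0 : I₀ ≠ 0 := lintegral_bump_ne_zero hp0
  have hI₀top : I₀ ≠ ⊤ := lintegral_enorm_rpow_ne_top (contDiff_bump (k := 0)).continuous
    hasCompactSupport_bump hp0
  have hI₁top : I₁ ≠ ⊤ := lintegral_enorm_rpow_ne_top
    ((contDiff_bump (k := m)).continuous_iteratedFDeriv le_rfl)
    (hasCompactSupport_bump.iteratedFDeriv m) hp0
  set Q : ℝ≥0∞ := (Finset.Nat.antidiagonalTuple n m).card * (I₁ / I₀) with hQ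
  have hQtop : Q ≠ ⊤ := ENNReal.mul_ne_top (ENNReal.natCast_ne_top _) (ENNReal.div_ne_top hI₁top hI₀0)
  set B : ℝ := 2 ^ σ * (2 * n) ^ m with hB
  set A : ℝ := (Q ^ (1 / p)).toReal * B + 1 with hA
  have hA0 : 0 < A := by positivity
  refine ⟨(4 * A)⁻¹, by positivity, fun J N δ k hN hδ hk h hkN => ?_⟩
  have hside := fun j => side_pos hN j
  obtain ⟨V, hV, hrank, hnorm⟩ := CZero.exists_subspace_norm_le
    (f := bumpFamily hN m p σ J) (eq_of_mem_tsupport_bumpFamily (m := m) (p := p) (σ := σ) hN J) hσ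
    (D := ENNReal.ofReal ((B / δ) ^ p) * (I₁ / I₀))
    (ENNReal.mul_ne_top ENNReal.ofReal_ne_top (ENNReal.div_ne_top hI₁top hI₀0))
    (fun a => by
      rw [lintegral_bumpFamily (n := n) (m := m) (σ := σ) hN hp0 J a]
      have := hside a.1.1
      exact mul_ne_zero (by rw [Ne, ENNReal.ofReal_eq_zero, not_le]; positivity) hI₀0)
    (fun a => by
      refine (energy_bumpFamily_le hN hp0 hσ.le J a hδ
        (h a.1.1 (Finset.mem_sigma.1 a.2).1)).trans_eq ?_
      rw [lintegral_bumpFamily (n := n) (m := m) (σ := σ) hN hp0 J a, ← hI₀, ← hI₁, ← hB, mul_assoc, mul_left_comm (I₁ / I₀),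
        ENNReal.div_mul_cancel hI₀0 hI₀top])
  have hkV : k ≤ finrank ℂ V := by rwa [hrank, Fintype.card_coe, card_bumpIndex]
  have key := le_entropyNumber_of_subspace (idEmbedding n m p σ) hk (δ := δ / A) (by positivity) V
    hkV fun u hu => by
      have h1 := hnorm u hu
      have h2 : (((Finset.Nat.antidiagonalTuple n m).card *
          (ENNReal.ofReal ((B / δ) ^ p) * (I₁ / I₀))) ^ (1 / p)).toReal ≤ A / δ := by
        rw [mul_left_comm, ← hQ, ENNReal.mul_rpow_of_nonneg _ _ (by positivity),
          ENNReal.ofReal_rpow_of_nonneg (by positivity) (by positivity),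
          ← Real.rpow_mul (by positivity), mul_one_div_cancel hp0.ne', Real.rpow_one,
          ENNReal.toReal_mul, ENNReal.toReal_ofReal (by positivity), div_mul_eq_mul_div]
        gcongr
        rw [hA]
        linarith
      calc δ / A * ‖u‖ ≤ δ / A * (A / δ * ‖idEmbedding n m p σ u‖) := by
            gcongr
            exact h1.trans (by gcongr)
        _ = _ := by field_simp
  refine le_trans (le_of_eq ?_) key
  field_simp

end Bump

/-! ### The three lower rates, and the theorem -/

section Main

theorem log_sub_log_le_sum_Ico (n J : ℕ) :
    Real.log (1 + J) - Real.log (1 + n) ≤ ∑ j ∈ Finset.Ico n J, (1 / (1 + j) : ℝ) := by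
  rcases le_total J n with h | h
  · rw [Finset.Ico_eq_empty_of_le h, Finset.sum_empty, sub_nonpos]
    exact Real.log_le_log (by positivity) (by gcongr)
  · induction J, h using Nat.le_induction with
    | base => simp
    | succ J hJ ih =>
      rw [Finset.sum_Ico_succ_top hJ]
      have h1 : Real.log (1 + (J + 1 : ℕ)) - Real.log (1 + J) ≤ 1 / (1 + J) := by
        rw [← Real.log_div (by positivity) (by positivity)]
        refine (Real.log_le_sub_one_of_pos (by positivity)).trans_eq ?_
        push_cast
        field_simp
        ring
      linarith

/-- Only the shell n is used, with N about k ^ (1 / n), so the logarithmic factor is a constant. -/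
theorem exists_mul_rpow_neg_div_le_of_single_shell {n m : ℕ} [NeZero n] {σ c : ℝ}
    (hc : 0 < c) {e : ℕ → ℝ}
    (h : ∀ (J : ℕ) (N : ℕ → ℕ) (δ : ℝ) (k : ℕ), (∀ j, 1 ≤ N j) → 0 < δ → 1 ≤ k →
      (∀ j ∈ Finset.Ico n J, δ * ((N j : ℝ) ^ m * (1 + j : ℝ) ^ σ) ≤ 1) →
      k ≤ ∑ j ∈ Finset.Ico n J, N j ^ n → c * δ ≤ e k) :
    ∃ c₁ : ℝ, 0 < c₁ ∧ ∀ k : ℕ, 1 ≤ k → c₁ * (k : ℝ) ^ (-((m : ℝ) / n)) ≤ e k := by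
  have hn : (0 : ℝ) < n := by exact_mod_cast Nat.pos_of_ne_zero (NeZero.ne n)
  refine ⟨c * ((2 : ℝ) ^ m * (1 + n : ℝ) ^ σ)⁻¹, by positivity, fun k hk => ?_⟩
  have hk0 : (0 : ℝ) < k := by exact_mod_cast hk
  have hx : 1 ≤ (k : ℝ) ^ (1 / (n : ℝ)) := Real.one_le_rpow (by exact_mod_cast hk) (by positivity)
  have hle := Nat.le_ceil ((k : ℝ) ^ (1 / (n : ℝ)))
  have hlt := Nat.ceil_lt_add_one (by positivity : 0 ≤ (k : ℝ) ^ (1 / (n : ℝ)))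
  rw [mul_assoc]
  refine h (n + 1) (fun _ => ⌈(k : ℝ) ^ (1 / (n : ℝ))⌉₊) _ k
    (fun _ => Nat.one_le_ceil_iff.2 (by linarith)) (by positivity) hk (fun j hj => ?_) ?_
  · obtain rfl : j = n := by have := Finset.mem_Ico.1 hj; omega
    have h1 : (⌈(k : ℝ) ^ (1 / (j : ℝ))⌉₊ : ℝ) ^ m ≤ 2 ^ m * (k : ℝ) ^ ((m : ℝ) / j) := by
      calc (⌈(k : ℝ) ^ (1 / (j : ℝ))⌉₊ : ℝ) ^ m ≤ (2 * (k : ℝ) ^ (1 / (j : ℝ))) ^ m := by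
            gcongr; linarith
        _ = _ := by
            rw [mul_pow, ← Real.rpow_mul_natCast hk0.le, one_div_mul_eq_div]
    calc _ ≤ ((2 : ℝ) ^ m * (1 + j : ℝ) ^ σ)⁻¹ * (k : ℝ) ^ (-((m : ℝ) / j)) *
          (2 ^ m * (k : ℝ) ^ ((m : ℝ) / j) * (1 + j : ℝ) ^ σ) := by gcongr
      _ = 1 := by
          rw [Real.rpow_neg hk0.le]
          field_simp
  · rw [Nat.Ico_succ_singleton, Finset.sum_singleton]
    have h1 : (k : ℝ) ≤ (⌈(k : ℝ) ^ (1 / (n : ℝ))⌉₊ : ℝ) ^ n := by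
      calc (k : ℝ) = ((k : ℝ) ^ (1 / (n : ℝ))) ^ n := by
            rw [← Real.rpow_mul_natCast hk0.le, one_div_mul_cancel hn.ne', Real.rpow_one]
        _ ≤ _ := by gcongr
    exact_mod_cast h1

/-- The k shells from n on carry one bump each; the factor (1 + j) ^ σ is at most ((1 + n) k) ^ σ.
-/
theorem exists_mul_rpow_neg_le_of_single_cells {n m : ℕ} {σ c : ℝ} (hσ : 0 < σ)
    (hc : 0 < c) {e : ℕ → ℝ}
    (h : ∀ (J : ℕ) (N : ℕ → ℕ) (δ : ℝ) (k : ℕ), (∀ j, 1 ≤ N j) → 0 < δ → 1 ≤ k →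
      (∀ j ∈ Finset.Ico n J, δ * ((N j : ℝ) ^ m * (1 + j : ℝ) ^ σ) ≤ 1) →
      k ≤ ∑ j ∈ Finset.Ico n J, N j ^ n → c * δ ≤ e k) :
    ∃ c₁ : ℝ, 0 < c₁ ∧ ∀ k : ℕ, 1 ≤ k → c₁ * (k : ℝ) ^ (-σ) ≤ e k := by
  refine ⟨c * (1 + n : ℝ) ^ (-σ), by positivity, fun k hk => ?_⟩
  have hk1 : (1 : ℝ) ≤ k := by exact_mod_cast hk
  have hk0 : (0 : ℝ) < k := by linarith
  rw [mul_assoc, ← Real.mul_rpow (by positivity) hk0.le]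
  refine h (n + k) (fun _ => 1) _ k (fun _ => le_rfl) (by positivity) hk (fun j hj => ?_) (by simp)
  have h1 : (j : ℝ) + 1 ≤ n + k := by exact_mod_cast (Finset.mem_Ico.1 hj).2
  have h2 : (1 + j : ℝ) ≤ (1 + n) * k := by nlinarith [(Nat.cast_nonneg n : (0 : ℝ) ≤ n)]
  rw [Nat.cast_one, one_pow, one_mul, Real.rpow_neg (by positivity),
    inv_mul_le_one₀ (by positivity)]
  gcongr

/-- At the critical exponent all shells contribute: N_j ^ n of order K / (1 + j) makes N_j ^ m (1 +
j) ^ (m/n) of order K ^ (m/n) in each of them, and the harmonic sum raises the dimension to K log K.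
-/
theorem exists_mul_log_rpow_le_of_shells {n m : ℕ} [NeZero n] {c : ℝ}
    (hc : 0 < c) {e : ℕ → ℝ}
    (h : ∀ (J : ℕ) (N : ℕ → ℕ) (δ : ℝ) (k : ℕ), (∀ j, 1 ≤ N j) → 0 < δ → 1 ≤ k →
      (∀ j ∈ Finset.Ico n J, δ * ((N j : ℝ) ^ m * (1 + j : ℝ) ^ ((m : ℝ) / n)) ≤ 1) →
      k ≤ ∑ j ∈ Finset.Ico n J, N j ^ n → c * δ ≤ e k) :
    ∃ c₁ : ℝ, 0 < c₁ ∧ ∀ k : ℕ, 2 ≤ k →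
      c₁ * ((k : ℝ) ^ (-((m : ℝ) / n)) * Real.log k ^ ((m : ℝ) / n)) ≤ e k := by
  have hn : (0 : ℝ) < n := by exact_mod_cast Nat.pos_of_ne_zero (NeZero.ne n)
  -- A makes 2 ^ (-n) K (log k / 2) equal to k for K = A k / log k, and A ≥ 1 + n absorbs the
  -- missing first n terms of the harmonic sum.
  set A : ℝ := 2 ^ (n + 1) with hA
  have hA0 : 0 < A := by positivity
  refine ⟨c * A ^ (-((m : ℝ) / n)), by positivity, fun k hk => ?_⟩
  have hk2 : (2 : ℝ) ≤ k := by exact_mod_cast hk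
  have hk0 : (0 : ℝ) < k := by linarith
  have hlog : 0 < Real.log k := Real.log_pos (by linarith)
  set K : ℝ := A * k / Real.log k with hK
  have hK0 : 0 < K := by positivity
  have hδ : A ^ (-((m : ℝ) / n)) * ((k : ℝ) ^ (-((m : ℝ) / n)) * Real.log k ^ ((m : ℝ) / n)) =
      K ^ (-((m : ℝ) / n)) := by
    rw [hK, Real.div_rpow (by positivity) hlog.le, Real.mul_rpow hA0.le hk0.le,
      Real.rpow_neg hlog.le, div_inv_eq_mul, mul_assoc]
  rw [mul_assoc, hδ]
  set x : ℕ → ℝ := fun j => (K / (1 + j)) ^ (1 / (n : ℝ)) with hx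
  have hx0 : ∀ j, 0 < x j := fun j => by positivity
  have hx1 : ∀ j ∈ Finset.Ico n ⌊K⌋₊, 1 ≤ x j := fun j hj => by
    refine Real.one_le_rpow ?_ (by positivity)
    rw [one_le_div (by positivity)]
    have h1 : ((j + 1 : ℕ) : ℝ) ≤ ⌊K⌋₊ := by exact_mod_cast (Finset.mem_Ico.1 hj).2
    have h2 := Nat.floor_le hK0.le
    push_cast at h1
    linarith
  -- For j < ⌊K⌋ already x j ≥ 1; the maximum with 1 matters only beyond the shells in use.
  refine h ⌊K⌋₊ (fun j => max 1 ⌊x j⌋₊) _ k (fun j => le_max_left _ _) (by positivity) (by omega)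
    (fun j hj => ?_) ?_
  · have h1 : ((max 1 ⌊x j⌋₊ : ℕ) : ℝ) ≤ x j := by
      push_cast
      exact max_le (hx1 j hj) (Nat.floor_le (hx0 j).le)
    have h2 : x j ^ m = K ^ ((m : ℝ) / n) / (1 + j : ℝ) ^ ((m : ℝ) / n) := by
      rw [hx]
      dsimp only
      rw [← Real.rpow_mul_natCast (by positivity), one_div_mul_eq_div,
        Real.div_rpow hK0.le (by positivity)]
    calc _ ≤ K ^ (-((m : ℝ) / n)) * (x j ^ m * (1 + j : ℝ) ^ ((m : ℝ) / n)) := by gcongr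
      _ = 1 := by
        rw [h2, Real.rpow_neg hK0.le]
        field_simp
  · have h1 : ∀ j ∈ Finset.Ico n ⌊K⌋₊, (2 ^ n : ℝ)⁻¹ * K * (1 / (1 + j)) ≤
        ((max 1 ⌊x j⌋₊ : ℕ) : ℝ) ^ n := fun j hj => by
      have h2 : x j / 2 ≤ ((max 1 ⌊x j⌋₊ : ℕ) : ℝ) := by
        push_cast
        have h3 := Nat.lt_floor_add_one (x j)
        rcases le_total (⌊x j⌋₊ : ℝ) 1 with h4 | h4
        · exact le_max_of_le_left (by linarith)
        · exact le_max_of_le_right (by linarith)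
      have h5 : x j ^ n = K / (1 + j) := by
        rw [hx]
        dsimp only
        rw [← Real.rpow_mul_natCast (by positivity), one_div_mul_cancel hn.ne', Real.rpow_one]
      calc (2 ^ n : ℝ)⁻¹ * K * (1 / (1 + j)) = (x j / 2) ^ n := by
            rw [div_pow, h5]; ring
        _ ≤ _ := by
            have := hx0 j
            gcongr
    have h2 : Real.log k / 2 ≤ ∑ j ∈ Finset.Ico n ⌊K⌋₊, (1 / (1 + j) : ℝ) := by
      refine le_trans ?_ (log_sub_log_le_sum_Ico n ⌊K⌋₊)
      have h3 : Real.log K ≤ Real.log (1 + ⌊K⌋₊) :=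
        Real.log_le_log hK0 (by linarith [Nat.lt_floor_add_one K])
      have h4 : Real.log K = Real.log A + Real.log k - Real.log (Real.log k) := by
        rw [hK, Real.log_div (by positivity) hlog.ne', Real.log_mul hA0.ne' hk0.ne']
      have h5 : Real.log (1 + n) ≤ Real.log A := by
        refine Real.log_le_log (by positivity) ?_
        have : 1 + n ≤ 2 ^ (n + 1) := by
          have := (n + 1).lt_two_pow_self
          omega
        rw [hA]
        exact_mod_cast this
      have h6 : Real.log (Real.log k) ≤ Real.log k / 2 := by
        have h7 := Real.log_le_sub_one_of_pos (by positivity : 0 < Real.log k / 2)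
        rw [Real.log_div hlog.ne' two_ne_zero] at h7
        linarith [Real.log_two_lt_d9]
      linarith
    have h3 : (k : ℝ) ≤ ∑ j ∈ Finset.Ico n ⌊K⌋₊, ((max 1 ⌊x j⌋₊ : ℕ) : ℝ) ^ n := by
      calc (k : ℝ) = (2 ^ n : ℝ)⁻¹ * K * (Real.log k / 2) := by
            rw [hK, hA, pow_succ]
            field_simp
        _ ≤ (2 ^ n : ℝ)⁻¹ * K * ∑ j ∈ Finset.Ico n ⌊K⌋₊, (1 / (1 + j) : ℝ) := by gcongr
        _ = ∑ j ∈ Finset.Ico n ⌊K⌋₊, (2 ^ n : ℝ)⁻¹ * K * (1 / (1 + j)) := Finset.mul_sum _ _ _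
        _ ≤ _ := Finset.sum_le_sum h1
    exact_mod_cast h3

end Main

theorem theorem4p1 (n m : ℕ) [NeZero n] [NeZero m] (p σ : ℝ) [Fact (1 ≤ p)] (hσ : 0 < σ) :
    ∃ J : ESpace n m p σ →L[ℂ] LpBall n p,
      IsIdEmbedding J ∧ IsCompactOperator J ∧
      ((m : ℝ) / n < σ →
        EquivFrom 1 (entropyNumber J) fun k => (k : ℝ) ^ (-((m : ℝ) / n))) ∧
      (σ = (m : ℝ) / n →
        EquivFrom 2 (entropyNumber J) fun k =>
          (k : ℝ) ^ (-((m : ℝ) / n)) * Real.log k ^ ((m : ℝ) / n)) ∧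
      (σ < (m : ℝ) / n →
        EquivFrom 1 (entropyNumber J) fun k => (k : ℝ) ^ (-σ)) := by
  obtain ⟨⟨C, hC, hupper⟩, hcompact⟩ := exists_entropyNumber_idEmbedding_le n m p hσ
  obtain ⟨c, hc, hlower⟩ := exists_le_entropyNumber_idEmbedding n m p hσ
  refine ⟨idEmbedding n m p σ, isIdEmbedding_idEmbedding hσ, hcompact, fun h => ?_, ?_,
    fun h => ?_⟩
  · obtain ⟨c₁, hc₁, hl⟩ := exists_mul_rpow_neg_div_le_of_single_shell hc hlower
    refine ⟨c₁, C, hc₁, hC, fun k hk => ⟨hl k hk, (hupper k hk).trans_eq ?_⟩⟩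
    dsimp only
    rw [if_neg h.ne', min_eq_left h.le, one_div, Real.inv_rpow (by positivity),
      Real.rpow_neg (by positivity)]
  · rintro rfl
    obtain ⟨c₁, hc₁, hl⟩ := exists_mul_log_rpow_le_of_shells hc hlower
    -- 1 + log k ≤ 3 log k for k ≥ 2, as 2 log 2 > 1.
    refine ⟨c₁, C * 3 ^ ((m : ℝ) / n), hc₁, by positivity, fun k hk =>
      ⟨hl k hk, (hupper k (by omega)).trans ?_⟩⟩
    have hk2 : (2 : ℝ) ≤ k := by exact_mod_cast hk
    have hlog : Real.log 2 ≤ Real.log k := Real.log_le_log two_pos hk2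
    have hlog2 := Real.log_two_gt_d9
    dsimp only
    rw [if_pos rfl, min_self, mul_assoc, Real.rpow_neg (by positivity), mul_comm (_⁻¹),
      ← div_eq_mul_inv, ← Real.div_rpow (by linarith) (by positivity),
      ← Real.mul_rpow (by norm_num) (div_nonneg (by linarith) (by positivity)), ← mul_div_assoc]
    have h1 : 0 ≤ 1 + Real.log k := by linarith
    gcongr
    linarith
  · obtain ⟨c₁, hc₁, hl⟩ := exists_mul_rpow_neg_le_of_single_cells hσ hc hlower
    refine ⟨c₁, C, hc₁, hC, fun k hk => ⟨hl k hk, (hupper k hk).trans_eq ?_⟩⟩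
    dsimp only
    rw [if_neg h.ne, min_eq_right h.le, one_div, Real.inv_rpow (by positivity),
      Real.rpow_neg (by positivity)]
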